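/- Let $k\ge 1$ and let $\vec\alpha=(\alpha_1,\dots,\alpha_k)$ be non-negative integers. A translation surface of type $\vec\alpha$ is a compact connected surface $M$ with a set $\Sigma=\{\xi_1,\dots,\xi_k\}$ of $k$ labelled points (the singularities) and an atlas of planar charts on $M\smallsetminus\Sigma$ with translations as transition maps, such that $\xi_i$ is a cone point of angle $2\pi(\alpha_i+1)$; if $\alpha_i=0$, $\xi_i$ is called a marked point. The stratum $\mathcal H(\vec\alpha)$ is the set of translation surfaces of type $\vec\alpha$ up to label-preserving translation equivalence, with the topology given by period coordinates, and $\vec\alpha''=(\alpha_1,\dots,\alpha_k,0,0)$, so that $\mathcal H(\vec\alpha'')$ consists of surfaces with two additional marked points. A straight-line trajectory from $x\in M$ to $y\in M$ is a non-constant constant-velocity straight segment from $x$ to $y$ with no singularity in its interior. A blocking set for $(x,y)$ is a finite set $B\subset M$ which contains neither $x$ nor $y$ and meets every straight-line trajectory from $x$ to $y$. The blocking cardinality $\operatorname{bc}(x,y)\in\{0,1,2,\dots,\infty\}$ is the minimal cardinality of a blocking set ($\infty$ if there is none). Write $\widehat{M^2}=\{(x,y)\in(M\smallsetminus\Sigma)^2: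 x\ne y\}$. **Lemma 3.1.** For any fixed integer $n\ge 0$ the following hold. (I) For every translation surface $M$ of type $\vec\alpha$, the set $F_n(M)=\{(x,y)\in\widehat{M^2}:\operatorname{bc}(x,y)\le n\}$ is closed as a subset of $\widehat{M^2}$. (II) For every translation surface $M$ of type $\vec\alpha$ and every non-singular $x\in M$, the set $\{y\in M\smallsetminus(\Sigma\cup\{x\}):\operatorname{bc}(x,y)\le n\}$ is closed as a subset of $M\smallsetminus(\Sigma\cup\{x\})$. (III) The set of all surfaces in $\mathcal H(\vec\alpha'')$ on which the first and the second additional marked points have blocking cardinality at most $n$ is closed in $\mathcal H(\vec\alpha'')$ (hence its intersection with each connected component is closed in that component). (IV) The set of all $M_0\in\mathcal H(\vec\alpha)$ such that $\operatorname{bc}(x,y)\le n$ for every $(x,y)\in\widehat{M_0^2}$ is closed in $\mathcal H(\vec\alpha)$. Moreover, there is an integer $\ell$, depending only on $n$ and $\vec\alpha$, such that for every translation surface $M$ of type $\vec\alpha$: if $\{(x,y)\in M^2:\operatorname{bc}(x,y)\le n\}$ is dense in $M^2$, then $M$ has the bounded blocking property with bound $\ell$, that is, $\operatorname{bc}(x,y)\le\ell$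 for all $x,y\in M$. -/

import Mathlib

open Set Filter Topology

/-- A translation surface of type `α = (α₁, …, α_k)`: a compact connected Hausdorff space with `k`
labelled distinct points (the singularities), an atlas of planar charts on the complement of the
singularities whose transition maps are (locally) translations, such that the `i`-th singularity
is a cone point of angle `2π(αᵢ + 1)`. Marked points are singularities with `αᵢ = 0`. -/
structure TranslationSurface {k : ℕ} (α : Fin k → ℕ) : Type 1 where
  carrier : Type
  [top : TopologicalSpace carrier]
  [compact : CompactSpace carrier]
  [hausdorff : T2Space carrier]
  [connected : ConnectedSpace carrier]
  /-- the labelled singularities -/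
  sing : Fin k → carrier
  sing_injective : Function.Injective sing
  /-- the planar charts -/
  charts : Set (OpenPartialHomeomorph carrier ℂ)
  chart_regular : ∀ φ ∈ charts, ∀ p ∈ φ.source, p ∉ range sing
  chart_cover : ∀ p, p ∉ range sing → ∃ φ ∈ charts, p ∈ φ.source
  chart_translation : ∀ φ ∈ charts, ∀ ψ ∈ charts, ∀ p ∈ φ.source ∩ ψ.source,
    ∀ᶠ q in 𝓝 p, ψ q - φ q = ψ p - φ p
  /-- Near the `i`-th singularity there is a local coordinate `ζ` centred at it such that the
  planar charts agree, up to additive constants, with `ζ ^ (αᵢ + 1)`. -/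
  cone : ∀ i, ∃ ζ : OpenPartialHomeomorph carrier ℂ,
    sing i ∈ ζ.source ∧ ζ (sing i) = 0 ∧ (∀ j, sing j ∈ ζ.source → j = i) ∧
    ∀ φ ∈ charts, ∀ p ∈ φ.source ∩ ζ.source,
      ∀ᶠ q in 𝓝 p, φ q - ζ q ^ (α i + 1) = φ p - ζ p ^ (α i + 1)

namespace TranslationSurface

instance {k : ℕ} {α : Fin k → ℕ} : CoeSort (TranslationSurface α) Type := ⟨carrier⟩

attribute [instance] top compact hausdorff connected

variable {k : ℕ} {α : Fin k → ℕ}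

/-- The set `Σ` of singular points. -/
def singSet (M : TranslationSurface α) : Set M := range M.sing

/-- `γ : [0,1] → M` is a straight-line trajectory from `x` to `y`: it has constant nonzero
velocity `w` in every planar chart and no singular point in its interior. (The endpoints may be
singular, and may coincide.) -/
structure IsTrajectory (M : TranslationSurface α) (x y : M) (γ : ℝ → M) : Prop where
  continuousOn : ContinuousOn γ (Icc 0 1)
  start : γ 0 = x
  finish : γ 1 = y
  regular : ∀ t ∈ Ioo (0 : ℝ) 1, γ t ∉ M.singSet
  straight : ∃ w : ℂ, w ≠ 0 ∧ ∀ t ∈ Ioo (0 : ℝ) 1, ∀ φ ∈ M.charts, γ t ∈ φ.source →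
    ∀ᶠ s in 𝓝 t, φ (γ s) = φ (γ t) + ((s - t : ℝ) : ℂ) * w

/-- The finite set `B` is a blocking set for `(x, y)`. -/
def IsBlockingSet (M : TranslationSurface α) (x y : M) (B : Finset M) : Prop :=
  x ∉ B ∧ y ∉ B ∧ ∀ γ : ℝ → M, M.IsTrajectory x y γ → ∃ t ∈ Icc (0 : ℝ) 1, γ t ∈ B

/-- The blocking cardinality of `(x, y)`: the least cardinality of a (finite) blocking set, and
`⊤` if `(x, y)` is not finitely blocked. -/
noncomputable def bc (M : TranslationSurface α) (x y : M) : ℕ∞ :=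
  ⨅ (B : Finset M) (_ : M.IsBlockingSet x y B), (B.card : ℕ∞)

/-- `M` has the bounded blocking property with blocking cardinality at most `n`. -/
def BoundedBlocking (M : TranslationSurface α) (n : ℕ) : Prop :=
  ∀ x y : M, M.bc x y ≤ n

/-- The set of pairs of distinct nonsingular points. -/
def regularPairs (M : TranslationSurface α) : Set (M × M) :=
  {p | p.1 ∉ M.singSet ∧ p.2 ∉ M.singSet ∧ p.1 ≠ p.2}

/-- The set of pairs of distinct nonsingular points with blocking cardinality at most `n`. -/
def blockedPairs (M : TranslationSurface α) (n : ℕ) : Set (M × M) :=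
  {p | p ∈ M.regularPairs ∧ M.bc p.1 p.2 ≤ n}

/-- The set of nonsingular points other than `x`. -/
def regularPointsNe (M : TranslationSurface α) (x : M) : Set M :=
  {y | y ∉ M.singSet ∧ y ≠ x}

/-- The set of nonsingular `y ≠ x` such that `(x, y)` has blocking cardinality at most `n`. -/
def blockedFrom (M : TranslationSurface α) (x : M) (n : ℕ) : Set M :=
  {y | y ∈ M.regularPointsNe x ∧ M.bc x y ≤ n}

/-- A translation equivalence: a homeomorphism respecting the labelled singularities which is a
translation in charts. -/
structure IsTranslationEquiv (M N : TranslationSurface α) (f : M ≃ₜ N) : Prop where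
  map_sing : ∀ i, f (M.sing i) = N.sing i
  translation : ∀ φ ∈ M.charts, ∀ ψ ∈ N.charts, ∀ p ∈ φ.source, f p ∈ ψ.source →
    ∀ᶠ q in 𝓝 p, ψ (f q) - φ q = ψ (f p) - φ p

instance setoid (α : Fin k → ℕ) : Setoid (TranslationSurface α) where
  r M N := ∃ f : M ≃ₜ N, IsTranslationEquiv M N f
  iseqv :=
    { refl := fun M => ⟨Homeomorph.refl M, fun _ => rfl, fun φ hφ ψ hψ p hp hp' =>
        M.chart_translation φ hφ ψ hψ p ⟨hp, hp'⟩⟩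
      symm := by
        rintro M N ⟨f, hf⟩
        refine ⟨f.symm, fun i => by rw [← hf.map_sing i, f.symm_apply_apply], ?_⟩
        intro φ hφ ψ hψ p hp hp'
        have h := hf.translation ψ hψ φ hφ (f.symm p) hp' (by simpa using hp)
        have h2 := f.symm.continuous.continuousAt.eventually h
        filter_upwards [h2] with q hq
        simp only [f.apply_symm_apply] at hq
        linear_combination -hq
      trans := by
        rintro M N P ⟨f, hf⟩ ⟨g, hg⟩
        refine ⟨f.trans g, fun i => by simp [hf.map_sing, hg.map_sing], ?_⟩
        intro φ hφ ψ hψ p hp hp'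
        have hreg : f p ∉ range N.sing := by
          rintro ⟨i, hi⟩
          rw [← hf.map_sing i] at hi
          exact M.chart_regular φ hφ p hp ⟨i, f.injective hi⟩
        obtain ⟨χ, hχ, hpχ⟩ := N.chart_cover (f p) hreg
        have h1 := hf.translation φ hφ χ hχ p hp hpχ
        have h2 := f.continuous.continuousAt.eventually
          (hg.translation χ hχ ψ hψ (f p) hpχ hp')
        filter_upwards [h1, h2] with q hq1 hq2
        simp only [Homeomorph.trans_apply]
        linear_combination hq1 + hq2 }

end TranslationSurface

/-- The stratum `H(α)`: translation surfaces of type `α` up to translation equivalence. -/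
def Stratum {k : ℕ} (α : Fin k → ℕ) : Type 1 := Quotient (TranslationSurface.setoid α)

/-- The translation equivalence class of a surface. -/
def TranslationSurface.toStratum {k : ℕ} {α : Fin k → ℕ} (M : TranslationSurface α) :
    Stratum α := Quotient.mk _ M

/-- The combinatorics of a triangulation whose vertices are `k` labelled points: `num` triangles,
the sides of each numbered `0, 1, 2` in counterclockwise order, a pairing `opp` of the sides, and
the label of the starting point of each side. -/
structure Pattern (k : ℕ) : Type where
  num : ℕ
  opp : Fin num × Fin 3 → Fin num × Fin 3
  opp_opp : ∀ e, opp (opp e) = e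
  label : Fin num × Fin 3 → Fin k

namespace Pattern

variable {k : ℕ} (T : Pattern k)

/-- A complex number (holonomy) for every oriented side of every triangle. -/
abbrev Holonomy : Type := Fin T.num × Fin 3 → ℂ

variable {T}

/-- The corners of the `τ`-th triangle, placed in the plane with corner `0` at the origin;
side `j` starts at corner `j`. -/
def corner (v : T.Holonomy) (e : Fin T.num × Fin 3) : ℂ :=
  ![0, v (e.1, 0), v (e.1, 0) + v (e.1, 1)] e.2

/-- The closed plane triangle number `τ`. -/
def triangle (v : T.Holonomy) (τ : Fin T.num) : Set ℂ :=
  convexHull ℝ (range fun j => corner v (τ, j))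

/-- The point of the side `e` with parameter `s ∈ [0,1]`. -/
def sidePoint (v : T.Holonomy) (e : Fin T.num × Fin 3) (s : ℝ) : ℂ :=
  corner v e + (s : ℂ) * v e

/-- `f` exhibits `M` as the union of the nondegenerate, positively oriented plane triangles with
side vectors `v`, glued along their sides by translations according to the pattern `T`; the
vertices are exactly the singularities, with their labels. -/
structure IsTriangulation {α : Fin k → ℕ} (M : TranslationSurface α) (v : T.Holonomy)
    (f : Fin T.num → ℂ → M) : Prop where
  closed_up : ∀ τ, v (τ, 0) + v (τ, 1) + v (τ, 2) = 0
  positive : ∀ τ, 0 < (starRingEnd ℂ (v (τ, 0)) * v (τ, 1)).im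
  opposite : ∀ e, v (T.opp e) = -v e
  continuousOn : ∀ τ, ContinuousOn (f τ) (triangle v τ)
  vertex : ∀ e, f e.1 (corner v e) = M.sing (T.label e)
  regular : ∀ τ, ∀ p ∈ triangle v τ, f τ p ∈ M.singSet → ∃ j, p = corner v (τ, j)
  translation : ∀ τ, ∀ p ∈ triangle v τ, ∀ φ ∈ M.charts, f τ p ∈ φ.source →
    ∀ᶠ q in 𝓝[triangle v τ] p, φ (f τ q) - q = φ (f τ p) - p
  cover : ∀ m : M, ∃ τ, ∃ p ∈ triangle v τ, f τ p = m
  glue : ∀ e, ∀ s ∈ Icc (0 : ℝ) 1,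
    f e.1 (sidePoint v e s) = f (T.opp e).1 (sidePoint v (T.opp e) (1 - s))
  /-- Apart from the vertices, points are identified only by the gluing of the sides. -/
  separate : ∀ τ, ∀ p ∈ triangle v τ, ∀ τ', ∀ p' ∈ triangle v τ', f τ p = f τ' p' →
    f τ p ∈ M.singSet ∨ (τ = τ' ∧ p = p') ∨
    ∃ e, ∃ s ∈ Icc (0 : ℝ) 1, e.1 = τ ∧ p = sidePoint v e s ∧
      (T.opp e).1 = τ' ∧ p' = sidePoint v (T.opp e) (1 - s)

variable (T)

/-- The surfaces of type `α` with a triangulation of pattern `T`. -/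
structure Realization (α : Fin k → ℕ) : Type 1 where
  surface : TranslationSurface α
  hol : T.Holonomy
  map : Fin T.num → ℂ → surface
  isTriangulation : IsTriangulation surface hol map

end Pattern

/-- The topology given by period coordinates. For a pattern `T`, the surfaces triangulated with
pattern `T` are parametrized by the holonomies of the edges of the triangulation, that is by their
period coordinates in the corresponding marking. The topology of the stratum is the one for which
these parametrizations (which jointly cover it) are continuous and open, hence the final one: a
set is open iff, for every `T`, it corresponds to an open set of edge holonomies. -/
noncomputable instance {k : ℕ} (α : Fin k → ℕ) : TopologicalSpace (Stratum α) :=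
  ⨆ T : Pattern k, TopologicalSpace.coinduced
    (fun R : T.Realization α => R.surface.toStratum)
    (TopologicalSpace.induced (fun R : T.Realization α => R.hol) inferInstance)

/-- The type `α'' = (α₁, …, α_k, 0, 0)`: two additional marked points. -/
def addTwoMarked {k : ℕ} (α : Fin k → ℕ) : Fin (k + 2) → ℕ := Fin.append α ![0, 0]

/-- The surfaces in `H(α'')` on which the first and the second additional marked points are
finitely blocked with blocking cardinality at most `n`. -/
def markedBlocked {k : ℕ} (α : Fin k → ℕ) (n : ℕ) : Set (Stratum (addTwoMarked α)) :=
  {X | ∃ M : TranslationSurface (addTwoMarked α), M.toStratum = X ∧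
    M.bc (M.sing (Fin.natAdd k 0)) (M.sing (Fin.natAdd k 1)) ≤ n}

/-- The surfaces in `H(α)` on which all pairs of distinct nonsingular points have blocking
cardinality at most `n`. -/
def regularBlocking {k : ℕ} (α : Fin k → ℕ) (n : ℕ) : Set (Stratum α) :=
  {X | ∃ M : TranslationSurface α, M.toStratum = X ∧
    ∀ p ∈ M.regularPairs, M.bc p.1 p.2 ≤ n}

/-! Everything rests on one limit argument. Let surfaces `N j` converge to `M` along an ultrafilter,
with points `xs j`, `ys j` tending to `x`, `y` and blocked by at most `n` points. By compactness the
`i`-th blocking points have a limit `β i` in `M`. A segment `σ` from `x` to `y` is a limit of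
segments of the `N j` (`Approx.persist`), each of which meets a blocking point; the ultrafilter
fixes the index `i` and the limit of the meeting times. If that limit is interior, `σ` passes
through `β i`. If it is `0` or `1`, then `β i` is an end and useless, but the blocking points
approach this end in the direction of `σ`. They can approach an end in one direction only, so at
each end at most one primitive segment (one whose interior avoids `x` and `y`) is lost to the index
`i`, and its midpoint replaces `β i`. Every trajectory contains a primitive one, so blocking these
suffices. If `x ≠ y`, then `β i` cannot be both ends and `n` points suffice; otherwise `2 * n` do
(`Approx.exists_blocking`).

The argument only needs to know how segments leave `xs j` and `ys j`: a launch family. There are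
three sources. At regular points flat discs are used (`Approx.exists_launchFamily`); with a constant
family of surfaces this gives the two statements about a single surface, and with varying surfaces
the one about all regular pairs. At labelled points of surfaces with one triangulation pattern and
converging edge holonomies, launches live in kites, the quadrilaterals formed by two adjacent
triangles (`Pattern.exists_launchFamily_corner`); this gives the statement about marked points. As
the topology of a stratum is final for edge holonomies, such limits decide closedness
(`Stratum.isClosed_of_tendsto`).

For the bound `ℓ` the ends may be singular or equal. The segments leaving `x` are distributed over
at most `4 * (∑ i, α i + 1)` half-discs. By density, blocked pairs tend to `(x, y)` inside any
prescribed pair of half-discs, and the limit argument (`IsSector.launchFamily`) blocks the segments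
through that pair by `2 * n` points. Adding up over all pairs gives a bound in terms of `n` and `α`.
-/

/-! ### Unique continuation of flat maps and straight paths. -/

/-- The set of points near which `f` and `g` agree is open, contains `a`, and is closed in `s` by
continuity and the local uniqueness `hfg`. -/
theorem IsPreconnected.eqOn_of_eventuallyEq {X Y : Type*} [TopologicalSpace X] [TopologicalSpace Y]
    [T2Space Y] {s : Set X} (hs : IsPreconnected s) {f g : X → Y}
    (hf : ∀ x ∈ s, ContinuousAt f x) (hg : ∀ x ∈ s, ContinuousAt g x)
    (hfg : ∀ x ∈ s, f x = g x → f =ᶠ[𝓝 x] g) {a : X} (ha : a ∈ s) (hfa : f a = g a) :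
    EqOn f g s := by
  have hsub : s ⊆ {x | f =ᶠ[𝓝 x] g} := by
    refine hs.subset_of_closure_inter_subset isOpen_setOfPred_eventually_nhds
      ⟨a, ha, hfg a ha hfa⟩ ?_
    rintro x ⟨hx, hxs⟩
    refine hfg x hxs (tendsto_nhds_unique_of_frequently_eq (hf x hxs) (hg x hxs) ?_)
    exact (mem_closure_iff_frequently.1 hx).mono fun y hy => hy.self_of_nhds
  exact fun x hx => (hsub hx).self_of_nhds

namespace TranslationSurface

variable {k : ℕ} {α : Fin k → ℕ}

/-- `S` is, near `z`, a translation into the regular part of `M`. -/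
structure FlatAt (M : TranslationSurface α) (S : ℂ → M) (z : ℂ) : Prop where
  continuousAt : ContinuousAt S z
  regular : S z ∉ M.singSet
  translation : ∀ φ ∈ M.charts, S z ∈ φ.source → ∀ᶠ q in 𝓝 z, φ (S q) - q = φ (S z) - z

/-- `γ` moves, near time `t`, straight with velocity `w` in the regular part of `M`. -/
structure PathFlatAt (M : TranslationSurface α) (γ : ℝ → M) (w : ℂ) (t : ℝ) : Prop where
  continuousAt : ContinuousAt γ t
  regular : γ t ∉ M.singSet
  straight : ∀ φ ∈ M.charts, γ t ∈ φ.source →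
    ∀ᶠ s in 𝓝 t, φ (γ s) = φ (γ t) + ((s - t : ℝ) : ℂ) * w

/-- `γ` is a straight-line trajectory from `x` to `y` with velocity `w`. -/
structure IsSegment (M : TranslationSurface α) (x y : M) (γ : ℝ → M) (w : ℂ) : Prop where
  continuousOn : ContinuousOn γ (Icc 0 1)
  start : γ 0 = x
  finish : γ 1 = y
  flat : ∀ t ∈ Ioo (0 : ℝ) 1, M.PathFlatAt γ w t
  ne_zero : w ≠ 0

variable {M : TranslationSurface α}

theorem FlatAt.congr {S S' : ℂ → M} {z : ℂ} (h : M.FlatAt S z) (he : S' =ᶠ[𝓝 z] S) :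
    M.FlatAt S' z where
  continuousAt := h.continuousAt.congr he.symm
  regular := he.self_of_nhds ▸ h.regular
  translation φ hφ hz := by
    rw [he.self_of_nhds] at hz ⊢
    filter_upwards [h.translation φ hφ hz, he] with q hq hq'
    rw [hq', hq]

theorem PathFlatAt.congr {γ γ' : ℝ → M} {w : ℂ} {t : ℝ} (h : M.PathFlatAt γ w t)
    (he : γ' =ᶠ[𝓝 t] γ) : M.PathFlatAt γ' w t where
  continuousAt := h.continuousAt.congr he.symm
  regular := he.self_of_nhds ▸ h.regular
  straight φ hφ hz := by
    rw [he.self_of_nhds] at hz ⊢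
    filter_upwards [h.straight φ hφ hz, he] with q hq hq'
    rw [hq', hq]

theorem FlatAt.comp_add {S : ℂ → M} {z c : ℂ} (h : M.FlatAt S (z + c)) :
    M.FlatAt (fun q => S (q + c)) z where
  continuousAt := ContinuousAt.comp (g := S) h.continuousAt (by fun_prop)
  regular := h.regular
  translation φ hφ hz := by
    have hc : Tendsto (fun q : ℂ => q + c) (𝓝 z) (𝓝 (z + c)) := by
      have : Continuous fun q : ℂ => q + c := by fun_prop
      exact this.continuousAt
    filter_upwards [hc.eventually (h.translation φ hφ hz)] with q hq
    linear_combination hq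

theorem FlatAt.comp_const_add {S : ℂ → M} {z c : ℂ} (h : M.FlatAt S (c + z)) :
    M.FlatAt (fun q => S (c + q)) z := by
  rw [add_comm] at h
  simpa only [add_comm c] using h.comp_add

theorem FlatAt.pathFlatAt {S : ℂ → M} {w c : ℂ} {t : ℝ} (h : M.FlatAt S ((t : ℂ) * w + c)) :
    M.PathFlatAt (fun s : ℝ => S ((s : ℂ) * w + c)) w t where
  continuousAt := ContinuousAt.comp (g := S) h.continuousAt (by fun_prop)
  regular := h.regular
  straight φ hφ hz := by
    have hc : Tendsto (fun q : ℝ => (q : ℂ) * w + c) (𝓝 t) (𝓝 ((t : ℂ) * w + c)) := by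
      have : Continuous fun q : ℝ => (q : ℂ) * w + c := by fun_prop
      exact this.continuousAt
    filter_upwards [hc.eventually (h.translation φ hφ hz)] with q hq
    push_cast
    linear_combination hq

theorem FlatAt.pathFlatAt' {S : ℂ → M} {w : ℂ} {t : ℝ} (h : M.FlatAt S ((t : ℂ) * w)) :
    M.PathFlatAt (fun s : ℝ => S ((s : ℂ) * w)) w t := by
  have := FlatAt.pathFlatAt (M := M) (S := S) (w := w) (c := 0) (t := t) (by simpa using h)
  simpa using this

theorem PathFlatAt.comp_affine {γ : ℝ → M} {w : ℂ} {a c t : ℝ}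
    (h : M.PathFlatAt γ w (a * t + c)) :
    M.PathFlatAt (fun s => γ (a * s + c)) ((a : ℂ) * w) t where
  continuousAt := ContinuousAt.comp (g := γ) h.continuousAt (by fun_prop)
  regular := h.regular
  straight φ hφ hz := by
    have hc : Tendsto (fun q : ℝ => a * q + c) (𝓝 t) (𝓝 (a * t + c)) := by
      have : Continuous fun q : ℝ => a * q + c := by fun_prop
      exact this.continuousAt
    filter_upwards [hc.eventually (h.straight φ hφ hz)] with q hq
    rw [hq]
    push_cast
    ring

theorem exists_chart (M : TranslationSurface α) {p : M} (hp : p ∉ M.singSet) :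
    ∃ φ ∈ M.charts, p ∈ φ.source := M.chart_cover p hp

/-- In a chart around the common value both maps are the same translation, and charts are injective.
-/
theorem FlatAt.eventuallyEq {S S' : ℂ → M} {z : ℂ} (h : M.FlatAt S z) (h' : M.FlatAt S' z)
    (he : S z = S' z) : S =ᶠ[𝓝 z] S' := by
  obtain ⟨φ, hφ, hz⟩ := M.exists_chart h.regular
  have hz' : S' z ∈ φ.source := he ▸ hz
  filter_upwards [h.translation φ hφ hz, h'.translation φ hφ hz',
    h.continuousAt (φ.open_source.mem_nhds hz), h'.continuousAt (φ.open_source.mem_nhds hz')]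
    with q h1 h2 h3 h4
  refine φ.injOn h3 h4 ?_
  rw [← he] at h2
  linear_combination h1 - h2

theorem PathFlatAt.eventuallyEq {γ γ' : ℝ → M} {w : ℂ} {t : ℝ} (h : M.PathFlatAt γ w t)
    (h' : M.PathFlatAt γ' w t) (he : γ t = γ' t) : γ =ᶠ[𝓝 t] γ' := by
  obtain ⟨φ, hφ, hz⟩ := M.exists_chart h.regular
  have hz' : γ' t ∈ φ.source := he ▸ hz
  filter_upwards [h.straight φ hφ hz, h'.straight φ hφ hz',
    h.continuousAt (φ.open_source.mem_nhds hz), h'.continuousAt (φ.open_source.mem_nhds hz')]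
    with q h1 h2 h3 h4
  refine φ.injOn h3 h4 ?_
  rw [h1, h2, he]

theorem eqOn_of_flatAt {S S' : ℂ → M} {O : Set ℂ} (hO : IsPreconnected O)
    (h : ∀ z ∈ O, M.FlatAt S z) (h' : ∀ z ∈ O, M.FlatAt S' z) {a : ℂ} (ha : a ∈ O)
    (he : S a = S' a) : EqOn S S' O :=
  hO.eqOn_of_eventuallyEq (fun z hz => (h z hz).continuousAt) (fun z hz => (h' z hz).continuousAt)
    (fun z hz hz' => (h z hz).eventuallyEq (h' z hz) hz') ha he

theorem eqOn_of_pathFlatAt {γ γ' : ℝ → M} {w : ℂ} {I : Set ℝ} (hI : IsPreconnected I)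
    (h : ∀ z ∈ I, M.PathFlatAt γ w z) (h' : ∀ z ∈ I, M.PathFlatAt γ' w z) {a : ℝ} (ha : a ∈ I)
    (he : γ a = γ' a) : EqOn γ γ' I :=
  hI.eqOn_of_eventuallyEq (fun z hz => (h z hz).continuousAt) (fun z hz => (h' z hz).continuousAt)
    (fun z hz hz' => (h z hz).eventuallyEq (h' z hz) hz') ha he

/-- Flat maps are local homeomorphisms. -/
theorem FlatAt.map_nhds {S : ℂ → M} {z : ℂ} (h : M.FlatAt S z) : map S (𝓝 z) = 𝓝 (S z) := by
  obtain ⟨φ, hφ, hz⟩ := M.exists_chart h.regular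
  have he : S =ᶠ[𝓝 z] fun q => φ.symm (q + (φ (S z) - z)) := by
    filter_upwards [h.translation φ hφ hz, h.continuousAt (φ.open_source.mem_nhds hz)] with q h1 h2
    rw [← h1, add_sub_cancel, φ.left_inv h2]
  rw [Filter.map_congr he]
  have h1 : map (fun q : ℂ => q + (φ (S z) - z)) (𝓝 z) = 𝓝 (φ (S z)) := by
    simp
  have h2 := φ.symm.map_nhds_eq (x := φ (S z)) (φ.map_source hz)
  rw [← h1, map_map] at h2
  rw [φ.left_inv hz] at h2
  exact h2

theorem IsSegment.isTrajectory {x y : M} {γ : ℝ → M} {w : ℂ} (h : M.IsSegment x y γ w) :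
    M.IsTrajectory x y γ where
  continuousOn := h.continuousOn
  start := h.start
  finish := h.finish
  regular t ht := (h.flat t ht).regular
  straight := ⟨w, h.ne_zero, fun t ht => (h.flat t ht).straight⟩

theorem IsTrajectory.exists_isSegment {x y : M} {γ : ℝ → M} (h : M.IsTrajectory x y γ) :
    ∃ w, M.IsSegment x y γ w := by
  obtain ⟨w, hw, hs⟩ := h.straight
  refine ⟨w, h.continuousOn, h.start, h.finish, fun t ht => ⟨?_, h.regular t ht, hs t ht⟩, hw⟩
  exact h.continuousOn.continuousAt (Icc_mem_nhds ht.1 ht.2)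

theorem IsSegment.subsegment {x y : M} {γ : ℝ → M} {w : ℂ} (h : M.IsSegment x y γ w) {a b : ℝ}
    (ha : 0 ≤ a) (hab : a < b) (hb : b ≤ 1) :
    M.IsSegment (γ a) (γ b) (fun t => γ ((b - a) * t + a)) (((b - a : ℝ) : ℂ) * w) where
  continuousOn := by
    refine h.continuousOn.comp (by fun_prop) fun t ht => ⟨?_, ?_⟩
    · nlinarith [ht.1, ht.2]
    · nlinarith [ht.1, ht.2]
  start := by simp
  finish := by simp
  flat t ht := by
    refine (h.flat _ ⟨?_, ?_⟩).comp_affine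
    · nlinarith [ht.1, ht.2]
    · nlinarith [ht.1, ht.2]
  ne_zero := mul_ne_zero (by exact_mod_cast (sub_pos.2 hab).ne') h.ne_zero

theorem IsSegment.reverse {x y : M} {γ : ℝ → M} {w : ℂ} (h : M.IsSegment x y γ w) :
    M.IsSegment y x (fun t => γ (1 - t)) (-w) where
  continuousOn := h.continuousOn.comp (by fun_prop) fun t ht => ⟨by linarith [ht.2], by linarith [ht.1]⟩
  start := by simp [h.finish]
  finish := by simp [h.start]
  flat t ht := by
    have h1 := h.flat (-1 * t + 1) ⟨by linarith [ht.2], by linarith [ht.1]⟩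
    have h2 := h1.comp_affine
    have h3 : (fun s => γ (-1 * s + 1)) = fun t => γ (1 - t) := by
      ext s; congr 1; ring
    rw [h3] at h2
    simpa using h2
  ne_zero := neg_ne_zero.2 h.ne_zero

theorem bc_le_iff {M : TranslationSurface α} {x y : M} {n : ℕ} :
    M.bc x y ≤ n ↔ ∃ B : Finset M, M.IsBlockingSet x y B ∧ B.card ≤ n := by
  constructor
  · intro h
    have h1 : M.bc x y < ((n + 1 : ℕ) : ℕ∞) := lt_of_le_of_lt h (by exact_mod_cast Nat.lt_succ_self n)
    simp only [bc, iInf_lt_iff] at h1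
    obtain ⟨B, hB, hc⟩ := h1
    exact ⟨B, hB, Nat.lt_succ_iff.1 (by exact_mod_cast hc)⟩
  · rintro ⟨B, hB, hc⟩
    exact (iInf₂_le B hB).trans (by exact_mod_cast hc)

/-! ### Primitive segments. -/

/-- A segment whose interior avoids both of its ends. -/
structure IsPrimitive (M : TranslationSurface α) (x y : M) (γ : ℝ → M) (w : ℂ) : Prop extends
    M.IsSegment x y γ w where
  ne_start : ∀ t ∈ Ioo (0 : ℝ) 1, γ t ≠ x
  ne_finish : ∀ t ∈ Ioo (0 : ℝ) 1, γ t ≠ y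

theorem IsPrimitive.reverse {x y : M} {γ : ℝ → M} {w : ℂ} (h : M.IsPrimitive x y γ w) :
    M.IsPrimitive y x (fun t => γ (1 - t)) (-w) where
  toIsSegment := h.toIsSegment.reverse
  ne_start t ht := h.ne_finish _ ⟨by linarith [ht.2], by linarith [ht.1]⟩
  ne_finish t ht := h.ne_start _ ⟨by linarith [ht.2], by linarith [ht.1]⟩

/-- Two primitive segments with the same germ at their start agree up to scaling. -/
theorem IsPrimitive.mem_of_germ {x y : M} {σ σ' : ℝ → M} {w w' : ℂ} (h : M.IsPrimitive x y σ w)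
    (h' : M.IsPrimitive x y σ' w') {c : ℝ} (hc : 0 < c) (hw : w = c * w')
    (hg : ∀ᶠ t in 𝓝[>] (0 : ℝ), σ t = σ' (c * t)) :
    c = 1 ∧ ∀ t ∈ Ioo (0 : ℝ) 1, σ t = σ' t := by
  have key : ∀ {σ σ' : ℝ → M} {w w' : ℂ} {c : ℝ}, M.IsPrimitive x y σ w →
      M.IsPrimitive x y σ' w' → 0 < c → c ≤ 1 → w = c * w' →
      (∀ᶠ t in 𝓝[>] (0 : ℝ), σ t = σ' (c * t)) → c = 1 ∧ ∀ t ∈ Ioo (0 : ℝ) 1, σ t = σ' t := by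
    intro σ σ' w w' c h h' hc hc1 hw hg
    obtain ⟨a, ha, ha'⟩ := (hg.and (Ioo_mem_nhdsGT one_pos)).exists
    have heq : EqOn σ (fun t => σ' (c * t + 0)) (Ioo 0 1) := by
      refine eqOn_of_pathFlatAt isPreconnected_Ioo h.flat (fun t ht => ?_) ha' (by simpa using ha)
      rw [hw]
      refine PathFlatAt.comp_affine (h'.flat _ ⟨?_, ?_⟩)
      · have := mul_pos hc ht.1
        linarith
      · nlinarith [ht.1, ht.2]
    -- `σ` ends at `σ' c`. If `c < 1`, this puts `y` in the interior of the primitive segment `σ'`.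
    have hc1' : c = 1 := by
      by_contra hne
      have hlt : c < 1 := lt_of_le_of_ne hc1 hne
      refine h'.ne_finish c ⟨hc, hlt⟩ ?_
      have hcont : ContinuousOn (fun t => σ' (c * t + 0)) (Icc 0 1) :=
        h'.continuousOn.comp (by fun_prop) fun t ht =>
          ⟨by nlinarith [ht.1, ht.2], by nlinarith [ht.1, ht.2]⟩
      have h1 := (heq.of_subset_closure h.continuousOn hcont Ioo_subset_Icc_self
        (by rw [closure_Ioo (by norm_num)])) (right_mem_Icc.2 zero_le_one)
      simp only [mul_one, add_zero] at h1
      rw [← h1, h.finish]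
    subst hc1'
    exact ⟨rfl, fun t ht => by simpa using heq ht⟩
  rcases le_total c 1 with hc1 | hc1
  · exact key h h' hc hc1 hw hg
  · have hg' : ∀ᶠ t in 𝓝[>] (0 : ℝ), σ' t = σ (c⁻¹ * t) := by
      have ht : Tendsto (fun t : ℝ => c⁻¹ * t) (𝓝[>] 0) (𝓝[>] 0) := by
        refine tendsto_nhdsWithin_iff.2 ⟨?_, ?_⟩
        · have : Continuous fun t : ℝ => c⁻¹ * t := by fun_prop
          simpa using (this.tendsto 0).mono_left nhdsWithin_le_nhds
        · filter_upwards [self_mem_nhdsWithin] with t ht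
          exact mul_pos (inv_pos.2 hc) ht
      filter_upwards [ht.eventually hg] with t ht
      rw [ht, mul_inv_cancel_left₀ hc.ne']
    have hw' : w' = ((c⁻¹ : ℝ) : ℂ) * w := by
      rw [hw]
      push_cast
      rw [inv_mul_cancel_left₀]
      exact_mod_cast hc.ne'
    obtain ⟨h1, h2⟩ := key h' h (inv_pos.2 hc) (inv_le_one_of_one_le₀ hc1) hw' hg'
    exact ⟨inv_eq_one.1 h1, fun t ht => (h2 t ht).symm⟩

end TranslationSurface

/-! ### Convergence of surfaces and continuation of launches along strips. -/

/-- By compactness finitely many of the `δ`-neighbourhoods lead from `a` to `b`, and `Q` is carried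
through them one after another. It matters that `δ` depends on `t` alone and not on how `Q` was
reached. -/
theorem Real.propagate_of_local {Q : ℝ → Prop} {a b : ℝ} (hab : a ≤ b) (ha : Q a)
    (h : ∀ t ∈ Icc a b, ∃ δ > 0, ∀ T T', a ≤ T → T ≤ T' → |T - t| < δ → |T' - t| < δ →
      Q T → Q T') : Q b := by
  choose! δ hδ hQ using h
  obtain ⟨t, ht0, htm, ⟨m, hm⟩, ht⟩ := exists_monotone_Icc_subset_open_cover_Icc hab
    (c := fun s : Icc a b => {p : Icc a b | |(p : ℝ) - s| < δ s})
    (fun s => isOpen_lt (by fun_prop) continuous_const)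
    (fun s _ => mem_iUnion.2 ⟨s, by simpa using hδ s s.2⟩)
  have key : ∀ n, Q (t n) := by
    intro n
    induction n with
    | zero => rw [ht0]; exact ha
    | succ n ih =>
      obtain ⟨s, hs⟩ := ht n
      have hle : t n ≤ t (n + 1) := htm n.le_succ
      exact hQ s s.2 _ _ (t n).2.1 hle (hs (left_mem_Icc.2 hle)) (hs (right_mem_Icc.2 hle)) ih
  rw [← hm m le_rfl]
  exact key m

/-- The open `r`-neighbourhood of the plane segment from `a * w` to `b * w`. -/
def planeStrip (w : ℂ) (a b r : ℝ) : Set ℂ :=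
  Metric.thickening r ((fun s : ℝ => (s : ℂ) * w) '' Icc a b)

theorem mem_planeStrip {w : ℂ} {a b r : ℝ} {z : ℂ} :
    z ∈ planeStrip w a b r ↔ ∃ s ∈ Icc a b, ‖z - s * w‖ < r := by
  simp [planeStrip, Metric.mem_thickening_iff, dist_eq_norm]

theorem isOpen_planeStrip {w : ℂ} {a b r : ℝ} : IsOpen (planeStrip w a b r) :=
  Metric.isOpen_thickening

theorem convex_planeStrip {w : ℂ} {a b r : ℝ} : Convex ℝ (planeStrip w a b r) := by
  refine Convex.thickening ((convex_Icc a b).is_linear_image (f := fun s : ℝ => (s : ℂ) * w) ?_) r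
  constructor
  · intro x y; push_cast; ring
  · intro c x; simp [mul_assoc]

namespace TranslationSurface

variable {k : ℕ} {α : Fin k → ℕ} {ι : Type*}

/-- A notion of convergence of points of the surfaces `N j` to points of `M` along `U`, under which
flat discs around regular points of `M` are limits of flat discs of the same size. -/
structure Approx (U : Ultrafilter ι) (M : TranslationSurface α) (N : ι → TranslationSurface α) where
  Conv : ((j : ι) → N j) → M → Prop
  exists_conv : ∀ m, ∃ a, Conv m a
  unique : ∀ {m a b}, Conv m a → Conv m b → a = b
  congr : ∀ {m m' a}, (∀ᶠ j in (U : Filter ι), m' j = m j) → Conv m a → Conv m' a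
  disc : ∀ a, a ∉ M.singSet → ∃ r > 0, ∃ (D : ℂ → M) (E : ∀ j, ℂ → N j), D 0 = a ∧
    (∀ z ∈ Metric.ball 0 r, M.FlatAt D z) ∧
    (∀ᶠ j in (U : Filter ι), (∀ z ∈ Metric.ball 0 r, (N j).FlatAt (E j) z) ∧
      InjOn (E j) (Metric.ball 0 r)) ∧
    (∀ z ∈ Metric.ball 0 r, ∀ q : ι → ℂ, Tendsto q U (𝓝 z) → Conv (fun j => E j (q j)) (D z)) ∧
    (∀ z ∈ Metric.ball 0 r, ∀ m, Conv m (D z) →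
      ∃ q : ι → ℂ, Tendsto q U (𝓝 z) ∧ ∀ᶠ j in (U : Filter ι), m j = E j (q j))

variable {U : Ultrafilter ι} {M : TranslationSurface α} {N : ι → TranslationSurface α}

/-- The flat maps `S j` describe, for all velocities close to `w`, the beginning of a trajectory
from `xs j`, and these converge to the path `σ`, up to time `t₀`. -/
structure LaunchOn (A : Approx U M N) (xs : ∀ j, N j) (σ : ℝ → M) (w : ℂ) (S : ∀ j, ℂ → N j)
    (t₀ r : ℝ) : Prop where
  time_pos : 0 < t₀
  radius_pos : 0 < r
  flat : ∀ᶠ j in (U : Filter ι), ∀ v ∈ Metric.ball w r, ∀ s ∈ Ioc 0 t₀,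
    (N j).FlatAt (S j) ((s : ℂ) * v)
  start : ∀ᶠ j in (U : Filter ι), ∀ v ∈ Metric.ball w r,
    Tendsto (fun s : ℝ => S j ((s : ℂ) * v)) (𝓝[>] 0) (𝓝 (xs j))
  conv : ∀ v : ι → ℂ, Tendsto v U (𝓝 w) → ∀ s : ι → ℝ, (∀ᶠ j in (U : Filter ι), s j ∈ Ioc 0 t₀) →
    ∀ s₀, Tendsto s U (𝓝 s₀) → A.Conv (fun j => S j ((s j : ℂ) * v j)) (σ s₀)

theorem LaunchOn.mono {A : Approx U M N} {xs : ∀ j, N j} {σ : ℝ → M} {w : ℂ} {S : ∀ j, ℂ → N j}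
    {t₀ t₁ r : ℝ} (h : LaunchOn A xs σ w S t₀ r) (ht : 0 < t₁) (ht' : t₁ ≤ t₀) :
    LaunchOn A xs σ w S t₁ r where
  time_pos := ht
  radius_pos := h.radius_pos
  flat := h.flat.mono fun _ hj v hv s hs => hj v hv s ⟨hs.1, hs.2.trans ht'⟩
  start := h.start
  conv v hv s hs s₀ hs₀ :=
    h.conv v hv s (hs.mono fun _ hj => ⟨hj.1, hj.2.trans ht'⟩) s₀ hs₀

/-- Flat maps `S j` continuing a launch along `σ` from time `t₀` to time `T`. -/
def StripOn (A : Approx U M N) (σ : ℝ → M) (w : ℂ) (S : ∀ j, ℂ → N j) (t₀ T : ℝ) : Prop :=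
  ∃ r > 0, ∃ S' : ∀ j, ℂ → N j,
    (∀ᶠ j in (U : Filter ι), ∀ z ∈ planeStrip w t₀ T r, (N j).FlatAt (S' j) z) ∧
    (∀ᶠ j in (U : Filter ι), ∀ z ∈ Metric.ball ((t₀ : ℂ) * w) r, S' j z = S j z) ∧
    ∀ s ∈ Icc t₀ T, ∀ z : ι → ℂ, Tendsto z U (𝓝 ((s : ℂ) * w)) →
      A.Conv (fun j => S' j (z j)) (σ s)

theorem LaunchOn.stripOn {A : Approx U M N} {xs : ∀ j, N j} {σ : ℝ → M} {w : ℂ}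
    {S : ∀ j, ℂ → N j} {t₀ r : ℝ} (h : LaunchOn A xs σ w S t₀ r) : StripOn A σ w S t₀ t₀ := by
  have h0 := h.time_pos
  have h0' : (t₀ : ℂ) ≠ 0 := by exact_mod_cast h0.ne'
  refine ⟨t₀ * r, mul_pos h0 h.radius_pos, S, ?_, Eventually.of_forall fun _ _ _ => rfl, ?_⟩
  · filter_upwards [h.flat] with j hj z hz
    obtain ⟨s, hs, hzs⟩ := mem_planeStrip.1 hz
    obtain rfl : s = t₀ := le_antisymm hs.2 hs.1
    have := hj (z / s) ?_ s ⟨h0, le_rfl⟩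
    · rwa [mul_div_cancel₀ _ h0'] at this
    · rw [mem_ball_iff_norm]
      have h1 : z - s * w = s * (z / s - w) := by field_simp
      rw [h1, norm_mul, Complex.norm_real, Real.norm_of_nonneg h0.le] at hzs
      exact lt_of_mul_lt_mul_left hzs h0.le
  · intro s hs z hz
    obtain rfl : s = t₀ := le_antisymm hs.2 hs.1
    have := h.conv (fun j => z j / s) ?_ (fun _ => s) (Eventually.of_forall fun _ => ⟨h0, le_rfl⟩)
      s tendsto_const_nhds
    · simpa only [mul_div_cancel₀ _ h0'] using this
    · have := hz.div_const (s : ℂ)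
      rwa [mul_div_cancel_left₀ _ h0'] at this

theorem IsSegment.exists_eq_disc {x y : M} {σ : ℝ → M} {w : ℂ} (hσ : M.IsSegment x y σ w) {t : ℝ}
    (ht : t ∈ Ioo (0 : ℝ) 1) {D : ℂ → M} (hD : M.FlatAt D 0) (h0 : D 0 = σ t) :
    ∃ δ > 0, ∀ s, |s - t| < δ → σ s = D (((s - t : ℝ) : ℂ) * w) := by
  have h1 : M.PathFlatAt (fun s : ℝ => D ((s : ℂ) * w + -((t : ℂ) * w))) w t :=
    FlatAt.pathFlatAt (by simpa using hD)
  have h2 := (hσ.flat t ht).eventuallyEq h1 (by simp [h0])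
  obtain ⟨δ, hδ, h⟩ := Metric.eventually_nhds_iff.1 h2
  refine ⟨δ, hδ, fun s hs => ?_⟩
  refine (h (by simpa [Real.dist_eq] using hs)).trans (congrArg D ?_)
  push_cast
  ring

/-- Near time `t` the limit path lies in one flat disc of `M`, a limit of flat discs `E j` of the
same size. Translating `E j` to match the strip at time `T` prolongs the strip across the disc. The
radius may shrink, which is harmless since finitely many prolongations suffice. -/
theorem StripOn.extend {A : Approx U M N} {x y : M} {σ : ℝ → M} {w : ℂ} {S : ∀ j, ℂ → N j}
    {t₀ t : ℝ} (hσ : M.IsSegment x y σ w) (ht : t ∈ Ioo (0 : ℝ) 1) :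
    ∃ δ > 0, ∀ T T', t₀ ≤ T → T ≤ T' → |T - t| < δ → |T' - t| < δ →
      StripOn A σ w S t₀ T → StripOn A σ w S t₀ T' := by
  obtain ⟨ρ, hρ, D, E, hD0, hD, hE, hconv, hcomp⟩ := A.disc (σ t) (hσ.flat t ht).regular
  obtain ⟨δ₁, hδ₁, hσD⟩ := hσ.exists_eq_disc ht (hD 0 (Metric.mem_ball_self hρ)) hD0
  have hw := norm_pos_iff.2 hσ.ne_zero
  refine ⟨min δ₁ (ρ / 2 / ‖w‖), lt_min hδ₁ (by positivity), ?_⟩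
  rintro T T' hT hTT hTt hTt' ⟨r, hr, S', hflat, hinit, hS'⟩
  have hsmall : ∀ s ∈ Icc T T', |s - t| < min δ₁ (ρ / 2 / ‖w‖) := by
    intro s hs
    rw [abs_lt] at hTt hTt' ⊢
    exact ⟨by linarith [hs.1], by linarith [hs.2]⟩
  have hnorm : ∀ s ∈ Icc T T', ‖((s - t : ℝ) : ℂ) * w‖ < ρ / 2 := by
    intro s hs
    have := (hsmall s hs).trans_le (min_le_right _ _)
    rw [lt_div_iff₀ hw] at this
    rwa [norm_mul, Complex.norm_real, Real.norm_eq_abs]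
  have hTm : T ∈ Icc T T' := left_mem_Icc.2 hTT
  have hball : ∀ s ∈ Icc T T', ((s - t : ℝ) : ℂ) * w ∈ Metric.ball (0 : ℂ) ρ := fun s hs => by
    rw [mem_ball_zero_iff]
    linarith [hnorm s hs]
  have hcT := hS' T ⟨hT, le_rfl⟩ (fun _ => (T : ℂ) * w) tendsto_const_nhds
  rw [hσD T ((hsmall T hTm).trans_le (min_le_left _ _))] at hcT
  obtain ⟨q, hq, hSq⟩ := hcomp _ (hball T hTm) _ hcT
  classical
  -- The strip has value `E j (q j)` at `T * w`, so `z ↦ E j (z + c j)` is the translate of the disc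
  -- that agrees with it there.
  set c : ι → ℂ := fun j => q j - (T : ℂ) * w with hc
  have hclim : Tendsto c U (𝓝 (-((t : ℂ) * w))) := by
    have := hq.sub_const ((T : ℂ) * w)
    convert this using 2
    push_cast
    ring
  set r' := min r (ρ / 4) with hr'
  have hr'0 : 0 < r' := lt_min hr (by positivity)
  have hcs : ∀ᶠ j in (U : Filter ι), ‖c j + (t : ℂ) * w‖ < ρ / 4 := by
    have h1 : Tendsto (fun j => ‖c j + (t : ℂ) * w‖) U (𝓝 0) := by
      have := (hclim.add_const ((t : ℂ) * w)).norm
      simpa using this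
    exact h1.eventually (gt_mem_nhds (by positivity))
  have hEflat : ∀ᶠ j in (U : Filter ι), ∀ z ∈ planeStrip w T T' r',
      (N j).FlatAt (fun z => E j (z + c j)) z := by
    filter_upwards [hE, hcs] with j hj hjs z hz
    obtain ⟨s, hs, hzs⟩ := mem_planeStrip.1 hz
    refine FlatAt.comp_add (hj.1 _ ?_)
    rw [mem_ball_zero_iff]
    have h1 : z + c j = (z - s * w) + ((s - t : ℝ) : ℂ) * w + (c j + t * w) := by
      push_cast; ring
    rw [h1]
    have h2 := hnorm s hs
    have h3 : r' ≤ ρ / 4 := min_le_right _ _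
    have h4 := norm_add₃_le (a := z - s * w) (b := ((s - t : ℝ) : ℂ) * w) (c := c j + t * w)
    linarith
  have hsub : planeStrip w t₀ T r' ⊆ planeStrip w t₀ T r :=
    Metric.thickening_mono (min_le_left _ _) _
  -- The two strips overlap in a convex, hence connected, set, so agreement at `T * w` spreads over
  -- the overlap.
  have hagree : ∀ᶠ j in (U : Filter ι), ∀ z ∈ planeStrip w t₀ T r' ∩ planeStrip w T T' r',
      S' j z = E j (z + c j) := by
    filter_upwards [hEflat, hflat, hSq] with j h1 h2 h3
    have hmem : (T : ℂ) * w ∈ planeStrip w t₀ T r' ∩ planeStrip w T T' r' :=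
      ⟨mem_planeStrip.2 ⟨T, ⟨hT, le_rfl⟩, by simpa using hr'0⟩,
        mem_planeStrip.2 ⟨T, hTm, by simpa using hr'0⟩⟩
    refine eqOn_of_flatAt (convex_planeStrip.inter convex_planeStrip).isPreconnected
      (fun z hz => h2 z (hsub hz.1)) (fun z hz => h1 z hz.2) hmem ?_
    rw [h3, hc]
    simp
  refine ⟨r', hr'0, fun j z => if z ∈ planeStrip w t₀ T r' then S' j z else E j (z + c j),
    ?_, ?_, ?_⟩
  · filter_upwards [hEflat, hflat, hagree] with j h1 h2 h3 z hz
    by_cases hzA : z ∈ planeStrip w t₀ T r'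
    · refine (h2 z (hsub hzA)).congr ?_
      filter_upwards [isOpen_planeStrip.mem_nhds hzA] with q hq
      simp [hq]
    · have hzB : z ∈ planeStrip w T T' r' := by
        obtain ⟨s, hs, hzs⟩ := mem_planeStrip.1 hz
        rcases le_total s T with h | h
        · exact absurd (mem_planeStrip.2 ⟨s, ⟨hs.1, h⟩, hzs⟩) hzA
        · exact mem_planeStrip.2 ⟨s, ⟨h, hs.2⟩, hzs⟩
      refine (h1 z hzB).congr ?_
      filter_upwards [isOpen_planeStrip.mem_nhds hzB] with q hq
      by_cases hqA : q ∈ planeStrip w t₀ T r'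
      · simp [hqA, h3 q ⟨hqA, hq⟩]
      · simp [hqA]
  · filter_upwards [hinit] with j hj z hz
    have hzA : z ∈ planeStrip w t₀ T r' :=
      mem_planeStrip.2 ⟨t₀, ⟨le_rfl, hT⟩, by simpa [dist_eq_norm] using hz⟩
    simp only [hzA, if_true]
    exact hj z (Metric.ball_subset_ball (min_le_left _ _) hz)
  · intro s hs z hz
    rcases le_total s T with h | h
    · refine A.congr ?_ (hS' s ⟨hs.1, h⟩ z hz)
      have : (s : ℂ) * w ∈ planeStrip w t₀ T r' :=
        mem_planeStrip.2 ⟨s, ⟨hs.1, h⟩, by simpa using hr'0⟩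
      filter_upwards [hz.eventually (isOpen_planeStrip.mem_nhds this)] with j hj
      exact if_pos hj
    · have hsm : s ∈ Icc T T' := ⟨h, hs.2⟩
      rw [hσD s ((hsmall s hsm).trans_le (min_le_left _ _))]
      refine A.congr ?_ (hconv _ (hball s hsm) (fun j => z j + c j) ?_)
      · have : (s : ℂ) * w ∈ planeStrip w T T' r' :=
          mem_planeStrip.2 ⟨s, hsm, by simpa using hr'0⟩
        filter_upwards [hz.eventually (isOpen_planeStrip.mem_nhds this), hagree] with j hj hja
        by_cases hqA : z j ∈ planeStrip w t₀ T r'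
        · simp [hqA, hja _ ⟨hqA, hj⟩]
        · simp [hqA]
      · convert hz.add hclim using 2
        push_cast
        ring

theorem LaunchOn.stripOn_of_lt {A : Approx U M N} {xs : ∀ j, N j} {x y : M} {σ : ℝ → M} {w : ℂ}
    {S : ∀ j, ℂ → N j} {t₀ r T : ℝ} (h : LaunchOn A xs σ w S t₀ r) (hσ : M.IsSegment x y σ w)
    (hT : t₀ ≤ T) (hT1 : T < 1) : StripOn A σ w S t₀ T :=
  Real.propagate_of_local hT h.stripOn fun _ ht =>
    StripOn.extend hσ ⟨h.time_pos.trans_le ht.1, ht.2.trans_lt hT1⟩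

/-- Near a regular limit point, flat maps with the same limit differ by small translations. -/
theorem Approx.exists_shift (A : Approx U M N) {a : M} (ha : a ∉ M.singSet)
    {F G : ∀ j, ℂ → N j} {p q : ℂ} {r : ℝ} (hr : 0 < r)
    (hF : ∀ᶠ j in (U : Filter ι), ∀ z ∈ Metric.ball p r, (N j).FlatAt (F j) z)
    (hG : ∀ᶠ j in (U : Filter ι), ∀ z ∈ Metric.ball q r, (N j).FlatAt (G j) z)
    (hFa : A.Conv (fun j => F j p) a) (hGa : A.Conv (fun j => G j q) a) :
    ∃ d : ι → ℂ, Tendsto d U (𝓝 0) ∧ ∃ ρ > 0, ∀ᶠ j in (U : Filter ι), ∀ z : ℂ, ‖z‖ < ρ →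
      F j (p + z) = G j (q + z + d j) := by
  obtain ⟨s, hs, D, E, hD0, hD, hE, hconv, hcomp⟩ := A.disc a ha
  have h0 := Metric.mem_ball_self (x := (0 : ℂ)) hs
  rw [← hD0] at hFa hGa
  obtain ⟨u, hu, hFu⟩ := hcomp 0 h0 _ hFa
  obtain ⟨v, hv, hGv⟩ := hcomp 0 h0 _ hGa
  have small : ∀ u : ι → ℂ, Tendsto u U (𝓝 0) → ∀ ε > 0, ∀ᶠ j in (U : Filter ι), ‖u j‖ < ε := by
    intro u hu ε hε
    have := hu.norm
    rw [norm_zero] at this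
    exact this.eventually (gt_mem_nhds hε)
  set R := min r (s / 2) with hR
  have hR0 : 0 < R := lt_min hr (by positivity)
  have hRs : R ≤ s / 2 := min_le_right _ _
  have claim : ∀ (F : ∀ j, ℂ → N j) (p : ℂ) (u : ι → ℂ),
      (∀ᶠ j in (U : Filter ι), ∀ z ∈ Metric.ball p r, (N j).FlatAt (F j) z) →
      Tendsto u U (𝓝 0) → (∀ᶠ j in (U : Filter ι), F j p = E j (u j)) →
      ∀ᶠ j in (U : Filter ι), ∀ z ∈ Metric.ball (0 : ℂ) R, F j (p + z) = E j (u j + z) := by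
    intro F p u hF hu hFu
    filter_upwards [hF, hFu, hE, small u hu (s / 2) (by positivity)] with j h1 h2 h3 h4
    refine eqOn_of_flatAt (convex_ball (0 : ℂ) R).isPreconnected (fun z hz => ?_) (fun z hz => ?_)
      (Metric.mem_ball_self hR0) (by simpa using h2)
    · refine FlatAt.comp_const_add (h1 _ ?_)
      rw [mem_ball_iff_norm, add_sub_cancel_left]
      exact (mem_ball_zero_iff.1 hz).trans_le (min_le_left _ _)
    · refine FlatAt.comp_const_add (h3.1 _ ?_)
      rw [mem_ball_zero_iff] at hz ⊢
      linarith [norm_add_le (u j) z]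
  refine ⟨fun j => u j - v j, by simpa using hu.sub hv, R / 2, by positivity, ?_⟩
  filter_upwards [claim F p u hF hu hFu, claim G q v hG hv hGv,
    small (fun j => u j - v j) (by simpa using hu.sub hv) (R / 2) (by positivity)]
    with j h1 h2 h3 z hz
  rw [h1 z (mem_ball_zero_iff.2 (by linarith)), add_assoc, h2]
  · congr 1
    ring
  · rw [mem_ball_zero_iff]
    linarith [norm_add_le z (u j - v j)]

end TranslationSurface

/-! ### Persistence of trajectories under limits. -/

namespace TranslationSurface

variable {k : ℕ} {α : Fin k → ℕ} {ι : Type*}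
variable {U : Ultrafilter ι} {M : TranslationSurface α} {N : ι → TranslationSurface α}

/-- The path from `x` to `y` which follows `P` up to time `a`, then `Q` up to time `b`, then `R`. -/
noncomputable def gluePath {X : Type*} (x y : X) (P Q R : ℝ → X) (a b t : ℝ) : X :=
  if t ≤ 0 then x else if t ≤ a then P t else if t ≤ b then Q t else if t < 1 then R t else y

theorem isSegment_gluePath {x y : M} {P Q R : ℝ → M} {v : ℂ} {a b : ℝ} (ha : 0 < a) (hab : a < b)
    (hb : b < 1) (hP : ∀ t ∈ Ioc 0 a, M.PathFlatAt P v t) (hQ : ∀ t ∈ Icc a b, M.PathFlatAt Q v t)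
    (hR : ∀ t ∈ Ico b 1, M.PathFlatAt R v t) (hPQ : ∀ᶠ t in 𝓝 a, P t = Q t)
    (hQR : ∀ᶠ t in 𝓝 b, Q t = R t) (hx : Tendsto P (𝓝[>] 0) (𝓝 x))
    (hy : Tendsto R (𝓝[<] 1) (𝓝 y)) (hv : v ≠ 0) :
    M.IsSegment x y (gluePath x y P Q R a b) v := by
  have h0 : gluePath x y P Q R a b 0 = x := by simp [gluePath]
  have h1 : gluePath x y P Q R a b 1 = y := by
    simp [gluePath, (hab.trans hb).not_ge, hb.not_ge]
  have flat : ∀ t ∈ Ioo (0 : ℝ) 1, M.PathFlatAt (gluePath x y P Q R a b) v t := by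
    intro t ht
    rcases lt_trichotomy t a with hta | rfl | hta
    · refine (hP t ⟨ht.1, hta.le⟩).congr ?_
      filter_upwards [lt_mem_nhds ht.1, gt_mem_nhds hta] with s h1 h2
      simp [gluePath, h1.not_ge, h2.le]
    · refine (hP t ⟨ht.1, le_rfl⟩).congr ?_
      filter_upwards [lt_mem_nhds ht.1, gt_mem_nhds hab, hPQ] with s h1 h2 h3
      simp [gluePath, h1.not_ge, h2.le, h3]
    · rcases lt_trichotomy t b with htb | rfl | htb
      · refine (hQ t ⟨hta.le, htb.le⟩).congr ?_
        filter_upwards [lt_mem_nhds ht.1, lt_mem_nhds hta, gt_mem_nhds htb] with s h1 h2 h3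
        simp [gluePath, h1.not_ge, h2.not_ge, h3.le]
      · refine (hQ t ⟨hta.le, le_rfl⟩).congr ?_
        filter_upwards [lt_mem_nhds ht.1, lt_mem_nhds hta, gt_mem_nhds hb, hQR] with s h1 h2 h3 h4
        simp [gluePath, h1.not_ge, h2.not_ge, h3, h4]
      · refine (hR t ⟨htb.le, ht.2⟩).congr ?_
        filter_upwards [lt_mem_nhds ht.1, lt_mem_nhds hta, lt_mem_nhds htb, gt_mem_nhds ht.2]
          with s h1 h2 h3 h4
        simp [gluePath, h1.not_ge, h2.not_ge, h3.not_ge, h4]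
  refine ⟨?_, h0, h1, flat, hv⟩
  intro t ht
  rcases eq_or_lt_of_le ht.1 with rfl | ht0
  · rw [ContinuousWithinAt, h0]
    have hle : 𝓝[Icc 0 1] (0 : ℝ) ≤ pure 0 ⊔ 𝓝[>] 0 := by
      have : (Icc 0 1 : Set ℝ) ⊆ {0} ∪ Ioi 0 := fun s hs => by
        rcases eq_or_lt_of_le hs.1 with h | h
        · exact Or.inl h.symm
        · exact Or.inr h
      exact (nhdsWithin_mono _ this).trans (by rw [nhdsWithin_union, nhdsWithin_singleton])
    refine Tendsto.mono_left (tendsto_sup.2 ⟨?_, ?_⟩) hle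
    · rw [tendsto_pure_left]
      intro s hs
      rw [h0]
      exact mem_of_mem_nhds hs
    · refine hx.congr' ?_
      filter_upwards [Ioc_mem_nhdsGT ha] with s hs
      simp [gluePath, hs.1.not_ge, hs.2]
  · rcases eq_or_lt_of_le ht.2 with rfl | ht1
    · rw [ContinuousWithinAt, h1]
      have hle : 𝓝[Icc 0 1] (1 : ℝ) ≤ pure 1 ⊔ 𝓝[<] 1 := by
        have : (Icc 0 1 : Set ℝ) ⊆ {1} ∪ Iio 1 := fun s hs => by
          rcases eq_or_lt_of_le hs.2 with h | h
          · exact Or.inl h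
          · exact Or.inr h
        exact (nhdsWithin_mono _ this).trans (by rw [nhdsWithin_union, nhdsWithin_singleton])
      refine Tendsto.mono_left (tendsto_sup.2 ⟨?_, ?_⟩) hle
      · rw [tendsto_pure_left]
        intro s hs
        rw [h1]
        exact mem_of_mem_nhds hs
      · refine hy.congr' ?_
        filter_upwards [Ioo_mem_nhdsLT hb] with s hs
        simp [gluePath, ((ha.trans hab).trans hs.1).not_ge, (hab.trans hs.1).not_ge, hs.1.not_ge,
          hs.2]
    · exact (flat t ⟨ht0, ht1⟩).continuousAt.continuousWithinAt

/-- Trajectories persist: a segment of `M` with launches at both ends is the limit of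
segments of the surfaces `N j`. -/
theorem Approx.persist (A : Approx U M N) {xs ys : ∀ j, N j} {x y : M} {σ : ℝ → M} {w : ℂ}
    {S S' : ∀ j, ℂ → N j} {t₀ r t₁ r' : ℝ} (hσ : M.IsSegment x y σ w)
    (hS : LaunchOn A xs σ w S t₀ r)
    (hS' : LaunchOn A ys (fun t => σ (1 - t)) (-w) S' t₁ r') :
    ∃ (v : ι → ℂ) (γ : ∀ j, ℝ → N j), Tendsto v U (𝓝 w) ∧
      (∀ᶠ j in (U : Filter ι), (N j).IsSegment (xs j) (ys j) (γ j) (v j)) ∧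
      ∀ t : ι → ℝ, (∀ᶠ j in (U : Filter ι), t j ∈ Ioo (0 : ℝ) 1) → ∀ s, Tendsto t U (𝓝 s) →
        A.Conv (fun j => γ j (t j)) (σ s) ∧
        (s = 0 → ∀ᶠ j in (U : Filter ι), γ j (t j) = S j ((t j : ℂ) * v j)) ∧
        (s = 1 → ∀ᶠ j in (U : Filter ι), γ j (t j) = S' j (((1 - t j : ℝ) : ℂ) * (-v j))) := by
  set a := min (min t₀ t₁) (1 / 4) with ha
  have ha0 : 0 < a := lt_min (lt_min hS.time_pos hS'.time_pos) (by norm_num)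
  have ha4 : a ≤ 1 / 4 := min_le_right _ _
  replace hS := hS.mono ha0 ((min_le_left _ _).trans (min_le_left _ _))
  replace hS' := hS'.mono ha0 ((min_le_left _ _).trans (min_le_right _ _))
  set b := 1 - a with hb
  have hab : a < b := by linarith
  have hb1 : b < 1 := by linarith
  obtain ⟨R, hR, S₁, hflat, hinit, hconv⟩ := hS.stripOn_of_lt hσ hab.le hb1
  have hreg := (hσ.flat b ⟨ha0.trans hab, hb1⟩).regular
  have hr' := hS'.radius_pos
  have haC : (a : ℂ) ≠ 0 := by exact_mod_cast ha0.ne'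
  -- At time `b` the strip continued from `xs j` and the launch from `ys j` tend to the same regular
  -- point of `M`, so they differ by a translation `d j` tending to zero.
  obtain ⟨d, hd, ρ, hρ, hmatch⟩ := A.exists_shift hreg (F := S₁) (G := S') (p := (b : ℂ) * w)
    (q := (a : ℂ) * (-w)) (r := min R (a * r')) (lt_min hR (by positivity))
    (by
      filter_upwards [hflat] with j hj z hz
      exact hj z (mem_planeStrip.2 ⟨b, ⟨hab.le, le_rfl⟩,
        (mem_ball_iff_norm.1 hz).trans_le (min_le_left _ _)⟩))
    (by
      filter_upwards [hS'.flat] with j hj z hz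
      have := hj (z / a) ?_ a ⟨ha0, le_rfl⟩
      · rwa [mul_div_cancel₀ _ haC] at this
      · rw [mem_ball_iff_norm] at hz ⊢
        have h1 : z - a * -w = a * (z / a - -w) := by field_simp
        rw [h1, norm_mul, Complex.norm_real, Real.norm_of_nonneg ha0.le] at hz
        exact lt_of_mul_lt_mul_left (hz.trans_le (min_le_right _ _)) ha0.le)
    (hconv b ⟨hab.le, le_rfl⟩ _ tendsto_const_nhds)
    (by
      have := hS'.conv (fun _ => -w) tendsto_const_nhds (fun _ => a)
        (Eventually.of_forall fun _ => ⟨ha0, le_rfl⟩) a tendsto_const_nhds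
      simpa [hb] using this)
  have hv : Tendsto (fun j => w - d j) U (𝓝 w) := by simpa using hd.const_sub w
  have hdn : ∀ ε > 0, ∀ᶠ j in (U : Filter ι), ‖d j‖ < ε := by
    intro ε hε
    have := hd.norm
    rw [norm_zero] at this
    exact this.eventually (gt_mem_nhds hε)
  -- The velocity absorbs the mismatch exactly: since `a + b = 1`, the matching relation turns the
  -- strip at `t * (w - d j)` into the launch from `ys j` at `(1 - t) * -(w - d j)`.
  refine ⟨fun j => w - d j, fun j => gluePath (xs j) (ys j) (fun t => S j ((t : ℂ) * (w - d j)))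
    (fun t => S₁ j ((t : ℂ) * (w - d j))) (fun t => S' j (((1 - t : ℝ) : ℂ) * (-(w - d j)))) a b,
    hv, ?_, ?_⟩
  · filter_upwards [hflat, hinit, hmatch, hS.flat, hS'.flat, hS.start, hS'.start,
      hdn R hR, hdn r hS.radius_pos, hdn r' hr', hdn ρ hρ,
      hv.eventually_ne hσ.ne_zero] with j h1 h2 h3 h4 h5 h6 h7 h8 h9 h10 h11 h12
    have hvr : w - d j ∈ Metric.ball w r := by simpa [mem_ball_iff_norm] using h9
    have hvr' : -(w - d j) ∈ Metric.ball (-w) r' := by simpa [mem_ball_iff_norm] using h10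
    have hcont : ∀ t c : ℝ, ContinuousAt (fun t : ℝ => ‖(t : ℂ) * (w - d j) - c * w‖) t := by
      intro t c
      fun_prop
    refine isSegment_gluePath ha0 hab hb1 ?_ ?_ ?_ ?_ ?_ (h6 _ hvr) ?_ h12
    · intro t ht
      exact (h4 _ hvr t ht).pathFlatAt'
    · intro t ht
      refine (h1 _ (mem_planeStrip.2 ⟨t, ht, ?_⟩)).pathFlatAt'
      rw [← mul_sub, norm_mul, Complex.norm_real, Real.norm_of_nonneg (ha0.le.trans ht.1),
        sub_sub_cancel_left, norm_neg]
      nlinarith [norm_nonneg (d j), ht.2]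
    · intro t ht
      have h := (h5 _ hvr' (1 - t) ⟨by linarith [ht.2], by linarith [ht.1]⟩)
      have h' := FlatAt.pathFlatAt (M := N j) (S := S' j) (w := w - d j) (c := -(w - d j)) (t := t)
        (by convert h using 1; push_cast; ring)
      convert h' using 3
      push_cast
      ring
    · have : ‖(a : ℂ) * (w - d j) - a * w‖ < R := by
        rw [← mul_sub, norm_mul, Complex.norm_real, Real.norm_of_nonneg ha0.le,
          sub_sub_cancel_left, norm_neg]
        nlinarith [norm_nonneg (d j)]
      filter_upwards [(hcont a a).eventually (gt_mem_nhds this)] with t ht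
      exact (h2 _ (mem_ball_iff_norm.2 ht)).symm
    · have : ‖(b : ℂ) * (w - d j) - b * w‖ < ρ := by
        rw [← mul_sub, norm_mul, Complex.norm_real, Real.norm_of_nonneg (by linarith),
          sub_sub_cancel_left, norm_neg]
        nlinarith [norm_nonneg (d j)]
      filter_upwards [(hcont b b).eventually (gt_mem_nhds this)] with t ht
      have := h3 _ ht
      rw [add_sub_cancel] at this
      rw [this]
      congr 1
      rw [hb]
      push_cast
      ring
    · have h := h7 _ hvr'
      have ht : Tendsto (fun t : ℝ => 1 - t) (𝓝[<] 1) (𝓝[>] 0) := by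
        refine tendsto_nhdsWithin_iff.2 ⟨?_, ?_⟩
        · have : Continuous fun t : ℝ => 1 - t := by fun_prop
          simpa using (this.tendsto 1).mono_left nhdsWithin_le_nhds
        · filter_upwards [self_mem_nhdsWithin] with t ht
          exact mem_Ioi.2 (sub_pos.2 (mem_Iio.1 ht))
      exact h.comp ht
  · intro t ht s hs
    have hP : (∀ᶠ j in (U : Filter ι), t j ≤ a) → ∀ᶠ j in (U : Filter ι),
        gluePath (xs j) (ys j) (fun t => S j ((t : ℂ) * (w - d j)))
          (fun t => S₁ j ((t : ℂ) * (w - d j)))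
          (fun t => S' j (((1 - t : ℝ) : ℂ) * (-(w - d j)))) a b (t j)
          = S j ((t j : ℂ) * (w - d j)) := by
      intro h
      filter_upwards [h, ht] with j hj hj'
      simp [gluePath, hj'.1.not_ge, hj]
    have hR : (∀ᶠ j in (U : Filter ι), b < t j) → ∀ᶠ j in (U : Filter ι),
        gluePath (xs j) (ys j) (fun t => S j ((t : ℂ) * (w - d j)))
          (fun t => S₁ j ((t : ℂ) * (w - d j)))
          (fun t => S' j (((1 - t : ℝ) : ℂ) * (-(w - d j)))) a b (t j)
          = S' j (((1 - t j : ℝ) : ℂ) * (-(w - d j))) := by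
      intro h
      filter_upwards [h, ht] with j hj hj'
      simp [gluePath, hj'.1.not_ge, (hab.trans hj).not_ge, hj.not_ge, hj'.2]
    refine ⟨?_, ?_, ?_⟩
    · by_cases hA : ∀ᶠ j in (U : Filter ι), t j ≤ a
      · refine A.congr (hP hA) (hS.conv _ hv t ?_ s hs)
        filter_upwards [hA, ht] with j h1 h2
        exact ⟨h2.1, h1⟩
      · rw [← Ultrafilter.eventually_not] at hA
        by_cases hB : ∀ᶠ j in (U : Filter ι), t j ≤ b
        · have hsm : s ∈ Icc a b := by
            refine isClosed_Icc.mem_of_tendsto hs ?_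
            filter_upwards [hA, hB] with j h1 h2
            exact ⟨(not_le.1 h1).le, h2⟩
          refine A.congr ?_ (hconv s hsm (fun j => (t j : ℂ) * (w - d j)) ?_)
          · filter_upwards [hA, hB, ht] with j h1 h2 h3
            simp [gluePath, h3.1.not_ge, h1, h2]
          · exact ((Complex.continuous_ofReal.tendsto s).comp hs).mul hv
        · rw [← Ultrafilter.eventually_not] at hB
          have hB' := hB.mono fun j hj => not_le.1 hj
          refine A.congr (hR hB') ?_
          have := hS'.conv (fun j => -(w - d j)) hv.neg (fun j => 1 - t j) ?_ (1 - s)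
            (hs.const_sub 1)
          · simpa using this
          · filter_upwards [hB', ht] with j h1 h2
            exact ⟨by linarith [h2.2], by linarith⟩
    · rintro rfl
      exact hP ((hs.eventually (gt_mem_nhds ha0)).mono fun j hj => hj.le)
    · rintro rfl
      exact hR (hs.eventually (lt_mem_nhds hb1))

end TranslationSurface

/-! ### Limits of blocking sets. -/

/-- Indexing by the fixed set `Fin n` lets an ultrafilter select one index for a whole family of
blocking sets. Surplus indices carry an arbitrary point, which only enlarges the range. -/
theorem Finset.exists_subset_range_of_card_le {X : Type*} [Nonempty X] (B : Finset X) {n : ℕ}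
    (h : B.card ≤ n) : ∃ b : Fin n → X, (B : Set X) ⊆ Set.range b := by
  refine ⟨fun i => B.toList.getD i (Classical.arbitrary X), fun x hx => ?_⟩
  obtain ⟨i, hi, hix⟩ := List.getElem_of_mem (Finset.mem_toList.2 hx)
  have hin : i < n := by
    rw [Finset.length_toList] at hi
    exact hi.trans_le h
  exact ⟨⟨i, hin⟩, by simp [List.getD, List.getElem?_eq_getElem hi, hix]⟩

namespace TranslationSurface

variable {k : ℕ} {α : Fin k → ℕ} {ι : Type*}
variable {U : Ultrafilter ι} {M : TranslationSurface α} {N : ι → TranslationSurface α}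

/-- The points `b j` lie on the launches `S j` in directions close to `w`, at times tending
to zero. -/
def HitAtStart (U : Ultrafilter ι) (w : ℂ) (S : ∀ j, ℂ → N j) (b : ∀ j, N j) : Prop :=
  ∃ (v : ι → ℂ) (s : ι → ℝ), Tendsto v U (𝓝 w) ∧ Tendsto s U (𝓝 0) ∧
    (∀ᶠ j in (U : Filter ι), 0 < s j) ∧ ∀ᶠ j in (U : Filter ι), b j = S j ((s j : ℂ) * v j)

/-- A family of paths with launches such that points of the surfaces `N j` close to the starting
point determine the germs of the paths whose launches they hit. -/
structure LaunchFamily (A : Approx U M N) (xs : ∀ j, N j) {κ : Type*} (σ : κ → ℝ → M) (w : κ → ℂ)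
    (S : κ → ∀ j, ℂ → N j) : Prop where
  launch : ∀ p, ∃ t₀ r, LaunchOn A xs (σ p) (w p) (S p) t₀ r
  germ : ∀ p q b, HitAtStart U (w p) (S p) b → HitAtStart U (w q) (S q) b →
    ∃ c : ℝ, 0 < c ∧ w p = c * w q ∧ ∀ᶠ t in 𝓝[>] (0 : ℝ), σ p t = σ q (c * t)

theorem HitAtStart.conv {A : Approx U M N} {xs : ∀ j, N j} {σ : ℝ → M} {w : ℂ} {t₀ r : ℝ}
    {S : ∀ j, ℂ → N j} {b : ∀ j, N j} (h : HitAtStart U w S b) (hS : LaunchOn A xs σ w S t₀ r) :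
    A.Conv b (σ 0) := by
  obtain ⟨v, s, hv, hs, hs0, hb⟩ := h
  refine A.congr hb (hS.conv v hv s ?_ 0 hs)
  filter_upwards [hs0, hs.eventually (gt_mem_nhds hS.time_pos)] with j h1 h2
  exact ⟨h1, h2.le⟩

/-- Blocking sets of at most `n` points of the surfaces `N j` converge to a set which blocks a
given family of primitive segments of `M`. -/
theorem Approx.exists_blocking (A : Approx U M N) {xs ys : ∀ j, N j} {x y : M} {n : ℕ}
    (hn : ∀ᶠ j in (U : Filter ι), (N j).bc (xs j) (ys j) ≤ n)
    {κ : Type*} {σ : κ → ℝ → M} {w : κ → ℂ} (hσ : ∀ p, M.IsPrimitive x y (σ p) (w p))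
    {S S' : κ → ∀ j, ℂ → N j} (hS : LaunchFamily A xs σ w S)
    (hS' : LaunchFamily A ys (fun p t => σ p (1 - t)) (fun p => -w p) S') :
    ∃ B : Finset M, x ∉ B ∧ y ∉ B ∧ (∀ p, ∃ t ∈ Icc (0 : ℝ) 1, σ p t ∈ B) ∧
      B.card ≤ 2 * n ∧ (x ≠ y → B.card ≤ n) := by
  classical
  have hb : ∀ j, ∃ b : Fin n → N j, (N j).bc (xs j) (ys j) ≤ n →
      ∃ B : Finset (N j), (N j).IsBlockingSet (xs j) (ys j) B ∧ (B : Set (N j)) ⊆ range b := by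
    intro j
    have : Nonempty (N j) := ⟨xs j⟩
    by_cases h : (N j).bc (xs j) (ys j) ≤ n
    · obtain ⟨B, hB, hc⟩ := bc_le_iff.1 h
      obtain ⟨b, hb⟩ := B.exists_subset_range_of_card_le hc
      exact ⟨b, fun _ => ⟨B, hB, hb⟩⟩
    · exact ⟨fun _ => xs j, fun h' => absurd h' h⟩
  choose b hb using hb
  choose β hβ using fun i : Fin n => A.exists_conv (fun j => b j i)
  have hstart : ∀ p i, HitAtStart U (w p) (S p) (fun j => b j i) → β i = x := by
    intro p i h
    obtain ⟨t₀, r, hl⟩ := hS.launch p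
    rw [← (hσ p).start]
    exact A.unique (hβ i) (h.conv hl)
  have hend : ∀ p i, HitAtStart U (-w p) (S' p) (fun j => b j i) → β i = y := by
    intro p i h
    obtain ⟨t₀, r, hl⟩ := hS'.launch p
    rw [← (hσ p).finish]
    have := A.unique (hβ i) (h.conv hl)
    simpa using this
  -- The ultrafilter fixes the index `i` and the limit `s` of the hitting times. An interior `s`
  -- gives `σ p s = β i`; the values `0` and `1` mean that the blocking points run into an end of `σ
  -- p` along its launch.
  have hit : ∀ p, ∃ i, (∃ t ∈ Ioo (0 : ℝ) 1, σ p t = β i) ∨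
      HitAtStart U (w p) (S p) (fun j => b j i) ∨ HitAtStart U (-w p) (S' p) (fun j => b j i) := by
    intro p
    obtain ⟨t₀, r, hl⟩ := hS.launch p
    obtain ⟨t₁, r', hl'⟩ := hS'.launch p
    obtain ⟨v, γ, hv, hγ, hlim⟩ := A.persist (hσ p).toIsSegment hl hl'
    have h1 : ∀ᶠ j in (U : Filter ι), ∃ i : Fin n, ∃ t ∈ Ioo (0 : ℝ) 1, γ j t = b j i := by
      filter_upwards [hn, hγ] with j hj hj'
      obtain ⟨B, hB, hBb⟩ := hb j hj
      obtain ⟨t, ht, htB⟩ := hB.2.2 _ hj'.isTrajectory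
      obtain ⟨i, hi⟩ := hBb htB
      refine ⟨i, t, ⟨lt_of_le_of_ne ht.1 ?_, lt_of_le_of_ne ht.2 ?_⟩, hi.symm⟩
      · rintro rfl
        exact hB.1 (hj'.start ▸ htB)
      · rintro rfl
        exact hB.2.1 (hj'.finish ▸ htB)
    obtain ⟨i, hi⟩ := Ultrafilter.eventually_exists_iff.1 h1
    obtain ⟨t, ht⟩ : ∃ t : ι → ℝ, ∀ᶠ j in (U : Filter ι), t j ∈ Ioo (0 : ℝ) 1 ∧ γ j (t j) = b j i := by
      have : ∀ j, ∃ t : ℝ, (∃ t ∈ Ioo (0 : ℝ) 1, γ j t = b j i) →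
          t ∈ Ioo (0 : ℝ) 1 ∧ γ j t = b j i := by
        intro j
        by_cases h : ∃ t ∈ Ioo (0 : ℝ) 1, γ j t = b j i
        · obtain ⟨t, ht⟩ := h
          exact ⟨t, fun _ => ht⟩
        · exact ⟨0, fun h' => absurd h' h⟩
      choose t ht using this
      exact ⟨t, hi.mono fun j hj => ht j hj⟩
    have htm : ∀ᶠ j in (U : Filter ι), t j ∈ Ioo (0 : ℝ) 1 := ht.mono fun j hj => hj.1
    obtain ⟨s, hs, hts⟩ := (isCompact_Icc (a := (0 : ℝ)) (b := 1)).ultrafilter_le_nhds (U.map t)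
      (le_principal_iff.2 (htm.mono fun j hj => ⟨hj.1.le, hj.2.le⟩))
    have hts' : Tendsto t U (𝓝 s) := hts
    obtain ⟨hc, hc0, hc1⟩ := hlim t htm s hts'
    refine ⟨i, ?_⟩
    rcases eq_or_lt_of_le hs.1 with h0 | h0
    · right; left
      refine ⟨v, t, hv, h0 ▸ hts', htm.mono fun j hj => hj.1, ?_⟩
      filter_upwards [hc0 h0.symm, ht] with j h2 h3
      rw [← h2, h3.2]
    rcases eq_or_lt_of_le hs.2 with h1 | h1
    · right; right
      refine ⟨fun j => -v j, fun j => 1 - t j, hv.neg, ?_, htm.mono fun j hj => sub_pos.2 hj.2, ?_⟩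
      · simpa [h1] using hts'.const_sub 1
      · filter_upwards [hc1 h1, ht] with j h2 h3
        rw [← h2, h3.2]
    · left
      refine ⟨s, ⟨h0, h1⟩, A.unique (A.congr ?_ hc) (hβ i)⟩
      filter_upwards [ht] with j hj using hj.2.symm
  -- Midpoints replace a `β i` that is an end. By `germ`, all segments whose launches at a given end
  -- are hit by the `i`-th blocking points have the same germ up to scaling; being primitive they
  -- coincide, so one midpoint for each end serves them all.
  set P : Fin n → Finset M := fun i =>
    if h : ∃ p, HitAtStart U (w p) (S p) (fun j => b j i) then {σ h.choose (1 / 2)} else ∅ with hP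
  set Q : Fin n → Finset M := fun i =>
    if h : ∃ p, HitAtStart U (-w p) (S' p) (fun j => b j i) then {σ h.choose (1 / 2)} else ∅ with hQ
  set R : Fin n → Finset M := fun i => if β i = x ∨ β i = y then P i ∪ Q i else {β i} with hR
  have hPc : ∀ i, (P i).card ≤ 1 := by
    intro i; simp only [hP]; split_ifs <;> simp
  have hQc : ∀ i, (Q i).card ≤ 1 := by
    intro i; simp only [hQ]; split_ifs <;> simp
  have hhalf : (1 / 2 : ℝ) ∈ Ioo (0 : ℝ) 1 := by norm_num
  have hPm : ∀ i, ∀ m ∈ P i, m ≠ x ∧ m ≠ y ∧ β i = x := by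
    intro i m hm
    simp only [hP] at hm
    split_ifs at hm with h
    · rw [Finset.mem_singleton.1 hm]
      exact ⟨(hσ _).ne_start _ hhalf, (hσ _).ne_finish _ hhalf, hstart _ i h.choose_spec⟩
    · simp at hm
  have hQm : ∀ i, ∀ m ∈ Q i, m ≠ x ∧ m ≠ y ∧ β i = y := by
    intro i m hm
    simp only [hQ] at hm
    split_ifs at hm with h
    · rw [Finset.mem_singleton.1 hm]
      exact ⟨(hσ _).ne_start _ hhalf, (hσ _).ne_finish _ hhalf, hend _ i h.choose_spec⟩
    · simp at hm
  have hRm : ∀ i, ∀ m ∈ R i, m ≠ x ∧ m ≠ y := by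
    intro i m hm
    simp only [hR] at hm
    split_ifs at hm with h
    · rcases Finset.mem_union.1 hm with h | h
      · exact ⟨(hPm i m h).1, (hPm i m h).2.1⟩
      · exact ⟨(hQm i m h).1, (hQm i m h).2.1⟩
    · rw [Finset.mem_singleton.1 hm]
      exact not_or.1 h
  refine ⟨Finset.univ.biUnion R, ?_, ?_, ?_, ?_, ?_⟩
  · simp only [Finset.mem_biUnion, not_exists, not_and]
    exact fun i _ hm => (hRm i x hm).1 rfl
  · simp only [Finset.mem_biUnion, not_exists, not_and]
    exact fun i _ hm => (hRm i y hm).2 rfl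
  · intro p
    obtain ⟨i, ⟨t, ht, hti⟩ | h | h⟩ := hit p
    · refine ⟨t, Ioo_subset_Icc_self ht, Finset.mem_biUnion.2 ⟨i, Finset.mem_univ _, ?_⟩⟩
      have : ¬ (β i = x ∨ β i = y) := by
        rw [← hti]
        exact not_or.2 ⟨(hσ p).ne_start t ht, (hσ p).ne_finish t ht⟩
      simp [hR, this, hti]
    · refine ⟨1 / 2, Ioo_subset_Icc_self hhalf, Finset.mem_biUnion.2 ⟨i, Finset.mem_univ _, ?_⟩⟩
      have hx : β i = x ∨ β i = y := Or.inl (hstart p i h)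
      have he : ∃ p, HitAtStart U (w p) (S p) (fun j => b j i) := ⟨p, h⟩
      obtain ⟨c, hc, hw, hg⟩ := hS.germ p _ _ h he.choose_spec
      have := ((hσ p).mem_of_germ (hσ _) hc hw hg).2 _ hhalf
      simp only [hR, if_pos hx]
      refine Finset.mem_union_left _ ?_
      simp only [hP, dif_pos he, Finset.mem_singleton]
      exact this
    · refine ⟨1 / 2, Ioo_subset_Icc_self hhalf, Finset.mem_biUnion.2 ⟨i, Finset.mem_univ _, ?_⟩⟩
      have hx : β i = x ∨ β i = y := Or.inr (hend p i h)
      have he : ∃ p, HitAtStart U (-w p) (S' p) (fun j => b j i) := ⟨p, h⟩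
      obtain ⟨c, hc, hw, hg⟩ := hS'.germ p _ _ h he.choose_spec
      have := ((hσ p).reverse.mem_of_germ (hσ _).reverse hc hw hg).2 _ hhalf
      simp only [hR, if_pos hx]
      refine Finset.mem_union_right _ ?_
      simp only [hQ, dif_pos he, Finset.mem_singleton]
      have h12 : (1 : ℝ) - 1 / 2 = 1 / 2 := by norm_num
      simpa only [h12] using this
  · refine Finset.card_biUnion_le.trans ((Finset.sum_le_card_nsmul _ _ 2 fun i _ => ?_).trans ?_)
    · simp only [hR]
      split_ifs
      · exact (Finset.card_union_le _ _).trans (add_le_add (hPc i) (hQc i))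
      · simp
    · simp [mul_comm]
  -- A point of `P i` forces `β i = x` and a point of `Q i` forces `β i = y`, so each index
  -- contributes at most one point.
  · intro hxy
    refine Finset.card_biUnion_le.trans ((Finset.sum_le_card_nsmul _ _ 1 fun i _ => ?_).trans ?_)
    · simp only [hR]
      split_ifs
      · rcases (P i).eq_empty_or_nonempty with h | ⟨m, hm⟩
        · rw [h, Finset.empty_union]
          exact hQc i
        · rcases (Q i).eq_empty_or_nonempty with h | ⟨m', hm'⟩
          · rw [h, Finset.union_empty]
            exact hPc i
          · exact absurd ((hPm i m hm).2.2.symm.trans (hQm i m' hm').2.2) hxy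
      · simp
    · simp

end TranslationSurface

/-! ### Local coordinates at a point and reduction to primitive segments. -/

/-- Vectors on a common ray satisfy `v * ‖v'‖ = v' * ‖v‖`; this identity passes to the limit and
says that `w` and `w'` have the same direction. -/
theorem exists_pos_smul_of_rays {ι : Type*} {l : Filter ι} [l.NeBot] {v v' : ι → ℂ} {s s' : ι → ℝ}
    {w w' : ℂ} (hw : w ≠ 0) (hw' : w' ≠ 0) (hv : Tendsto v l (𝓝 w)) (hv' : Tendsto v' l (𝓝 w'))
    (hs : ∀ᶠ j in l, 0 < s j) (hs' : ∀ᶠ j in l, 0 < s' j)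
    (h : ∀ᶠ j in l, (s j : ℂ) * v j = s' j * v' j) : ∃ c : ℝ, 0 < c ∧ w = c * w' := by
  have h1 : w * ‖w'‖ = w' * ‖w‖ := by
    have hl := hv.mul ((Complex.continuous_ofReal.tendsto _).comp hv'.norm)
    have hr := hv'.mul ((Complex.continuous_ofReal.tendsto _).comp hv.norm)
    refine tendsto_nhds_unique (hl.congr' ?_) hr
    filter_upwards [hs, hs', h] with j h1 h2 h3
    have h4 : s j * ‖v j‖ = s' j * ‖v' j‖ := by
      have := congrArg norm h3
      simpa [abs_of_pos h1, abs_of_pos h2] using this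
    have h4' : (s j : ℂ) * ‖v j‖ = s' j * ‖v' j‖ := by exact_mod_cast h4
    have h5 : (s j : ℂ) ≠ 0 := by exact_mod_cast h1.ne'
    have h6 : (s' j : ℂ) ≠ 0 := by exact_mod_cast h2.ne'
    refine mul_left_cancel₀ (mul_ne_zero h5 h6) ?_
    simp only [Function.comp_apply]
    linear_combination (s' j : ℂ) * (‖v' j‖ : ℂ) * h3 - (s' j : ℂ) * v' j * h4'
  have hp := norm_pos_iff.2 hw
  have hp' := norm_pos_iff.2 hw'
  have hpc : (‖w'‖ : ℂ) ≠ 0 := by exact_mod_cast hp'.ne'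
  refine ⟨‖w‖ / ‖w'‖, div_pos hp hp', ?_⟩
  push_cast
  field_simp
  linear_combination h1

namespace TranslationSurface

variable {k : ℕ} {α : Fin k → ℕ} {ι : Type*}
variable {U : Ultrafilter ι} {M : TranslationSurface α} {N : ι → TranslationSurface α}

/-- `ζ` is a coordinate centred at `x` such that `ζ ^ (a + 1)` is a planar coordinate. -/
structure ConeAt (M : TranslationSurface α) (x : M) (a : ℕ) (ζ : OpenPartialHomeomorph M ℂ) :
    Prop where
  mem_source : x ∈ ζ.source
  map_center : ζ x = 0
  regular : ∀ p ∈ ζ.source, p ≠ x → p ∉ M.singSet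
  agree : ∀ φ ∈ M.charts, ∀ p ∈ φ.source ∩ ζ.source,
    ∀ᶠ q in 𝓝 p, φ q - ζ q ^ (a + 1) = φ p - ζ p ^ (a + 1)

theorem coneAt_of_chart {φ : OpenPartialHomeomorph M ℂ} (hφ : φ ∈ M.charts) {x : M}
    (hx : x ∈ φ.source) : M.ConeAt x 0 (φ.transHomeomorph (Homeomorph.addRight (-φ x))) where
  mem_source := hx
  map_center := by simp
  regular p hp _ := M.chart_regular φ hφ p hp
  agree ψ hψ p hp := by
    filter_upwards [M.chart_translation φ hφ ψ hψ p ⟨hp.2, hp.1⟩] with q hq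
    simp only [zero_add, pow_one, OpenPartialHomeomorph.transHomeomorph_apply,
      Function.comp_apply, Homeomorph.coe_addRight]
    linear_combination hq

/-- The bound `∑ i, α i`, uniform over points and surfaces, is what makes the final `ℓ` depend on
`n` and `α` only. A regular point has `a = 0`. -/
theorem exists_coneAt (M : TranslationSurface α) (x : M) :
    ∃ a ≤ ∑ i, α i, ∃ ζ, M.ConeAt x a ζ := by
  by_cases hx : x ∈ M.singSet
  · obtain ⟨i, rfl⟩ := hx
    obtain ⟨ζ, h1, h2, h3, h4⟩ := M.cone i
    refine ⟨α i, Finset.single_le_sum (fun _ _ => Nat.zero_le _) (Finset.mem_univ i), ζ, h1, h2,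
      ?_, h4⟩
    rintro p hp hne ⟨j, rfl⟩
    exact hne (by rw [h3 j hp])
  · obtain ⟨φ, hφ, hxφ⟩ := M.exists_chart hx
    exact ⟨0, Nat.zero_le _, _, coneAt_of_chart hφ hxφ⟩

theorem IsSegment.tendsto_start {x y : M} {σ : ℝ → M} {w : ℂ} (hσ : M.IsSegment x y σ w) :
    Tendsto σ (𝓝[>] 0) (𝓝 x) := by
  have h := hσ.continuousOn 0 (left_mem_Icc.2 zero_le_one)
  rw [ContinuousWithinAt, hσ.start] at h
  refine h.mono_left ?_
  rw [← nhdsWithin_Ioo_eq_nhdsGT (zero_lt_one' ℝ)]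
  exact nhdsWithin_mono _ Ioo_subset_Icc_self

/-- A complex function on an interval `(0, t₁)` which locally moves with velocity `w` and tends to
`0` at time `0` is linear. -/
theorem eq_mul_of_locally {g : ℝ → ℂ} {w : ℂ} {t₁ : ℝ} (ht₁ : 0 < t₁)
    (hg : ∀ t ∈ Ioo 0 t₁, ∀ᶠ s in 𝓝 t, g s - s * w = g t - t * w)
    (h0 : Tendsto g (𝓝[>] 0) (𝓝 0)) : ∀ t ∈ Ioo 0 t₁, g t = t * w := by
  have hm : t₁ / 2 ∈ Ioo 0 t₁ := ⟨by linarith, by linarith⟩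
  set c := g (t₁ / 2) - ((t₁ / 2 : ℝ) : ℂ) * w with hc
  have hconst : EqOn (fun s : ℝ => g s - s * w) (fun _ => c) (Ioo 0 t₁) := by
    refine isPreconnected_Ioo.eqOn_of_eventuallyEq (fun t ht => ?_) (fun _ _ => continuousAt_const)
      (fun t ht h => ?_) hm rfl
    · exact (continuousAt_const (y := g t - t * w)).congr (EventuallyEq.symm (hg t ht))
    · filter_upwards [hg t ht] with s hs
      rw [hs]
      exact h
  have hlim : Tendsto (fun s : ℝ => g s - s * w) (𝓝[>] 0) (𝓝 0) := by
    have h1 : Tendsto (fun s : ℝ => (s : ℂ) * w) (𝓝[>] 0) (𝓝 0) := by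
      have : Continuous fun s : ℝ => (s : ℂ) * w := by fun_prop
      simpa using (this.tendsto 0).mono_left nhdsWithin_le_nhds
    simpa using h0.sub h1
  have hc0 : c = 0 := by
    refine tendsto_nhds_unique (tendsto_const_nhds.congr' ?_) hlim
    filter_upwards [Ioo_mem_nhdsGT ht₁] with s hs using (hconst hs).symm
  intro t ht
  have := hconst ht
  simp only [hc0] at this
  exact sub_eq_zero.1 this

/-- Along `σ` the planar coordinate `ζ ^ (a + 1)` moves with velocity `w`, and it tends to `0` at
time `0`, so it is linear. -/
theorem IsSegment.cone_pow {x y : M} {σ : ℝ → M} {w : ℂ} (hσ : M.IsSegment x y σ w) {a : ℕ}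
    {ζ : OpenPartialHomeomorph M ℂ} (hζ : M.ConeAt x a ζ) :
    ∃ t₁ > 0, t₁ ≤ 1 ∧ ∀ t ∈ Ioo 0 t₁, σ t ∈ ζ.source ∧ ζ (σ t) ^ (a + 1) = t * w := by
  have hs := hσ.tendsto_start.eventually (ζ.open_source.mem_nhds hζ.mem_source)
  obtain ⟨t₂, ht₂, hsub⟩ := mem_nhdsGT_iff_exists_Ioo_subset.1 hs
  have ht₂' : 0 < t₂ := ht₂
  have ht₁ : 0 < min t₂ 1 := lt_min ht₂' one_pos
  have hsrc : ∀ t ∈ Ioo 0 (min t₂ 1), σ t ∈ ζ.source :=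
    fun t ht => hsub ⟨ht.1, ht.2.trans_le (min_le_left _ _)⟩
  refine ⟨min t₂ 1, ht₁, min_le_right _ _, fun t ht => ⟨hsrc t ht, ?_⟩⟩
  refine eq_mul_of_locally (g := fun t => ζ (σ t) ^ (a + 1)) ht₁ ?_ ?_ t ht
  · intro t ht
    have hf := hσ.flat t ⟨ht.1, ht.2.trans_le (min_le_right _ _)⟩
    obtain ⟨φ, hφ, hz⟩ := M.exists_chart hf.regular
    filter_upwards [hf.straight φ hφ hz,
      hf.continuousAt.eventually (hζ.agree φ hφ _ ⟨hz, hsrc t ht⟩)] with s h1 h2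
    push_cast at h1
    linear_combination h1 - h2
  · have h1 := (ζ.continuousAt hζ.mem_source).tendsto.comp hσ.tendsto_start
    have h2 := h1.pow (a + 1)
    rw [hζ.map_center, zero_pow a.succ_ne_zero] at h2
    exact h2

theorem IsSegment.eventually_ne_start {x y : M} {σ : ℝ → M} {w : ℂ} (hσ : M.IsSegment x y σ w) :
    ∀ᶠ t in 𝓝[>] (0 : ℝ), σ t ≠ x := by
  obtain ⟨a, -, ζ, hζ⟩ := M.exists_coneAt x
  obtain ⟨t₁, ht₁, -, h⟩ := hσ.cone_pow hζ
  filter_upwards [Ioo_mem_nhdsGT ht₁] with t ht he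
  have := (h t ht).2
  rw [he, hζ.map_center, zero_pow a.succ_ne_zero] at this
  exact mul_ne_zero (by exact_mod_cast ht.1.ne') hσ.ne_zero this.symm

/-- Every trajectory contains a primitive segment with the same ends. -/
theorem IsSegment.exists_isPrimitive {x y : M} {σ : ℝ → M} {w : ℂ} (hσ : M.IsSegment x y σ w) :
    ∃ a b : ℝ, 0 ≤ a ∧ a < b ∧ b ≤ 1 ∧
      M.IsPrimitive x y (fun t => σ ((b - a) * t + a)) (((b - a : ℝ) : ℂ) * w) := by
  have hy : ∀ᶠ t in 𝓝[>] (0 : ℝ), σ t ≠ y := by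
    by_cases hxy : x = y
    · rw [← hxy]
      exact hσ.eventually_ne_start
    · exact hσ.tendsto_start.eventually (isOpen_compl_singleton.mem_nhds hxy)
  obtain ⟨ε, hε, hεy⟩ := mem_nhdsGT_iff_exists_Ioo_subset.1 hy
  have hε0 : 0 < ε := hε
  have hcl : ∀ p : M, ∀ c d, 0 ≤ c → d ≤ 1 → IsCompact (Icc c d ∩ σ ⁻¹' {p}) := fun p c d hc hd =>
    isCompact_Icc.of_isClosed_subset
      ((hσ.continuousOn.mono (Icc_subset_Icc hc hd)).preimage_isClosed_of_isClosed isClosed_Icc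
        isClosed_singleton) inter_subset_left
  set e := min ε 1 / 2 with he
  have he0 : 0 < e := by have := lt_min hε0 one_pos; positivity
  have heε : e < ε := by have := min_le_left ε 1; linarith
  have he1 : e ≤ 1 := by have := min_le_right ε 1; linarith
  -- `b` is the first positive time at which `σ` is at `y`. The cut-off `e` keeps the search in a
  -- compact set away from `0`, where `σ` is already at `y` if `x = y`. Then `a` is the last visit
  -- to `x` before `b`, or `0` if `x = y`.
  obtain ⟨b, ⟨⟨hb1, hb2⟩, hb3⟩, hbmin⟩ := (hcl y e 1 he0.le le_rfl).exists_isLeast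
    ⟨1, ⟨he1, le_rfl⟩, hσ.finish⟩
  have hb0 : 0 < b := he0.trans_le hb1
  have hby : σ b = y := hb3
  have hnoy : ∀ t ∈ Ioo 0 b, σ t ≠ y := by
    intro t ht hty
    rcases lt_or_ge t e with h | h
    · exact hεy ⟨ht.1, h.trans heε⟩ hty
    · exact (hbmin ⟨⟨h, ht.2.le.trans hb2⟩, hty⟩).not_gt ht.2
  obtain ⟨a, ha0, hab, hax, hnox⟩ : ∃ a, 0 ≤ a ∧ a < b ∧ σ a = x ∧ ∀ t ∈ Ioo a b, σ t ≠ x := by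
    by_cases hxy : x = y
    · exact ⟨0, le_rfl, hb0, hσ.start, fun t ht => by rw [hxy]; exact hnoy t ht⟩
    · obtain ⟨a, ⟨⟨ha1, ha2⟩, ha3⟩, hamax⟩ := (hcl x 0 b le_rfl hb2).exists_isGreatest
        ⟨0, ⟨le_rfl, hb0.le⟩, hσ.start⟩
      have hax : σ a = x := ha3
      refine ⟨a, ha1, lt_of_le_of_ne ha2 ?_, hax, fun t ht htx => ?_⟩
      · rintro rfl
        exact hxy (hax.symm.trans hby)
      · exact (hamax ⟨⟨ha1.trans ht.1.le, ht.2.le⟩, htx⟩).not_gt ht.1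
  have hmem : ∀ t ∈ Ioo (0 : ℝ) 1, (b - a) * t + a ∈ Ioo a b := fun t ht =>
    ⟨by nlinarith [ht.1, ht.2], by nlinarith [ht.1, ht.2]⟩
  refine ⟨a, b, ha0, hab, hb2, ?_, fun t ht => hnox _ (hmem t ht), fun t ht => hnoy _ ?_⟩
  · have := hσ.subsegment ha0 hab hb2
    rwa [hax, hby] at this
  · exact ⟨ha0.trans_lt (hmem t ht).1, (hmem t ht).2⟩

theorem isBlockingSet_of_isPrimitive {x y : M} {B : Finset M} (hx : x ∉ B) (hy : y ∉ B)
    (h : ∀ σ w, M.IsPrimitive x y σ w → ∃ t ∈ Icc (0 : ℝ) 1, σ t ∈ B) :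
    M.IsBlockingSet x y B := by
  refine ⟨hx, hy, fun γ hγ => ?_⟩
  obtain ⟨w, hw⟩ := hγ.exists_isSegment
  obtain ⟨a, b, ha, hab, hb, hp⟩ := hw.exists_isPrimitive
  obtain ⟨t, ht, htB⟩ := h _ _ hp
  exact ⟨_, ⟨by nlinarith [ht.1, ht.2], by nlinarith [ht.1, ht.2]⟩, htB⟩

theorem IsSegment.exists_eq_disc_start {x y : M} {σ : ℝ → M} {w : ℂ} (hσ : M.IsSegment x y σ w)
    {D : ℂ → M} (hD : M.FlatAt D 0) (h0 : D 0 = x) :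
    ∃ t₁ > 0, ∀ t ∈ Ico 0 t₁, σ t = D ((t : ℂ) * w) := by
  have hx : x ∉ M.singSet := h0 ▸ hD.regular
  obtain ⟨φ, hφ, hxφ⟩ := M.exists_chart hx
  obtain ⟨t₂, ht₂, -, h⟩ := hσ.cone_pow (coneAt_of_chart hφ hxφ)
  have h0φ : D 0 ∈ φ.source := h0 ▸ hxφ
  have hlin : Tendsto (fun t : ℝ => (t : ℂ) * w) (𝓝[>] 0) (𝓝 0) := by
    have : Continuous fun s : ℝ => (s : ℂ) * w := by fun_prop
    simpa using (this.tendsto 0).mono_left nhdsWithin_le_nhds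
  have hev : ∀ᶠ t in 𝓝[>] (0 : ℝ), σ t = D ((t : ℂ) * w) := by
    filter_upwards [Ioo_mem_nhdsGT ht₂, hlin.eventually (hD.translation φ hφ h0φ),
      hlin.eventually (hD.continuousAt (φ.open_source.mem_nhds h0φ))] with t h1 h2 h3
    obtain ⟨h4, h5⟩ := h t h1
    refine φ.injOn h4 h3 ?_
    simp only [zero_add, pow_one, OpenPartialHomeomorph.transHomeomorph_apply,
      Function.comp_apply, Homeomorph.coe_addRight] at h5
    rw [h0] at h2
    linear_combination h5 - h2
  obtain ⟨t₁, ht₁, hsub⟩ := mem_nhdsGT_iff_exists_Ioo_subset.1 hev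
  refine ⟨t₁, ht₁, fun t ht => ?_⟩
  rcases eq_or_lt_of_le ht.1 with rfl | ht0
  · simp [h0, hσ.start]
  · exact hsub ⟨ht0, ht.2⟩

/-- All segments are launched in the same flat discs `E j`, recentred at the position `q j` of `xs
j`. As `E j` is injective, a point of the disc lies on only one ray from the centre, which gives the
germ condition. -/
theorem Approx.exists_launchFamily (A : Approx U M N) {xs : ∀ j, N j} {x : M}
    (hx : x ∉ M.singSet) (hxs : A.Conv xs x) {κ : Type*} {σ : κ → ℝ → M} {w : κ → ℂ}
    (hσ : ∀ p, ∃ y, M.IsSegment x y (σ p) (w p)) : ∃ S, LaunchFamily A xs σ w S := by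
  obtain ⟨ρ, hρ, D, E, hD0, hD, hE, hconv, hcomp⟩ := A.disc x hx
  have h0 := Metric.mem_ball_self (x := (0 : ℂ)) hρ
  have hgerm : ∀ p, ∃ t₁ > 0, ∀ t ∈ Ico 0 t₁, σ p t = D ((t : ℂ) * w p) := fun p => by
    obtain ⟨y, hy⟩ := hσ p
    exact hy.exists_eq_disc_start (hD 0 h0) hD0
  obtain ⟨q, hq, hxq⟩ := hcomp 0 h0 xs (hD0 ▸ hxs)
  have hqn : ∀ᶠ j in (U : Filter ι), ‖q j‖ < ρ / 2 := by
    have := hq.norm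
    rw [norm_zero] at this
    exact this.eventually (gt_mem_nhds (by positivity))
  refine ⟨fun _ j z => E j (z + q j), fun p => ?_, fun p p' b hb hb' => ?_⟩
  · obtain ⟨t₁, ht₁, hpt⟩ := hgerm p
    set t₀ := min (t₁ / 2) (ρ / 2 / (‖w p‖ + 1)) with ht₀
    have hw := norm_nonneg (w p)
    have ht₀0 : 0 < t₀ := lt_min (by positivity) (by positivity)
    have ht₀1 : t₀ < t₁ := (min_le_left _ _).trans_lt (by linarith)
    have ht₀ρ : t₀ * (‖w p‖ + 1) ≤ ρ / 2 := by
      rw [← le_div_iff₀ (by positivity)]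
      exact min_le_right _ _
    refine ⟨t₀, 1, ht₀0, one_pos, ?_, ?_, ?_⟩
    · filter_upwards [hE, hqn] with j h1 h2 v hv s hs
      refine FlatAt.comp_add (h1.1 _ ?_)
      rw [mem_ball_zero_iff]
      rw [mem_ball_iff_norm] at hv
      have h3 : ‖(s : ℂ) * v‖ ≤ t₀ * (‖w p‖ + 1) := by
        rw [norm_mul, Complex.norm_real, Real.norm_of_nonneg hs.1.le]
        refine mul_le_mul hs.2 ?_ (norm_nonneg _) ht₀0.le
        linarith [norm_sub_norm_le v (w p)]
      linarith [norm_add_le ((s : ℂ) * v) (q j)]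
    · filter_upwards [hE, hqn, hxq] with j h1 h2 h3 v hv
      have h4 := (h1.1 (q j) (mem_ball_zero_iff.2 (by linarith))).continuousAt
      rw [h3]
      refine h4.tendsto.comp ?_
      have : Continuous fun s : ℝ => (s : ℂ) * v + q j := by fun_prop
      simpa using (this.tendsto 0).mono_left nhdsWithin_le_nhds
    · intro v hv s hs s₀ hs₀
      have hs₀m : s₀ ∈ Icc 0 t₀ := isClosed_Icc.mem_of_tendsto hs₀ (hs.mono fun j hj => ⟨hj.1.le, hj.2⟩)
      rw [hpt s₀ ⟨hs₀m.1, hs₀m.2.trans_lt ht₀1⟩]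
      refine hconv _ ?_ (fun j => (s j : ℂ) * v j + q j) ?_
      · rw [mem_ball_zero_iff, norm_mul, Complex.norm_real, Real.norm_of_nonneg hs₀m.1]
        nlinarith [hs₀m.2]
      · simpa using (((Complex.continuous_ofReal.tendsto s₀).comp hs₀).mul hv).add hq
  · obtain ⟨v, s, hv, hs, hs0, hbv⟩ := hb
    obtain ⟨v', s', hv', hs', hs0', hbv'⟩ := hb'
    have hball : ∀ {v : ι → ℂ} {s : ι → ℝ} {w : ℂ}, Tendsto v U (𝓝 w) → Tendsto s U (𝓝 0) →
        ∀ᶠ j in (U : Filter ι), (s j : ℂ) * v j + q j ∈ Metric.ball (0 : ℂ) ρ := by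
      intro v s w hv hs
      have : Tendsto (fun j => (s j : ℂ) * v j + q j) U (𝓝 0) := by
        simpa using (((Complex.continuous_ofReal.tendsto 0).comp hs).mul hv).add hq
      exact this.eventually (Metric.ball_mem_nhds 0 hρ)
    have heq : ∀ᶠ j in (U : Filter ι), (s j : ℂ) * v j = s' j * v' j := by
      filter_upwards [hE, hball hv hs, hball hv' hs', hbv, hbv'] with j h1 h2 h3 h4 h5
      exact add_right_cancel (h1.2 h2 h3 (h4.symm.trans h5))
    obtain ⟨y, hy⟩ := hσ p
    obtain ⟨y', hy'⟩ := hσ p'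
    obtain ⟨c, hc, hw⟩ := exists_pos_smul_of_rays hy.ne_zero hy'.ne_zero hv hv' hs0 hs0' heq
    refine ⟨c, hc, hw, ?_⟩
    obtain ⟨t₁, ht₁, hp⟩ := hgerm p
    obtain ⟨t₁', ht₁', hp'⟩ := hgerm p'
    filter_upwards [Ioo_mem_nhdsGT ht₁, Ioo_mem_nhdsGT (show 0 < t₁' / c by positivity)] with t h h'
    have h2 : c * t < t₁' := by
      have := h'.2
      rw [lt_div_iff₀ hc] at this
      linarith
    rw [hp t ⟨h.1.le, h.2⟩, hp' (c * t) ⟨(mul_pos hc h.1).le, h2⟩, hw]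
    congr 1
    push_cast
    ring

/-! ### Semicontinuity at regular points and closedness on a fixed surface. -/

/-- Blocking cardinalities at regular points are lower semicontinuous. -/
theorem Approx.bc_le (A : Approx U M N) {xs ys : ∀ j, N j} {x y : M} {n : ℕ}
    (hn : ∀ᶠ j in (U : Filter ι), (N j).bc (xs j) (ys j) ≤ n) (hx : x ∉ M.singSet)
    (hy : y ∉ M.singSet) (hxy : x ≠ y) (hxs : A.Conv xs x) (hys : A.Conv ys y) :
    M.bc x y ≤ n := by
  let κ := {p : (ℝ → M) × ℂ // M.IsPrimitive x y p.1 p.2}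
  obtain ⟨S, hS⟩ := A.exists_launchFamily hx hxs (κ := κ) (σ := fun p => p.1.1)
    (w := fun p => p.1.2) fun p => ⟨y, p.2.toIsSegment⟩
  obtain ⟨S', hS'⟩ := A.exists_launchFamily hy hys (κ := κ) (σ := fun p t => p.1.1 (1 - t))
    (w := fun p => -p.1.2) fun p => ⟨x, p.2.reverse.toIsSegment⟩
  obtain ⟨B, hxB, hyB, hB, -, hc⟩ := A.exists_blocking hn (fun p : κ => p.2) hS hS'
  exact bc_le_iff.2 ⟨B, isBlockingSet_of_isPrimitive hxB hyB fun σ w h => hB ⟨(σ, w), h⟩, hc hxy⟩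

/-- The constant family of surfaces, with convergence of points in the surface. -/
def Approx.const (U : Ultrafilter ι) (M : TranslationSurface α) : Approx U M fun _ => M where
  Conv m a := Tendsto m U (𝓝 a)
  exists_conv m := by
    obtain ⟨a, -, ha⟩ := isCompact_univ.ultrafilter_le_nhds (U.map m) (by simp)
    exact ⟨a, ha⟩
  unique h h' := tendsto_nhds_unique h h'
  congr h h' := h'.congr' (h.mono fun _ hj => hj.symm)
  disc a ha := by
    obtain ⟨φ, hφ, haφ⟩ := M.exists_chart ha
    obtain ⟨r, hr, hsub⟩ := Metric.isOpen_iff.1 φ.open_target (φ a) (φ.map_source haφ)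
    have hmem : ∀ z ∈ Metric.ball (0 : ℂ) r, z + φ a ∈ φ.target := fun z hz =>
      hsub (by simpa using hz)
    have hcont : ∀ z ∈ Metric.ball (0 : ℂ) r, ContinuousAt (fun z => φ.symm (z + φ a)) z :=
      fun z hz => ContinuousAt.comp (g := φ.symm) (φ.continuousAt_symm (hmem z hz)) (by fun_prop)
    have hflat : ∀ z ∈ Metric.ball (0 : ℂ) r, M.FlatAt (fun z => φ.symm (z + φ a)) z := by
      refine fun z hz => ⟨hcont z hz, M.chart_regular φ hφ _ (φ.map_target (hmem z hz)), ?_⟩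
      intro ψ hψ hzψ
      filter_upwards [(hcont z hz).eventually (M.chart_translation φ hφ ψ hψ _
        ⟨φ.map_target (hmem z hz), hzψ⟩), Metric.isOpen_ball.mem_nhds hz] with q h1 h2
      rw [φ.right_inv (hmem q h2), φ.right_inv (hmem z hz)] at h1
      linear_combination h1
    refine ⟨r, hr, fun z => φ.symm (z + φ a), fun _ z => φ.symm (z + φ a), ?_, hflat,
      Eventually.of_forall fun _ => ⟨hflat, ?_⟩, ?_, ?_⟩
    · simp [φ.left_inv haφ]
    · intro z hz z' hz' h
      exact add_right_cancel (φ.symm.injOn (hmem z hz) (hmem z' hz') h)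
    · intro z hz q hq
      exact (hcont z hz).tendsto.comp hq
    · intro z hz m hm
      have hs := φ.map_target (hmem z hz)
      refine ⟨fun j => φ (m j) - φ a, ?_, ?_⟩
      · have := ((φ.continuousAt hs).tendsto.comp hm).sub_const (φ a)
        rw [φ.right_inv (hmem z hz), add_sub_cancel_right] at this
        exact this
      · filter_upwards [hm (φ.open_source.mem_nhds hs)] with j hj
        rw [sub_add_cancel, φ.left_inv hj]

/-- The ultrafilter lives on `M × M` itself: all surfaces are `M`, and the approximating points are
the two coordinates of the index. -/
theorem blockedPairs_eq (M : TranslationSurface α) (n : ℕ) :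
    M.blockedPairs n = M.regularPairs ∩ closure (M.blockedPairs n) := by
  refine Subset.antisymm (fun p hp => ⟨hp.1, subset_closure hp⟩) ?_
  rintro ⟨x, y⟩ ⟨h, hcl⟩
  refine ⟨h, ?_⟩
  obtain ⟨U, hU, hlim⟩ := mem_closure_iff_ultrafilter.1 hcl
  have h1 : Tendsto Prod.fst (U : Filter (M × M)) (𝓝 x) := continuous_fst.continuousAt.mono_left hlim
  have h2 : Tendsto Prod.snd (U : Filter (M × M)) (𝓝 y) := continuous_snd.continuousAt.mono_left hlim
  exact (Approx.const U M).bc_le (xs := Prod.fst) (ys := Prod.snd)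
    (by filter_upwards [hU] with p hp using hp.2) h.1 h.2.1 h.2.2 h1 h2

theorem blockedFrom_eq (M : TranslationSurface α) {x : M} (hx : x ∉ M.singSet) (n : ℕ) :
    M.blockedFrom x n = M.regularPointsNe x ∩ closure (M.blockedFrom x n) := by
  refine Subset.antisymm (fun p hp => ⟨hp.1, subset_closure hp⟩) ?_
  rintro y ⟨h, hcl⟩
  have hmaps : MapsTo (fun y => (x, y)) (M.blockedFrom x n) (M.blockedPairs n) :=
    fun z hz => ⟨⟨hx, hz.1.1, hz.1.2.symm⟩, hz.2⟩
  have := hmaps.closure (by fun_prop) hcl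
  have h2 : (x, y) ∈ M.blockedPairs n := by
    rw [blockedPairs_eq]
    exact ⟨⟨hx, h.1, h.2.symm⟩, this⟩
  exact ⟨h, h2.2⟩

end TranslationSurface

/-! ### Half-discs at arbitrary points and the uniform bound. -/

namespace TranslationSurface

variable {k : ℕ} {α : Fin k → ℕ} {ι : Type*}
variable {U : Ultrafilter ι} {M : TranslationSurface α}

/-- The open half-disc of radius `ρ` in the direction `u`. -/
def halfDisc (u : ℂ) (ρ : ℝ) : Set ℂ := {z | 0 < (z / u).re ∧ ‖z‖ < ρ}

theorem isOpen_halfDisc {u : ℂ} {ρ : ℝ} : IsOpen (halfDisc u ρ) := by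
  have h1 : Continuous fun z : ℂ => (z / u).re := Complex.continuous_re.comp (by fun_prop)
  exact (isOpen_lt continuous_const h1).inter (isOpen_lt continuous_norm continuous_const)

/-- A flat embedded half-disc with centre `x`. -/
structure IsSector (M : TranslationSurface α) (x : M) (u : ℂ) (ρ : ℝ) (S : ℂ → M) : Prop where
  dir_ne_zero : u ≠ 0
  radius_pos : 0 < ρ
  flat : ∀ z ∈ halfDisc u ρ, M.FlatAt S z
  injOn : InjOn S (halfDisc u ρ)
  tendsto : Tendsto S (𝓝[halfDisc u ρ] 0) (𝓝 x)

/-- Flat maps are open. This allows a dense set of pairs to be approached inside prescribed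
half-discs. -/
theorem IsSector.exists_mem {x : M} {u : ℂ} {ρ : ℝ} {S : ℂ → M} (h : M.IsSector x u ρ S)
    {P : Set ℂ} (hP : P ∈ 𝓝[halfDisc u ρ] 0) :
    ∃ O : Set M, O.Nonempty ∧ IsOpen O ∧ O ⊆ S '' P := by
  obtain ⟨V, hV, h0, hVP⟩ := mem_nhdsWithin.1 hP
  obtain ⟨ε, hε, hεV⟩ := Metric.isOpen_iff.1 hV 0 h0
  have hu := norm_pos_iff.2 h.dir_ne_zero
  set c := min ε ρ / 2 / ‖u‖ with hc
  have hc0 : 0 < c := by have := lt_min hε h.radius_pos; positivity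
  have hn : ‖(c : ℂ) * u‖ = min ε ρ / 2 := by
    rw [norm_mul, Complex.norm_real, Real.norm_of_nonneg hc0.le, hc]
    field_simp
  have hm := lt_min hε h.radius_pos
  have hmem : (c : ℂ) * u ∈ V ∩ halfDisc u ρ := by
    refine ⟨hεV ?_, ?_, ?_⟩
    · rw [mem_ball_zero_iff, hn]
      linarith [min_le_left ε ρ]
    · rw [mul_div_cancel_right₀ _ h.dir_ne_zero]
      simpa using hc0
    · rw [hn]
      linarith [min_le_right ε ρ]
  have himg : S '' (V ∩ halfDisc u ρ) ∈ 𝓝 (S ((c : ℂ) * u)) := by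
    rw [← (h.flat _ hmem.2).map_nhds]
    exact image_mem_map ((hV.inter isOpen_halfDisc).mem_nhds hmem)
  obtain ⟨O, hO, hOo, hxO⟩ := mem_nhds_iff.1 himg
  exact ⟨O, ⟨_, hxO⟩, hOo, hO.trans (image_mono hVP)⟩

/-- The segments leaving `x` inside a half-disc. -/
def LeavesThrough (u : ℂ) (S : ℂ → M) (σ : ℝ → M) (w : ℂ) : Prop :=
  0 < (w / u).re ∧ ∀ᶠ t : ℝ in 𝓝[>] 0, σ t = S ((t : ℂ) * w)

/-- Up to the radius, a half-disc is stable under adding positive multiples of vectors `v` with `0 <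
(v / u).re`. So a trajectory started at `q j` in such a direction at first stays where `S` is flat
and injective, even when `x` is singular. -/
theorem IsSector.launchFamily {x : M} {u : ℂ} {ρ : ℝ} {S : ℂ → M} (h : M.IsSector x u ρ S)
    {q : ι → ℂ} (hq : Tendsto q U (𝓝[halfDisc u ρ] 0)) {κ : Type*} {σ : κ → ℝ → M} {w : κ → ℂ}
    (hσ : ∀ p, ∃ y, M.IsSegment x y (σ p) (w p)) (hl : ∀ p, LeavesThrough u S (σ p) (w p)) :
    LaunchFamily (Approx.const U M) (fun j => S (q j)) σ w (fun _ j z => S (z + q j)) := by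
  have hρ := h.radius_pos
  have hq0 : Tendsto q U (𝓝 0) := hq.mono_right nhdsWithin_le_nhds
  have hqm : ∀ᶠ j in (U : Filter ι), q j ∈ halfDisc u ρ := hq.eventually self_mem_nhdsWithin
  have hqn : ∀ᶠ j in (U : Filter ι), ‖q j‖ < ρ / 2 := by
    have := hq0.norm
    rw [norm_zero] at this
    exact this.eventually (gt_mem_nhds (by positivity))
  have hre : ∀ (s : ℝ) (v z : ℂ), (((s : ℂ) * v + z) / u).re = s * (v / u).re + (z / u).re := by
    intro s v z
    rw [add_div, Complex.add_re, mul_div_assoc, Complex.re_ofReal_mul]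
  have hcre : Continuous fun z : ℂ => (z / u).re := Complex.continuous_re.comp (by fun_prop)
  refine ⟨fun p => ?_, fun p p' b hb hb' => ?_⟩
  · obtain ⟨y, hy⟩ := hσ p
    obtain ⟨hwu, hev⟩ := hl p
    obtain ⟨t₁, ht₁, hsub⟩ := mem_nhdsGT_iff_exists_Ioo_subset.1 hev
    have ht₁0 : 0 < t₁ := ht₁
    obtain ⟨r₀, hr₀, hr₀u⟩ := Metric.eventually_nhds_iff_ball.1
      ((hcre.tendsto (w p)).eventually (lt_mem_nhds hwu))
    set t₀ := min (t₁ / 2) (ρ / 2 / (‖w p‖ + 1)) with ht₀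
    have hw := norm_nonneg (w p)
    have ht₀0 : 0 < t₀ := lt_min (by positivity) (by positivity)
    have ht₀1 : t₀ < t₁ := (min_le_left _ _).trans_lt (by linarith)
    have ht₀ρ : t₀ * (‖w p‖ + 1) ≤ ρ / 2 := by
      rw [← le_div_iff₀ (by positivity)]
      exact min_le_right _ _
    have hmem : ∀ v, ‖v - w p‖ < min r₀ 1 → ∀ s ∈ Ioc 0 t₀, ∀ z ∈ halfDisc u ρ, ‖z‖ < ρ / 2 →
        (s : ℂ) * v + z ∈ halfDisc u ρ := by
      intro v hv s hs z hz hzn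
      refine ⟨?_, ?_⟩
      · rw [hre]
        have := hr₀u v (mem_ball_iff_norm.2 (hv.trans_le (min_le_left _ _)))
        exact add_pos (mul_pos hs.1 this) hz.1
      · have h3 : ‖(s : ℂ) * v‖ ≤ t₀ * (‖w p‖ + 1) := by
          rw [norm_mul, Complex.norm_real, Real.norm_of_nonneg hs.1.le]
          refine mul_le_mul hs.2 ?_ (norm_nonneg _) ht₀0.le
          linarith [norm_sub_norm_le v (w p), min_le_right r₀ 1]
        linarith [norm_add_le ((s : ℂ) * v) z]
    refine ⟨t₀, min r₀ 1, ht₀0, lt_min hr₀ one_pos, ?_, ?_, ?_⟩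
    · filter_upwards [hqm, hqn] with j h1 h2 v hv s hs
      exact FlatAt.comp_add (h.flat _ (hmem v (mem_ball_iff_norm.1 hv) s hs _ h1 h2))
    · filter_upwards [hqm] with j h1 v hv
      refine (h.flat _ h1).continuousAt.tendsto.comp ?_
      have : Continuous fun s : ℝ => (s : ℂ) * v + q j := by fun_prop
      simpa using (this.tendsto 0).mono_left nhdsWithin_le_nhds
    · intro v hv s hs s₀ hs₀
      have hs₀m : s₀ ∈ Icc 0 t₀ :=
        isClosed_Icc.mem_of_tendsto hs₀ (hs.mono fun j hj => ⟨hj.1.le, hj.2⟩)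
      have hlim : Tendsto (fun j => (s j : ℂ) * v j + q j) U (𝓝 ((s₀ : ℂ) * w p)) := by
        simpa using (((Complex.continuous_ofReal.tendsto s₀).comp hs₀).mul hv).add hq0
      -- Nothing is known about `S` at `0` itself, so time zero is handled by its limit within the
      -- half-disc.
      rcases eq_or_lt_of_le hs₀m.1 with rfl | hpos
      · rw [hy.start]
        refine h.tendsto.comp (tendsto_nhdsWithin_iff.2 ⟨by simpa using hlim, ?_⟩)
        filter_upwards [hs, hqm, hqn, hv.eventually
          (Metric.ball_mem_nhds (w p) (lt_min hr₀ one_pos))] with j h1 h2 h3 h4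
        exact hmem _ (mem_ball_iff_norm.1 h4) _ h1 _ h2 h3
      · have he : σ p s₀ = S ((s₀ : ℂ) * w p) := hsub ⟨hpos, hs₀m.2.trans_lt ht₀1⟩
        rw [he]
        refine (h.flat _ ⟨?_, ?_⟩).continuousAt.tendsto.comp hlim
        · have := hre s₀ (w p) 0
          simp only [add_zero, zero_div, Complex.zero_re] at this
          rw [this]
          exact mul_pos hpos hwu
        · rw [norm_mul, Complex.norm_real, Real.norm_of_nonneg hs₀m.1]
          nlinarith [hs₀m.2]
  · obtain ⟨v, s, hv, hs, hs0, hbv⟩ := hb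
    obtain ⟨v', s', hv', hs', hs0', hbv'⟩ := hb'
    have hmem : ∀ {p} {v : ι → ℂ} {s : ι → ℝ}, Tendsto v U (𝓝 (w p)) → Tendsto s U (𝓝 0) →
        (∀ᶠ j in (U : Filter ι), 0 < s j) →
        ∀ᶠ j in (U : Filter ι), (s j : ℂ) * v j + q j ∈ halfDisc u ρ := by
      intro p v s hv hs hs0
      have h1 : Tendsto (fun j => (s j : ℂ) * v j + q j) U (𝓝 0) := by
        simpa using (((Complex.continuous_ofReal.tendsto 0).comp hs).mul hv).add hq0
      have h2 := h1.norm
      rw [norm_zero] at h2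
      filter_upwards [h2.eventually (gt_mem_nhds hρ), hqm, hs0,
        ((hcre.tendsto (w p)).comp hv).eventually (lt_mem_nhds (hl p).1)] with j h3 h4 h5 h6
      refine ⟨?_, h3⟩
      rw [hre]
      exact add_pos (mul_pos h5 h6) h4.1
    have heq : ∀ᶠ j in (U : Filter ι), (s j : ℂ) * v j = s' j * v' j := by
      filter_upwards [hmem hv hs hs0, hmem hv' hs' hs0', hbv, hbv'] with j h2 h3 h4 h5
      exact add_right_cancel (h.injOn h2 h3 (h4.symm.trans h5))
    obtain ⟨y, hy⟩ := hσ p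
    obtain ⟨y', hy'⟩ := hσ p'
    obtain ⟨c, hc, hw⟩ := exists_pos_smul_of_rays hy.ne_zero hy'.ne_zero hv hv' hs0 hs0' heq
    refine ⟨c, hc, hw, ?_⟩
    have hct : Tendsto (fun t : ℝ => c * t) (𝓝[>] 0) (𝓝[>] 0) := by
      refine tendsto_nhdsWithin_iff.2 ⟨?_, ?_⟩
      · have : Continuous fun t : ℝ => c * t := by fun_prop
        simpa using (this.tendsto 0).mono_left nhdsWithin_le_nhds
      · filter_upwards [self_mem_nhdsWithin] with t ht
        exact mul_pos hc ht
    filter_upwards [(hl p).2, hct.eventually (hl p').2] with t h1 h2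
    rw [h1, h2, hw]
    congr 1
    push_cast
    ring

/-- The inverse branch of `ζ ^ (a + 1)` on a half-disc singled out by `β`. -/
noncomputable def coneBranch (ζ : OpenPartialHomeomorph M ℂ) (a : ℕ) (β z : ℂ) : M :=
  ζ.symm (β * (z / β ^ (a + 1)) ^ ((a + 1 : ℕ) : ℂ)⁻¹)

theorem coneBranch_pow (a : ℕ) {β : ℂ} (hβ : β ≠ 0) (z : ℂ) :
    (β * (z / β ^ (a + 1)) ^ ((a + 1 : ℕ) : ℂ)⁻¹) ^ (a + 1) = z := by
  rw [mul_pow, Complex.cpow_nat_inv_pow _ a.succ_ne_zero]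
  field_simp

/-- On the half-plane `0 < (z / u).re` with `u = β ^ (a + 1)`, the principal root of `z / u` is
continuous, so `coneBranch` is a flat inverse of `ζ ^ (a + 1)` there. Different `β` with the same
`u` give the different sheets. The last clause tells which sheet contains a given point. -/
theorem ConeAt.exists_isSector {x : M} {a : ℕ} {ζ : OpenPartialHomeomorph M ℂ}
    (h : M.ConeAt x a ζ) : ∃ ρ, ∀ β : ℂ, β ≠ 0 →
      M.IsSector x (β ^ (a + 1)) ρ (coneBranch ζ a β) ∧
      ∀ z ∈ halfDisc (β ^ (a + 1)) ρ, ∀ m ∈ ζ.source,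
        ζ m = β * (z / β ^ (a + 1)) ^ ((a + 1 : ℕ) : ℂ)⁻¹ → coneBranch ζ a β z = m := by
  have h0 : (0 : ℂ) ∈ ζ.target := h.map_center ▸ ζ.map_source h.mem_source
  obtain ⟨r, hr, hsub⟩ := Metric.isOpen_iff.1 ζ.open_target 0 h0
  refine ⟨r ^ (a + 1), fun β hβ => ?_⟩
  set u := β ^ (a + 1) with hu
  have hu0 : u ≠ 0 := pow_ne_zero _ hβ
  set g : ℂ → ℂ := fun z => β * (z / u) ^ ((a + 1 : ℕ) : ℂ)⁻¹ with hg
  have hpow : ∀ z, g z ^ (a + 1) = z := fun z => coneBranch_pow a hβ z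
  have hnorm : ∀ z, ‖g z‖ ^ (a + 1) = ‖z‖ := fun z => by rw [← norm_pow, hpow]
  have htar : ∀ z ∈ halfDisc u (r ^ (a + 1)), g z ∈ ζ.target := fun z hz => by
    refine hsub (mem_ball_zero_iff.2 (lt_of_pow_lt_pow_left₀ (a + 1) hr.le ?_))
    rw [hnorm]
    exact hz.2
  have hne : ∀ z ∈ halfDisc u (r ^ (a + 1)), z ≠ 0 := by
    rintro z hz rfl
    have := hz.1
    simp at this
  have hgc : ∀ z ∈ halfDisc u (r ^ (a + 1)), ContinuousAt g z := fun z hz => by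
    refine continuousAt_const.mul ?_
    exact ContinuousAt.cpow (f := fun z => z / u) (by fun_prop) continuousAt_const (Or.inl hz.1)
  have hSc : ∀ z ∈ halfDisc u (r ^ (a + 1)), ContinuousAt (coneBranch ζ a β) z := fun z hz =>
    ContinuousAt.comp (g := ζ.symm) (ζ.continuousAt_symm (htar z hz)) (hgc z hz)
  have hζ : ∀ z ∈ halfDisc u (r ^ (a + 1)), ζ (coneBranch ζ a β z) = g z := fun z hz =>
    ζ.right_inv (htar z hz)
  refine ⟨⟨hu0, pow_pos hr _, fun z hz => ⟨hSc z hz, ?_, ?_⟩, ?_, ?_⟩, ?_⟩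
  · refine h.regular _ (ζ.map_target (htar z hz)) fun he => hne z hz ?_
    have := hζ z hz
    rw [he, h.map_center] at this
    rw [← hpow z, ← this, zero_pow a.succ_ne_zero]
  · intro φ hφ hzφ
    filter_upwards [(hSc z hz).eventually (h.agree φ hφ _ ⟨hzφ, ζ.map_target (htar z hz)⟩),
      isOpen_halfDisc.mem_nhds hz] with q h1 h2
    rw [hζ q h2, hζ z hz, hpow, hpow] at h1
    exact h1
  · intro z hz z' hz' he
    rw [← hpow z, ← hpow z', ← hζ z hz, ← hζ z' hz', he]
  · have hg0 : Tendsto g (𝓝 0) (𝓝 0) := by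
      rw [tendsto_zero_iff_norm_tendsto_zero]
      have h1 : Tendsto (fun z : ℂ => ‖z‖ ^ ((a + 1 : ℕ) : ℝ)⁻¹) (𝓝 0) (𝓝 0) := by
        have := (continuous_norm (E := ℂ)).continuousAt (x := 0) |>.rpow_const
          (p := ((a + 1 : ℕ) : ℝ)⁻¹) (Or.inr (by positivity))
        have h2 := this.tendsto
        rwa [norm_zero, Real.zero_rpow (by positivity)] at h2
      refine h1.congr fun z => ?_
      rw [← hnorm z, Real.pow_rpow_inv_natCast (norm_nonneg _) a.succ_ne_zero]
    have h2 := (ζ.continuousAt_symm h0).tendsto.comp hg0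
    have h3 : ζ.symm 0 = x := by rw [← h.map_center, ζ.left_inv h.mem_source]
    rw [h3] at h2
    exact h2.mono_left nhdsWithin_le_nhds
  · intro z hz m hm he
    change ζ.symm (g z) = m
    rw [hg]
    simp only
    rw [← he, ζ.left_inv hm]

/-- The open half-planes in the directions `1`, `I`, `-1`, `-I` cover the nonzero vectors, so
finitely many directions `u` suffice. -/
theorem exists_re_div_pos {w : ℂ} (hw : w ≠ 0) : ∃ u : ℂ, u ^ 4 = 1 ∧ 0 < (w / u).re := by
  rcases lt_trichotomy w.re 0 with h | h | h
  · exact ⟨-1, by norm_num, by simpa [div_neg] using h⟩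
  · have h2 : w.im ≠ 0 := fun h' => hw (Complex.ext h h')
    rcases lt_or_gt_of_ne h2 with h' | h'
    · exact ⟨-Complex.I, by rw [neg_pow, Complex.I_pow_four]; norm_num,
        by simpa [div_neg, Complex.div_I] using h'⟩
    · exact ⟨Complex.I, Complex.I_pow_four, by simpa [Complex.div_I] using h'⟩
  · exact ⟨1, by norm_num, by simpa using h⟩

/-- The sheet is read off from one point of `σ`: `β` is `ζ (σ s)` divided by the principal root of
`s * w / u`. Then `β ^ (a + 1) = u` and `u ^ 4 = 1`, so `β` is one of at most `4 * (a + 1)` roots of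
unity. Unique continuation extends the agreement from time `s` to the germ. -/
theorem IsSegment.exists_leavesThrough {x y : M} {σ : ℝ → M} {w : ℂ} (hσ : M.IsSegment x y σ w)
    {a : ℕ} {ζ : OpenPartialHomeomorph M ℂ} (h : M.ConeAt x a ζ) :
    ∃ β ∈ (Polynomial.nthRoots (4 * (a + 1)) (1 : ℂ)).toFinset,
      LeavesThrough (β ^ (a + 1)) (coneBranch ζ a β) σ w := by
  obtain ⟨ρ, hsec⟩ := h.exists_isSector
  have hρ := (hsec 1 one_ne_zero).1.radius_pos
  obtain ⟨t₁, ht₁, ht₁1, hpow⟩ := hσ.cone_pow h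
  obtain ⟨u, hu4, hwu⟩ := exists_re_div_pos hσ.ne_zero
  have hu : u ≠ 0 := by
    rintro rfl
    norm_num at hu4
  have hw := norm_pos_iff.2 hσ.ne_zero
  set t₂ := min t₁ (ρ / ‖w‖) with ht₂
  have ht₂0 : 0 < t₂ := lt_min ht₁ (by positivity)
  have hdisc : ∀ t ∈ Ioo 0 t₂, (t : ℂ) * w ∈ halfDisc u ρ := by
    intro t ht
    refine ⟨?_, ?_⟩
    · rw [mul_div_assoc, Complex.re_ofReal_mul]
      exact mul_pos ht.1 hwu
    · rw [norm_mul, Complex.norm_real, Real.norm_of_nonneg ht.1.le, ← lt_div_iff₀ hw]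
      exact ht.2.trans_le (min_le_right _ _)
  set s := t₂ / 2 with hs
  have hsm : s ∈ Ioo 0 t₂ := ⟨by positivity, by linarith⟩
  obtain ⟨hsrc, hζs⟩ := hpow s ⟨hsm.1, hsm.2.trans_le (min_le_left _ _)⟩
  set c : ℂ := ((s : ℂ) * w / u) ^ ((a + 1 : ℕ) : ℂ)⁻¹ with hc
  have hcp : c ^ (a + 1) = (s : ℂ) * w / u := Complex.cpow_nat_inv_pow _ a.succ_ne_zero
  have hsw : (s : ℂ) * w ≠ 0 := mul_ne_zero (by exact_mod_cast hsm.1.ne') hσ.ne_zero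
  have hc0 : c ≠ 0 := by
    intro h0
    rw [h0, zero_pow a.succ_ne_zero] at hcp
    exact div_ne_zero hsw hu hcp.symm
  set β := ζ (σ s) / c with hβ
  have hβu : β ^ (a + 1) = u := by
    rw [hβ, div_pow, hζs, hcp, div_div_cancel₀ hsw]
  have hβ0 : β ≠ 0 := by
    rintro h0
    rw [h0, zero_pow a.succ_ne_zero] at hβu
    exact hu hβu.symm
  refine ⟨β, ?_, hβu ▸ hwu, ?_⟩
  · rw [Multiset.mem_toFinset, Polynomial.mem_nthRoots (by positivity), mul_comm, pow_mul, hβu, hu4]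
  · obtain ⟨hS, hSeq⟩ := hsec β hβ0
    rw [hβu] at hS hSeq
    have hse : coneBranch ζ a β ((s : ℂ) * w) = σ s := by
      refine hSeq _ (hdisc s hsm) _ hsrc ?_
      rw [← hc, hβ]
      field_simp
    have heq : EqOn σ (fun t : ℝ => coneBranch ζ a β ((t : ℂ) * w)) (Ioo 0 t₂) := by
      refine eqOn_of_pathFlatAt (w := w) isPreconnected_Ioo (fun t ht => hσ.flat t ⟨ht.1, ?_⟩)
        (fun t ht => (hS.flat _ (hdisc t ht)).pathFlatAt') hsm hse.symm
      exact (ht.2.trans_le (min_le_left _ _)).trans_le ht₁1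
    filter_upwards [Ioo_mem_nhdsGT ht₂0] with t ht using heq ht

/-- If the pairs of points blocked by `n` points are dense, then the primitive segments from `x`
to `y` which leave and arrive through given half-discs are blocked by `2 * n` points. -/
theorem exists_blocking_of_sectors {n : ℕ} (hd : Dense {p : M × M | M.bc p.1 p.2 ≤ n}) {x y : M}
    {u u' : ℂ} {ρ ρ' : ℝ} {S S' : ℂ → M} (hS : M.IsSector x u ρ S) (hS' : M.IsSector y u' ρ' S') :
    ∃ B : Finset M, x ∉ B ∧ y ∉ B ∧ B.card ≤ 2 * n ∧ ∀ σ w, M.IsPrimitive x y σ w →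
      LeavesThrough u S σ w → LeavesThrough u' S' (fun t => σ (1 - t)) (-w) →
      ∃ t ∈ Icc (0 : ℝ) 1, σ t ∈ B := by
  -- By density there are blocked pairs arbitrarily close to `(x, y)` inside the two half-discs,
  -- even if `x = y` or an end is singular.
  have hne : (𝓝[halfDisc u ρ] (0 : ℂ) ×ˢ 𝓝[halfDisc u' ρ'] (0 : ℂ) ⊓
      𝓟 {q : ℂ × ℂ | M.bc (S q.1) (S' q.2) ≤ n}).NeBot := by
    rw [inf_principal_neBot_iff]
    intro W hW
    obtain ⟨P, hP, P', hP', hPP⟩ := mem_prod_iff.1 hW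
    obtain ⟨O, hOn, hO, hOP⟩ := hS.exists_mem hP
    obtain ⟨O', hOn', hO', hOP'⟩ := hS'.exists_mem hP'
    obtain ⟨⟨m, m'⟩, ⟨hm, hm'⟩, hb⟩ := hd.inter_open_nonempty _ (hO.prod hO') (hOn.prod hOn')
    obtain ⟨z, hz, rfl⟩ := hOP hm
    obtain ⟨z', hz', rfl⟩ := hOP' hm'
    exact ⟨(z, z'), hPP ⟨hz, hz'⟩, hb⟩
  set U := Ultrafilter.of (𝓝[halfDisc u ρ] (0 : ℂ) ×ˢ 𝓝[halfDisc u' ρ'] (0 : ℂ) ⊓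
    𝓟 {q : ℂ × ℂ | M.bc (S q.1) (S' q.2) ≤ n}) with hU
  have hle := Ultrafilter.of_le (𝓝[halfDisc u ρ] (0 : ℂ) ×ˢ 𝓝[halfDisc u' ρ'] (0 : ℂ) ⊓
    𝓟 {q : ℂ × ℂ | M.bc (S q.1) (S' q.2) ≤ n})
  have h1 : Tendsto Prod.fst (U : Filter (ℂ × ℂ)) (𝓝[halfDisc u ρ] 0) :=
    tendsto_fst.mono_left (hle.trans inf_le_left)
  have h2 : Tendsto Prod.snd (U : Filter (ℂ × ℂ)) (𝓝[halfDisc u' ρ'] 0) :=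
    tendsto_snd.mono_left (hle.trans inf_le_left)
  have h3 : ∀ᶠ q in (U : Filter (ℂ × ℂ)), M.bc (S q.1) (S' q.2) ≤ n :=
    le_principal_iff.1 (hle.trans inf_le_right)
  let κ := {p : (ℝ → M) × ℂ // M.IsPrimitive x y p.1 p.2 ∧ LeavesThrough u S p.1 p.2 ∧
    LeavesThrough u' S' (fun t => p.1 (1 - t)) (-p.2)}
  obtain ⟨B, hx, hy, hB, hc, -⟩ := (Approx.const U M).exists_blocking h3
    (fun p : κ => p.2.1) (hS.launchFamily h1 (fun p => ⟨y, p.2.1.toIsSegment⟩) fun p => p.2.2.1)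
    (hS'.launchFamily h2 (fun p => ⟨x, p.2.1.reverse.toIsSegment⟩) fun p => p.2.2.2)
  exact ⟨B, hx, hy, hc, fun σ w h h' h'' => hB ⟨(σ, w), h, h', h''⟩⟩

/-- Each end has at most `4 * (∑ i, α i + 1)` half-discs, and each pair of half-discs costs `2 * n`
points; the factor two is there because `x = y` is allowed. -/
theorem boundedBlocking_of_dense {n : ℕ} (hd : Dense {p : M × M | M.bc p.1 p.2 ≤ n}) :
    M.BoundedBlocking ((4 * (∑ i, α i + 1)) * ((4 * (∑ i, α i + 1)) * (2 * n))) := by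
  classical
  intro x y
  obtain ⟨a, ha, ζ, hζ⟩ := M.exists_coneAt x
  obtain ⟨a', ha', ζ', hζ'⟩ := M.exists_coneAt y
  obtain ⟨ρ, hsec⟩ := hζ.exists_isSector
  obtain ⟨ρ', hsec'⟩ := hζ'.exists_isSector
  have hroot : ∀ {a : ℕ} {β : ℂ}, β ∈ (Polynomial.nthRoots (4 * (a + 1)) (1 : ℂ)).toFinset →
      β ≠ 0 := by
    rintro a β hβ rfl
    rw [Multiset.mem_toFinset, Polynomial.mem_nthRoots (by positivity), zero_pow (by positivity)]
      at hβ
    exact zero_ne_one hβ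
  have hcard : ∀ {a : ℕ}, a ≤ ∑ i, α i →
      (Polynomial.nthRoots (4 * (a + 1)) (1 : ℂ)).toFinset.card ≤ 4 * (∑ i, α i + 1) := by
    intro a ha
    exact (Multiset.toFinset_card_le _).trans ((Polynomial.card_nthRoots _ _).trans (by omega))
  have hB : ∀ β β' : ℂ, ∃ B : Finset M, x ∉ B ∧ y ∉ B ∧ B.card ≤ 2 * n ∧ (β ≠ 0 → β' ≠ 0 →
      ∀ σ w, M.IsPrimitive x y σ w → LeavesThrough (β ^ (a + 1)) (coneBranch ζ a β) σ w →
      LeavesThrough (β' ^ (a' + 1)) (coneBranch ζ' a' β') (fun t => σ (1 - t)) (-w) →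
      ∃ t ∈ Icc (0 : ℝ) 1, σ t ∈ B) := by
    intro β β'
    by_cases hβ : β = 0
    · exact ⟨∅, by simp, by simp, by simp, fun h => absurd hβ h⟩
    by_cases hβ' : β' = 0
    · exact ⟨∅, by simp, by simp, by simp, fun _ h => absurd hβ' h⟩
    obtain ⟨B, h1, h2, h3, h4⟩ := exists_blocking_of_sectors hd (hsec β hβ).1 (hsec' β' hβ').1
    exact ⟨B, h1, h2, h3, fun _ _ => h4⟩
  choose B hBx hBy hBc hB using hB
  refine bc_le_iff.2 ⟨(Polynomial.nthRoots (4 * (a + 1)) (1 : ℂ)).toFinset.biUnion fun β =>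
    (Polynomial.nthRoots (4 * (a' + 1)) (1 : ℂ)).toFinset.biUnion fun β' => B β β', ?_, ?_⟩
  · refine isBlockingSet_of_isPrimitive ?_ ?_ fun σ w h => ?_
    · simp only [Finset.mem_biUnion, not_exists, not_and]
      exact fun β _ β' _ => hBx β β'
    · simp only [Finset.mem_biUnion, not_exists, not_and]
      exact fun β _ β' _ => hBy β β'
    · obtain ⟨β, hβ, hl⟩ := h.toIsSegment.exists_leavesThrough hζ
      obtain ⟨β', hβ', hl'⟩ := h.toIsSegment.reverse.exists_leavesThrough hζ'
      obtain ⟨t, ht, htB⟩ := hB β β' (hroot hβ) (hroot hβ') σ w h hl hl'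
      exact ⟨t, ht, Finset.mem_biUnion.2 ⟨β, hβ, Finset.mem_biUnion.2 ⟨β', hβ', htB⟩⟩⟩
  · refine Finset.card_biUnion_le.trans ((Finset.sum_le_card_nsmul _ _ _ fun β _ =>
      Finset.card_biUnion_le.trans ((Finset.sum_le_card_nsmul _ _ _ fun β' _ =>
        hBc β β').trans (Nat.mul_le_mul_right _ (hcard ha')))).trans ?_)
    exact Nat.mul_le_mul_right _ (hcard ha)

end TranslationSurface

/-! ### Plane geometry of the triangles of a pattern. -/

theorem Complex.conj_mul_im (a b : ℂ) : (starRingEnd ℂ a * b).im = a.re * b.im - a.im * b.re := by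
  simp [Complex.mul_im]
  ring

namespace Pattern

variable {k : ℕ} {α : Fin k → ℕ} {T : Pattern k}

/-- The next side of the same triangle. -/
def nxt (e : Fin T.num × Fin 3) : Fin T.num × Fin 3 := (e.1, e.2 + 1)

/-- The previous side of the same triangle. -/
def prv (e : Fin T.num × Fin 3) : Fin T.num × Fin 3 := (e.1, e.2 + 2)

theorem nxt_prv (e : Fin T.num × Fin 3) : nxt (prv e) = e := by
  have h : ∀ j : Fin 3, j + 2 + 1 = j := by decide
  exact Prod.ext rfl (h e.2)

theorem prv_nxt (e : Fin T.num × Fin 3) : prv (nxt e) = e := by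
  have h : ∀ j : Fin 3, j + 1 + 2 = j := by decide
  exact Prod.ext rfl (h e.2)

theorem nxt_nxt (e : Fin T.num × Fin 3) : nxt (nxt e) = prv e := by
  have h : ∀ j : Fin 3, j + 1 + 1 = j + 2 := by decide
  exact Prod.ext rfl (h e.2)

theorem eq_or_eq_nxt_or_eq_prv {e e' : Fin T.num × Fin 3} (h : e'.1 = e.1) :
    e' = e ∨ e' = nxt e ∨ e' = prv e := by
  obtain ⟨τ, j⟩ := e
  obtain ⟨τ', j'⟩ := e'
  obtain rfl : τ' = τ := h
  fin_cases j <;> fin_cases j' <;> simp [nxt, prv]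

/-- The conditions on a holonomy to describe positively oriented triangles which can be glued. -/
structure IsPositive (v : T.Holonomy) : Prop where
  closed_up : ∀ τ, v (τ, 0) + v (τ, 1) + v (τ, 2) = 0
  positive : ∀ τ, 0 < (starRingEnd ℂ (v (τ, 0)) * v (τ, 1)).im
  opposite : ∀ e, v (T.opp e) = -v e

/-- Twice the signed area of the parallelogram spanned by two vectors. -/
def cross (a b : ℂ) : ℝ := a.re * b.im - a.im * b.re

theorem continuous_cross : Continuous fun q : ℂ × ℂ => cross q.1 q.2 := by
  unfold cross
  fun_prop

/-- Positive multiple of the signed distance of `z` to the line through the side `e`. -/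
def height (v : T.Holonomy) (e : Fin T.num × Fin 3) (z : ℂ) : ℝ := cross (v e) (z - corner v e)

/-- The translation which moves the triangle across the side `e` to its place next to `e`. -/
def shift (v : T.Holonomy) (e : Fin T.num × Fin 3) : ℂ := corner v e - corner v (nxt (T.opp e))

theorem continuous_corner (e : Fin T.num × Fin 3) :
    Continuous fun v : T.Holonomy => corner v e := by
  obtain ⟨τ, j⟩ := e
  fin_cases j <;> simp [corner] <;> fun_prop

theorem continuous_shift (e : Fin T.num × Fin 3) :
    Continuous fun v : T.Holonomy => shift v e :=
  (continuous_corner _).sub (continuous_corner _)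

theorem continuous_height (e : Fin T.num × Fin 3) :
    Continuous fun q : T.Holonomy × ℂ => height q.1 e q.2 :=
  continuous_cross.comp (((continuous_apply e).comp continuous_fst).prodMk
    (continuous_snd.sub ((continuous_corner e).comp continuous_fst)))

theorem height_add_corner (v : T.Holonomy) (e : Fin T.num × Fin 3) (z : ℂ) :
    height v e (corner v e + z) = cross (v e) z := by
  rw [height, add_sub_cancel_left]

theorem height_sidePoint (v : T.Holonomy) (e : Fin T.num × Fin 3) (s : ℝ) : height v e (sidePoint v e s) = 0 := by
  rw [sidePoint, height_add_corner]
  simp [cross]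
  ring

namespace IsPositive

variable {v : T.Holonomy}

theorem sum_eq_zero (hv : IsPositive v) (e : Fin T.num × Fin 3) : v e + v (nxt e) + v (prv e) = 0 := by
  obtain ⟨τ, j⟩ := e
  have := hv.closed_up τ
  fin_cases j
  · exact this
  · change v (τ, 1) + v (τ, 2) + v (τ, 0) = 0
    linear_combination this
  · change v (τ, 2) + v (τ, 0) + v (τ, 1) = 0
    linear_combination this

theorem corner_nxt (hv : IsPositive v) (e : Fin T.num × Fin 3) : corner v (nxt e) = corner v e + v e := by
  obtain ⟨τ, j⟩ := e
  have := hv.closed_up τ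
  fin_cases j
  · simp [corner, nxt]
  · simp [corner, nxt]
  · change corner v (τ, 0) = corner v (τ, 2) + v (τ, 2)
    simp only [corner]
    simp
    exact this.symm

theorem corner_eq_prv (hv : IsPositive v) (e : Fin T.num × Fin 3) : corner v e = corner v (prv e) + v (prv e) := by
  rw [← hv.corner_nxt, nxt_prv]

theorem prv_eq (hv : IsPositive v) (e : Fin T.num × Fin 3) : v (prv e) = -v e - v (nxt e) := by
  linear_combination hv.sum_eq_zero e

theorem cross_nxt_prv (hv : IsPositive v) (e : Fin T.num × Fin 3) :
    cross (v (nxt e)) (v (prv e)) = cross (v e) (v (nxt e)) := by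
  rw [hv.prv_eq]
  simp only [cross, Complex.sub_re, Complex.sub_im, Complex.neg_re, Complex.neg_im]
  ring

theorem area_pos (hv : IsPositive v) (e : Fin T.num × Fin 3) : 0 < cross (v e) (v (nxt e)) := by
  have h0 : ∀ τ, 0 < cross (v (τ, 0)) (v (τ, 1)) := fun τ => by
    have := hv.positive τ
    rwa [Complex.conj_mul_im] at this
  obtain ⟨τ, j⟩ := e
  have h := h0 τ
  fin_cases j
  · exact h
  · have := hv.cross_nxt_prv (τ, 0)
    exact this ▸ h
  · have h1 := hv.cross_nxt_prv (τ, 0)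
    have h2 := hv.cross_nxt_prv (nxt (τ, 0))
    rw [nxt_nxt, prv_nxt, h1] at h2
    exact h2 ▸ h

theorem height_prv_add_corner (hv : IsPositive v) (e : Fin T.num × Fin 3) (z : ℂ) :
    height v (prv e) (corner v e + z) = cross (v (prv e)) z := by
  rw [height, hv.corner_eq_prv e]
  simp only [cross, Complex.sub_re, Complex.sub_im, Complex.add_re, Complex.add_im]
  ring

theorem height_nxt_add_corner (hv : IsPositive v) (e : Fin T.num × Fin 3) (z : ℂ) :
    height v (nxt e) (corner v e + z) = cross (v e) (v (nxt e)) + cross (v (nxt e)) z := by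
  rw [height, hv.corner_nxt e]
  simp only [cross, Complex.sub_re, Complex.sub_im, Complex.add_re, Complex.add_im]
  ring

/-- Divided by their constant sum, the three heights are barycentric coordinates. This turns
membership into closed conditions that vary continuously with the holonomy. -/
theorem mem_triangle (hv : IsPositive v) {τ : Fin T.num} {z : ℂ} :
    z ∈ triangle v τ ↔ ∀ j, 0 ≤ height v (τ, j) z := by
  constructor
  · intro hz j
    have hconv : Convex ℝ {z : ℂ | 0 ≤ height v (τ, j) z} := by
      intro z hz z' hz' a b ha hb hab
      have : height v (τ, j) (a • z + b • z') = a * height v (τ, j) z + b * height v (τ, j) z' := by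
        obtain rfl : a = 1 - b := by linarith
        simp only [height, cross, Complex.sub_re, Complex.sub_im, Complex.add_re, Complex.add_im,
          Complex.smul_re, Complex.smul_im, smul_eq_mul]
        ring
      change 0 ≤ height v (τ, j) (a • z + b • z')
      rw [this]
      exact add_nonneg (mul_nonneg ha hz) (mul_nonneg hb hz')
    refine convexHull_min ?_ hconv hz
    rintro _ ⟨i, rfl⟩
    change 0 ≤ height v (τ, j) (corner v (τ, i))
    rcases eq_or_eq_nxt_or_eq_prv (e := (τ, i)) (e' := (τ, j)) rfl with h | h | h
    · rw [h, ← add_zero (corner v (τ, i)), height_add_corner]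
      simp [cross]
    · rw [h, ← add_zero (corner v (τ, i)), hv.height_nxt_add_corner]
      simpa [cross] using (hv.area_pos (τ, i)).le
    · rw [h, ← add_zero (corner v (τ, i)), hv.height_prv_add_corner]
      simp [cross]
  · intro h
    set A := cross (v (τ, 0)) (v (τ, 1)) with hA
    have hA0 : 0 < A := hv.area_pos (τ, 0)
    have h2 : v (τ, 2) = -v (τ, 0) - v (τ, 1) := hv.prv_eq (τ, 0)
    have hc : Convex ℝ (triangle v τ) := convex_convexHull ℝ _
    have hsum : height v (τ, 0) z + height v (τ, 1) z + height v (τ, 2) z = A := by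
      simp only [hA, height, corner, h2, cross]
      simp
      ring
    have hmem : ∀ j, corner v (τ, j) ∈ triangle v τ := fun j => subset_convexHull ℝ _ ⟨j, rfl⟩
    -- The weight of a corner is the height over the opposite side: side `1` for corner `0`, side
    -- `2` for corner `1`, side `0` for corner `2`.
    have key := hc.sum_mem (t := Finset.univ) (w := ![height v (τ, 1) z / A, height v (τ, 2) z / A,
      height v (τ, 0) z / A]) (z := fun j => corner v (τ, j)) ?_ ?_ (fun j _ => hmem j)
    · convert key using 1
      simp only [Fin.sum_univ_three, Matrix.cons_val_zero, Matrix.cons_val_one, Matrix.cons_val]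
      have hx : z.re * A = height v (τ, 2) z * (v (τ, 0)).re +
          height v (τ, 0) z * ((v (τ, 0)).re + (v (τ, 1)).re) := by
        simp only [hA, height, corner, h2, cross]
        simp
        ring
      have hy : z.im * A = height v (τ, 2) z * (v (τ, 0)).im +
          height v (τ, 0) z * ((v (τ, 0)).im + (v (τ, 1)).im) := by
        simp only [hA, height, corner, h2, cross]
        simp
        ring
      apply Complex.ext
      · simp [corner]
        field_simp
        linear_combination hx
      · simp [corner]
        field_simp
        linear_combination hy
    · intro j _
      fin_cases j <;> simp <;> exact div_nonneg (h _) hA0.le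
    · simp only [Fin.sum_univ_three, Matrix.cons_val_zero, Matrix.cons_val_one, Matrix.cons_val]
      rw [← add_div, ← add_div, div_eq_one_iff_eq hA0.ne', ← hsum]
      ring

theorem mem_triangle_iff (hv : IsPositive v) {e : Fin T.num × Fin 3} {z : ℂ} : z ∈ triangle v e.1 ↔
    0 ≤ height v e z ∧ 0 ≤ height v (nxt e) z ∧ 0 ≤ height v (prv e) z := by
  rw [hv.mem_triangle]
  constructor
  · intro h
    exact ⟨h e.2, h (e.2 + 1), h (e.2 + 2)⟩
  · intro h j
    rcases eq_or_eq_nxt_or_eq_prv (e := e) (e' := (e.1, j)) rfl with h' | h' | h' <;> rw [h']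
    exacts [h.1, h.2.1, h.2.2]

theorem shift_eq (hv : IsPositive v) (e : Fin T.num × Fin 3) :
    shift v e = corner v e + v e - corner v (T.opp e) := by
  rw [shift, hv.corner_nxt, hv.opposite]
  ring

theorem shift_opp (hv : IsPositive v) (e : Fin T.num × Fin 3) : shift v (T.opp e) = -shift v e := by
  rw [hv.shift_eq e, shift, T.opp_opp, hv.corner_nxt]
  ring

theorem height_opp (hv : IsPositive v) (e : Fin T.num × Fin 3) (z : ℂ) :
    height v (T.opp e) (z - shift v e) = -height v e z := by
  rw [height, height, hv.shift_eq, hv.opposite]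
  simp only [cross, Complex.sub_re, Complex.sub_im, Complex.add_re, Complex.add_im,
    Complex.neg_re, Complex.neg_im]
  ring

theorem sidePoint_opp (hv : IsPositive v) (e : Fin T.num × Fin 3) (s : ℝ) :
    sidePoint v (T.opp e) (1 - s) = sidePoint v e s - shift v e := by
  rw [sidePoint, sidePoint, hv.shift_eq, hv.opposite]
  push_cast
  ring

theorem ne_zero (hv : IsPositive v) (e : Fin T.num × Fin 3) : v e ≠ 0 := by
  intro h
  have := hv.area_pos e
  simp [h, cross] at this

/-- On the line through `e`, the heights over the other two sides are proportional to `s` and `1 -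
s`; their signs thus tell whether the point lies on the side. -/
theorem exists_smul_of_height_eq_zero (hv : IsPositive v) {e : Fin T.num × Fin 3} {z : ℂ} (h : height v e z = 0) :
    ∃ s : ℝ, z = sidePoint v e s ∧
      height v (prv e) z = s * cross (v e) (v (nxt e)) ∧
      height v (nxt e) z = (1 - s) * cross (v e) (v (nxt e)) := by
  have hve := hv.ne_zero e
  have hn : 0 < (v e).re * (v e).re + (v e).im * (v e).im := by
    have := Complex.normSq_pos.2 hve
    rwa [Complex.normSq_apply] at this
  set d := z - corner v e with hd
  have h' : (v e).re * d.im - (v e).im * d.re = 0 := h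
  obtain ⟨s, hs⟩ : ∃ s : ℝ, d = s * v e := by
    refine ⟨((v e).re * d.re + (v e).im * d.im) / ((v e).re * (v e).re + (v e).im * (v e).im), ?_⟩
    apply Complex.ext
    · rw [Complex.re_ofReal_mul, div_mul_eq_mul_div, eq_div_iff hn.ne']
      linear_combination (v e).im * (-h')
    · rw [Complex.im_ofReal_mul, div_mul_eq_mul_div, eq_div_iff hn.ne']
      linear_combination (v e).re * h'
  have hz : z = corner v e + s * v e := by rw [← hs, hd]; ring
  refine ⟨s, hz, ?_, ?_⟩
  · rw [hz, hv.height_prv_add_corner, hv.prv_eq]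
    simp [cross]
    ring
  · rw [hz, hv.height_nxt_add_corner]
    simp [cross]
    ring

/-- Two sides of a nondegenerate triangle are never opposite vectors. So no triangle is glued to
itself. -/
theorem opp_fst_ne (hv : IsPositive v) (e : Fin T.num × Fin 3) : (T.opp e).1 ≠ e.1 := by
  intro h
  have h0 := hv.opposite e
  have hA := hv.area_pos e
  rcases eq_or_eq_nxt_or_eq_prv h with h1 | h1 | h1
  · rw [h1] at h0
    refine hv.ne_zero e ?_
    linear_combination h0 / 2
  · rw [h1] at h0
    rw [h0] at hA
    simp [cross, mul_comm] at hA
  · rw [h1, hv.prv_eq] at h0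
    have : v (nxt e) = 0 := by linear_combination -h0
    exact hv.ne_zero _ this

end IsPositive

/-! ### Kites: flat charts across the sides of a triangulation. -/

/-- The interior of the quadrilateral formed by the triangles on both sides of `e`. -/
def kite (v : T.Holonomy) (e : Fin T.num × Fin 3) : Set ℂ :=
  {z | (height v e z < 0 ∨ 0 < height v (nxt e) z ∧ 0 < height v (prv e) z) ∧
    (0 < height v e z ∨ 0 < height v (nxt (T.opp e)) (z - shift v e) ∧
      0 < height v (prv (T.opp e)) (z - shift v e))}

end Pattern

namespace Pattern

variable {k : ℕ} {α : Fin k → ℕ} {T : Pattern k} {v : T.Holonomy}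

theorem isOpen_kite (e : Fin T.num × Fin 3) :
    IsOpen {q : T.Holonomy × ℂ | q.2 ∈ kite q.1 e} := by
  have h1 := continuous_height (T := T) e
  have h2 := continuous_height (T := T) (nxt e)
  have h3 := continuous_height (T := T) (prv e)
  have hs : Continuous fun q : T.Holonomy × ℂ => (q.1, q.2 - shift q.1 e) :=
    continuous_fst.prodMk (continuous_snd.sub ((continuous_shift e).comp continuous_fst))
  have h4 := (continuous_height (T := T) (nxt (T.opp e))).comp hs
  have h5 := (continuous_height (T := T) (prv (T.opp e))).comp hs
  exact ((isOpen_lt h1 continuous_const).union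
    ((isOpen_lt continuous_const h2).inter (isOpen_lt continuous_const h3))).inter
    ((isOpen_lt continuous_const h1).union
    ((isOpen_lt continuous_const h4).inter (isOpen_lt continuous_const h5)))

theorem isOpen_kite_right (v : T.Holonomy) (e : Fin T.num × Fin 3) : IsOpen (kite v e) :=
  (isOpen_kite e).preimage (Continuous.prodMk_right v)

namespace IsPositive

/-- Up to `shift`, the kites of `e` and `T.opp e` are the same region. This symmetry reduces many
statements to points of nonnegative height. -/
theorem mem_kite_opp (hv : IsPositive v) {e : Fin T.num × Fin 3} {z : ℂ} (hz : z ∈ kite v e) :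
    z - shift v e ∈ kite v (T.opp e) := by
  have h1 := hv.height_opp e z
  have h2 : z - shift v e - shift v (T.opp e) = z := by rw [hv.shift_opp]; ring
  refine ⟨?_, ?_⟩
  · rw [h1]
    exact hz.2.imp (fun h => neg_neg_iff_pos.2 h) id
  · rw [h1, h2, T.opp_opp]
    exact hz.1.imp (fun h => neg_pos.2 h) id

theorem pos_of_mem_kite {e : Fin T.num × Fin 3} {z : ℂ} (hz : z ∈ kite v e)
    (h : 0 ≤ height v e z) : 0 < height v (nxt e) z ∧ 0 < height v (prv e) z :=
  hz.1.resolve_left h.not_gt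

theorem mem_triangle_of_mem_kite (hv : IsPositive v) {e : Fin T.num × Fin 3} {z : ℂ}
    (hz : z ∈ kite v e) (h : 0 ≤ height v e z) : z ∈ triangle v e.1 := by
  have := pos_of_mem_kite hz h
  exact hv.mem_triangle_iff.2 ⟨h, this.1.le, this.2.le⟩

/-- Only points on the side need an argument: the parameter satisfies `0 < s < 1`, hence so does `1
- s` on the opposite side, which makes the two other heights in the neighbouring triangle positive.
-/
theorem mem_kite (hv : IsPositive v) {e : Fin T.num × Fin 3} {z : ℂ} (h : 0 ≤ height v e z)
    (h1 : 0 < height v (nxt e) z) (h2 : 0 < height v (prv e) z) : z ∈ kite v e := by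
  refine ⟨Or.inr ⟨h1, h2⟩, ?_⟩
  rcases eq_or_lt_of_le h with h0 | h0
  · right
    obtain ⟨s, hs, hp, hn⟩ := hv.exists_smul_of_height_eq_zero h0.symm
    have hA := hv.area_pos e
    have hA' := hv.area_pos (T.opp e)
    rw [hp] at h2
    rw [hn] at h1
    have hs0 : 0 < s := pos_of_mul_pos_left h2 hA.le
    have hs1 : 0 < 1 - s := pos_of_mul_pos_left h1 hA.le
    have h3 : z - shift v e = sidePoint v (T.opp e) (1 - s) := by rw [hv.sidePoint_opp, hs]
    obtain ⟨s', hs', hp', hn'⟩ := hv.exists_smul_of_height_eq_zero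
      (h3 ▸ height_sidePoint v (T.opp e) (1 - s) : height v (T.opp e) (z - shift v e) = 0)
    have hss : s' = 1 - s := by
      rw [h3, sidePoint, sidePoint] at hs'
      have := mul_right_cancel₀ (hv.ne_zero _) (add_left_cancel hs')
      exact_mod_cast this.symm
    rw [hn', hp', hss]
    exact ⟨mul_pos (by linarith) hA', mul_pos hs1 hA'⟩
  · exact Or.inl h0

theorem ne_corner_of_mem_kite (hv : IsPositive v) {e e' : Fin T.num × Fin 3} {z : ℂ}
    (hz : z ∈ kite v e) (h : 0 ≤ height v e z) (he : e'.1 = e.1) : z ≠ corner v e' := by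
  rintro rfl
  obtain ⟨h1, h2⟩ := pos_of_mem_kite hz h
  have h3 : height v e' (corner v e') = 0 := by
    have := height_add_corner v e' 0
    simpa [cross] using this
  have h4 : height v (prv e') (corner v e') = 0 := by
    have := hv.height_prv_add_corner e' 0
    simpa [cross] using this
  rcases eq_or_eq_nxt_or_eq_prv he with rfl | rfl | rfl
  · exact h2.ne' h4
  · exact h1.ne' h3
  · exact h2.ne' h3

/-- A point of a triangle other than its corners lies in the kite of one of its sides. -/
theorem exists_mem_kite (hv : IsPositive v) {τ : Fin T.num} {z : ℂ} (hz : z ∈ triangle v τ)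
    (hc : ∀ j, z ≠ corner v (τ, j)) :
    ∃ e : Fin T.num × Fin 3, e.1 = τ ∧ z ∈ kite v e ∧ 0 ≤ height v e z := by
  have key : ∀ e : Fin T.num × Fin 3, e.1 = τ → height v e z = 0 → z ∈ kite v e := by
    intro e he h
    subst he
    obtain ⟨h1, h2, h3⟩ := hv.mem_triangle_iff.1 hz
    obtain ⟨s, hs, hp, hn⟩ := hv.exists_smul_of_height_eq_zero h
    have hA := hv.area_pos e
    refine hv.mem_kite h.ge (lt_of_le_of_ne h2 fun h0 => ?_) (lt_of_le_of_ne h3 fun h0 => ?_)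
    · rw [hn] at h0
      have : s = 1 := by
        rcases mul_eq_zero.1 h0.symm with h' | h'
        · linarith
        · exact absurd h' hA.ne'
      refine hc (e.2 + 1) ?_
      change z = corner v (nxt e)
      rw [hs, sidePoint, hv.corner_nxt, this]
      simp
    · rw [hp] at h0
      have : s = 0 := by
        rcases mul_eq_zero.1 h0.symm with h' | h'
        · exact h'
        · exact absurd h' hA.ne'
      refine hc e.2 ?_
      rw [hs, sidePoint, this]
      simp
  by_cases h : ∃ e : Fin T.num × Fin 3, e.1 = τ ∧ height v e z = 0
  · obtain ⟨e, he, h0⟩ := h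
    exact ⟨e, he, key e he h0, h0.ge⟩
  · push Not at h
    refine ⟨(τ, 0), rfl, ?_, (hv.mem_triangle.1 hz 0)⟩
    have hpos : ∀ j, 0 < height v (τ, j) z := fun j =>
      lt_of_le_of_ne (hv.mem_triangle.1 hz j) (h (τ, j) rfl).symm
    exact hv.mem_kite (hpos 0).le (hpos _) (hpos _)

end IsPositive

/-- The map of the kite of `e` to the surface. -/
noncomputable def kiteMap {X : Type*} (v : T.Holonomy) (f : Fin T.num → ℂ → X)
    (e : Fin T.num × Fin 3) (z : ℂ) : X :=
  open scoped Classical in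
  if 0 ≤ height v e z then f e.1 z else f (T.opp e).1 (z - shift v e)

theorem kiteMap_of_nonneg {X : Type*} {f : Fin T.num → ℂ → X} {e : Fin T.num × Fin 3} {z : ℂ}
    (h : 0 ≤ height v e z) : kiteMap v f e z = f e.1 z := if_pos h

theorem kiteMap_of_neg {X : Type*} {f : Fin T.num → ℂ → X} {e : Fin T.num × Fin 3} {z : ℂ}
    (h : height v e z < 0) : kiteMap v f e z = f (T.opp e).1 (z - shift v e) := if_neg h.not_ge

namespace IsTriangulation

variable {M : TranslationSurface α} {f : Fin T.num → ℂ → M}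

theorem isPositive (h : IsTriangulation M v f) : IsPositive v :=
  ⟨h.closed_up, h.positive, h.opposite⟩

theorem glue_of_height_eq_zero (h : IsTriangulation M v f) {e : Fin T.num × Fin 3} {z : ℂ}
    (hz : z ∈ triangle v e.1) (h0 : height v e z = 0) :
    z - shift v e ∈ triangle v (T.opp e).1 ∧ f e.1 z = f (T.opp e).1 (z - shift v e) := by
  have hv := h.isPositive
  obtain ⟨s, hs, hp, hn⟩ := hv.exists_smul_of_height_eq_zero h0
  have hA := hv.area_pos e
  obtain ⟨h1, h2, h3⟩ := hv.mem_triangle_iff.1 hz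
  rw [hp] at h3
  rw [hn] at h2
  have hs0 : 0 ≤ s := nonneg_of_mul_nonneg_left h3 hA
  have hs1 : 0 ≤ 1 - s := nonneg_of_mul_nonneg_left h2 hA
  have hz' : z - shift v e = sidePoint v (T.opp e) (1 - s) := by rw [hv.sidePoint_opp, hs]
  refine ⟨?_, ?_⟩
  · obtain ⟨s', hs', hp', hn'⟩ := hv.exists_smul_of_height_eq_zero
      (hz' ▸ height_sidePoint v (T.opp e) (1 - s) : height v (T.opp e) (z - shift v e) = 0)
    have hss : s' = 1 - s := by
      rw [hz', sidePoint, sidePoint] at hs'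
      have := mul_right_cancel₀ (hv.ne_zero _) (add_left_cancel hs')
      exact_mod_cast this.symm
    have hA' := hv.area_pos (T.opp e)
    refine hv.mem_triangle_iff.2 ⟨?_, ?_, ?_⟩
    · rw [hz', height_sidePoint]
    · rw [hn', hss]
      exact mul_nonneg (by linarith) hA'.le
    · rw [hp', hss]
      exact mul_nonneg hs1 hA'.le
  · have := h.glue e s ⟨hs0, by linarith⟩
    rwa [← hs, ← hz'] at this

theorem kiteMap_of_nonpos (h : IsTriangulation M v f) {e : Fin T.num × Fin 3} {z : ℂ}
    (hz : z ∈ kite v e) (h0 : height v e z ≤ 0) :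
    kiteMap v f e z = f (T.opp e).1 (z - shift v e) := by
  rcases eq_or_lt_of_le h0 with h1 | h1
  · rw [kiteMap_of_nonneg h1.ge]
    exact (h.glue_of_height_eq_zero (h.isPositive.mem_triangle_of_mem_kite hz h1.ge) h1).2
  · exact kiteMap_of_neg h1

theorem kiteMap_opp (h : IsTriangulation M v f) {e : Fin T.num × Fin 3} {z : ℂ}
    (hz : z ∈ kite v e) : kiteMap v f (T.opp e) (z - shift v e) = kiteMap v f e z := by
  have hv := h.isPositive
  have h1 := hv.height_opp e z
  rcases le_total 0 (height v e z) with h0 | h0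
  · rw [h.kiteMap_of_nonpos (hv.mem_kite_opp hz) (by rw [h1]; linarith), hv.shift_opp, T.opp_opp,
      kiteMap_of_nonneg h0]
    congr 1
    ring
  · rw [h.kiteMap_of_nonpos hz h0, kiteMap_of_nonneg (by rw [h1]; linarith)]

/-- A point of a triangle mapped to a singularity is a corner. -/
theorem regular_of_ne_corner (h : IsTriangulation M v f) {τ : Fin T.num} {z : ℂ}
    (hz : z ∈ triangle v τ) (hc : ∀ j, z ≠ corner v (τ, j)) : f τ z ∉ M.singSet := fun hs => by
  obtain ⟨j, hj⟩ := h.regular τ z hz hs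
  exact hc j hj

theorem kiteMap_regular (h : IsTriangulation M v f) {e : Fin T.num × Fin 3} {z : ℂ}
    (hz : z ∈ kite v e) : kiteMap v f e z ∉ M.singSet := by
  have hv := h.isPositive
  have key : ∀ {e : Fin T.num × Fin 3} {z : ℂ}, z ∈ kite v e → 0 ≤ height v e z →
      kiteMap v f e z ∉ M.singSet := fun {e z} hz h0 => by
    rw [kiteMap_of_nonneg h0]
    exact h.regular_of_ne_corner (hv.mem_triangle_of_mem_kite hz h0) fun j =>
      hv.ne_corner_of_mem_kite hz h0 rfl
  rcases le_total 0 (height v e z) with h0 | h0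
  · exact key hz h0
  · rw [← h.kiteMap_opp hz]
    refine key (hv.mem_kite_opp hz) ?_
    rw [hv.height_opp]
    linarith

/-- A neighbourhood of a point of the kite is covered by closed pieces, at most one in each
triangle. Properties known within the triangles thus hold in a full neighbourhood; continuity and
flatness cross the side in this way. -/
theorem eventually_kite (h : IsTriangulation M v f) {e : Fin T.num × Fin 3} {z : ℂ}
    (hz : z ∈ kite v e) {Q : ℂ → M → Prop}
    (h1 : 0 ≤ height v e z → ∀ᶠ q in 𝓝[triangle v e.1] z, Q q (f e.1 q))
    (h2 : height v e z ≤ 0 → ∀ᶠ q in 𝓝[triangle v (T.opp e).1] (z - shift v e),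
      Q (q + shift v e) (f (T.opp e).1 q)) : ∀ᶠ q in 𝓝 z, Q q (kiteMap v f e q) := by
  have hv := h.isPositive
  have hc : Continuous fun q : ℂ => height v e q :=
    (continuous_height e).comp (Continuous.prodMk_right v)
  have hA : ∀ᶠ q in 𝓝 z, q ∈ kite v e → 0 ≤ height v e q → Q q (kiteMap v f e q) := by
    by_cases h0 : 0 ≤ height v e z
    · filter_upwards [eventually_nhdsWithin_iff.1 (h1 h0)] with q hq hqk hq0
      rw [kiteMap_of_nonneg hq0]
      exact hq (hv.mem_triangle_of_mem_kite hqk hq0)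
    · filter_upwards [(hc.tendsto z).eventually (gt_mem_nhds (not_le.1 h0))] with q hq _ hq0
      exact absurd hq0 hq.not_ge
  have hB : ∀ᶠ q in 𝓝 z, q ∈ kite v e → height v e q < 0 → Q q (kiteMap v f e q) := by
    by_cases h0 : height v e z ≤ 0
    · have hs : Tendsto (fun q : ℂ => q - shift v e) (𝓝 z) (𝓝 (z - shift v e)) :=
        (continuous_id.sub continuous_const).tendsto z
      filter_upwards [hs.eventually (eventually_nhdsWithin_iff.1 (h2 h0))] with q hq hqk hq0
      rw [kiteMap_of_neg hq0]
      have := hq (hv.mem_triangle_of_mem_kite (hv.mem_kite_opp hqk)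
        (by rw [hv.height_opp]; linarith))
      rwa [sub_add_cancel] at this
    · filter_upwards [(hc.tendsto z).eventually (lt_mem_nhds (not_le.1 h0))] with q hq _ hq0
      exact absurd hq0 hq.not_gt
  filter_upwards [hA, hB, (isOpen_kite_right v e).mem_nhds hz] with q h3 h4 h5
  rcases lt_or_ge (height v e q) 0 with h6 | h6
  exacts [h4 h5 h6, h3 h5 h6]

theorem flatAt_kiteMap (h : IsTriangulation M v f) {e : Fin T.num × Fin 3} {z : ℂ}
    (hz : z ∈ kite v e) : M.FlatAt (kiteMap v f e) z := by
  have hv := h.isPositive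
  have hmem' : height v e z ≤ 0 → z - shift v e ∈ triangle v (T.opp e).1 := fun h0 =>
    hv.mem_triangle_of_mem_kite (hv.mem_kite_opp hz) (by rw [hv.height_opp]; linarith)
  refine ⟨?_, h.kiteMap_regular hz, fun φ hφ hzφ => ?_⟩
  · intro W hW
    refine h.eventually_kite hz (Q := fun _ m => m ∈ W) (fun h0 => ?_) fun h0 => ?_
    · rw [kiteMap_of_nonneg h0] at hW
      exact h.continuousOn e.1 z (hv.mem_triangle_of_mem_kite hz h0) hW
    · rw [h.kiteMap_of_nonpos hz h0] at hW
      exact h.continuousOn _ _ (hmem' h0) hW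
  · refine h.eventually_kite hz (Q := fun q m => φ m - q = φ (kiteMap v f e z) - z)
      (fun h0 => ?_) fun h0 => ?_
    · rw [kiteMap_of_nonneg h0] at hzφ ⊢
      exact h.translation e.1 z (hv.mem_triangle_of_mem_kite hz h0) φ hφ hzφ
    · rw [h.kiteMap_of_nonpos hz h0] at hzφ ⊢
      filter_upwards [h.translation _ _ (hmem' h0) φ hφ hzφ] with q hq
      linear_combination hq

/-- Regular points of different triangles with the same image are glued along a side. -/
theorem eq_or_glued (h : IsTriangulation M v f) {τ τ' : Fin T.num} {p p' : ℂ}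
    (hp : p ∈ triangle v τ) (hp' : p' ∈ triangle v τ') (he : f τ p = f τ' p')
    (hr : f τ p ∉ M.singSet) : τ = τ' ∧ p = p' ∨
      ∃ e, e.1 = τ ∧ (T.opp e).1 = τ' ∧ height v e p = 0 ∧ p' = p - shift v e := by
  rcases h.separate τ p hp τ' p' hp' he with h1 | h1 | ⟨e, s, hs, h1, h2, h3, h4⟩
  · exact absurd h1 hr
  · exact Or.inl h1
  · exact Or.inr ⟨e, h1, h3, by rw [h2, height_sidePoint], by rw [h4, h2, h.isPositive.sidePoint_opp]⟩

/-- Points of one triangle are separated because a triangle is not glued to itself. A point of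
negative height has positive heights over all sides of the neighbouring triangle, so it lies on no
side and is glued to nothing. -/
theorem injOn_kiteMap (h : IsTriangulation M v f) (e : Fin T.num × Fin 3) :
    InjOn (kiteMap v f e) (kite v e) := by
  have hv := h.isPositive
  have hA : ∀ {e : Fin T.num × Fin 3} {z z' : ℂ}, z ∈ kite v e → z' ∈ kite v e →
      kiteMap v f e z = kiteMap v f e z' → 0 ≤ height v e z → 0 ≤ height v e z' → z = z' := by
    intro e z z' hz hz' he h0 h0'
    have hr := h.kiteMap_regular hz
    rw [kiteMap_of_nonneg h0] at hr he
    rw [kiteMap_of_nonneg h0'] at he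
    rcases h.eq_or_glued (hv.mem_triangle_of_mem_kite hz h0) (hv.mem_triangle_of_mem_kite hz' h0')
      he hr with h1 | ⟨e', h1, h2, -⟩
    · exact h1.2
    · exact absurd (h2.trans h1.symm) (hv.opp_fst_ne e')
  have hB : ∀ {e : Fin T.num × Fin 3} {z z' : ℂ}, z ∈ kite v e → z' ∈ kite v e →
      kiteMap v f e z = kiteMap v f e z' → 0 ≤ height v e z → height v e z' < 0 → False := by
    intro e z z' hz hz' he h0 h0'
    have hr := h.kiteMap_regular hz'
    rw [kiteMap_of_nonneg h0, kiteMap_of_neg h0'] at he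
    rw [kiteMap_of_neg h0'] at hr
    have hk := hv.mem_kite_opp hz'
    have hpos : 0 < height v (T.opp e) (z' - shift v e) := by rw [hv.height_opp]; linarith
    have hpos' := IsPositive.pos_of_mem_kite hk hpos.le
    rcases h.eq_or_glued (hv.mem_triangle_of_mem_kite hk hpos.le)
      (hv.mem_triangle_of_mem_kite hz h0) he.symm hr with h1 | ⟨e', h1, -, h3, -⟩
    · exact hv.opp_fst_ne e h1.1
    · rcases eq_or_eq_nxt_or_eq_prv h1 with rfl | rfl | rfl
      exacts [hpos.ne' h3, hpos'.1.ne' h3, hpos'.2.ne' h3]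
  intro z hz z' hz' he
  rcases lt_or_ge (height v e z) 0 with h0 | h0 <;> rcases lt_or_ge (height v e z') 0 with h0' | h0'
  · have := hA (hv.mem_kite_opp hz) (hv.mem_kite_opp hz')
      (by rw [h.kiteMap_opp hz, h.kiteMap_opp hz', he]) (by rw [hv.height_opp]; linarith)
      (by rw [hv.height_opp]; linarith)
    exact sub_left_injective this
  · exact (hB hz' hz he.symm h0' h0).elim
  · exact (hB hz hz' he h0 h0').elim
  · exact hA hz hz' he h0 h0'

end IsTriangulation

end Pattern

/-! ### Convergence of surfaces with converging edge holonomies. -/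

namespace Pattern

variable {k : ℕ} {α : Fin k → ℕ} {T : Pattern k} {ι : Type*}

/-- Convergence of points of triangulated surfaces: they lie eventually in the same triangle and
converge there. -/
def TriangleConv (U : Ultrafilter ι) (R₀ : T.Realization α) (R : ι → T.Realization α)
    (m : ∀ j, (R j).surface) (a : R₀.surface) : Prop :=
  ∃ (τ : Fin T.num) (p : ι → ℂ) (p₀ : ℂ),
    (∀ᶠ j in (U : Filter ι), p j ∈ triangle (R j).hol τ ∧ (R j).map τ (p j) = m j) ∧
    Tendsto p U (𝓝 p₀) ∧ p₀ ∈ triangle R₀.hol τ ∧ R₀.map τ p₀ = a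

variable {U : Ultrafilter ι} {R₀ : T.Realization α} {R : ι → T.Realization α}

theorem Realization.isPositive (R : T.Realization α) : IsPositive R.hol :=
  R.isTriangulation.isPositive

section

variable (hU : Tendsto (fun j => (R j).hol) U (𝓝 R₀.hol))
include hU

theorem tendsto_height (e : Fin T.num × Fin 3) {p : ι → ℂ} {p₀ : ℂ} (hp : Tendsto p U (𝓝 p₀)) :
    Tendsto (fun j => height (R j).hol e (p j)) U (𝓝 (height R₀.hol e p₀)) :=
  ((continuous_height e).tendsto (R₀.hol, p₀)).comp (hU.prodMk_nhds hp)

theorem tendsto_shift (e : Fin T.num × Fin 3) :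
    Tendsto (fun j => shift (R j).hol e) U (𝓝 (shift R₀.hol e)) :=
  ((continuous_shift e).tendsto R₀.hol).comp hU

theorem tendsto_corner (e : Fin T.num × Fin 3) :
    Tendsto (fun j => corner (R j).hol e) U (𝓝 (corner R₀.hol e)) :=
  ((continuous_corner e).tendsto R₀.hol).comp hU

theorem mem_triangle_of_tendsto {τ : Fin T.num} {p : ι → ℂ} {p₀ : ℂ} (hp : Tendsto p U (𝓝 p₀))
    (h : ∀ᶠ j in (U : Filter ι), p j ∈ triangle (R j).hol τ) : p₀ ∈ triangle R₀.hol τ := by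
  refine R₀.isPositive.mem_triangle.2 fun i => ?_
  refine ge_of_tendsto (tendsto_height hU (τ, i) hp) ?_
  filter_upwards [h] with j hj
  exact (R j).isPositive.mem_triangle.1 hj i

theorem eventually_mem_kite {e : Fin T.num × Fin 3} {p : ι → ℂ} {p₀ : ℂ}
    (hp : Tendsto p U (𝓝 p₀)) (h : p₀ ∈ kite R₀.hol e) :
    ∀ᶠ j in (U : Filter ι), p j ∈ kite (R j).hol e :=
  (hU.prodMk_nhds hp).eventually ((isOpen_kite e).mem_nhds (x := (R₀.hol, p₀)) h)

/-- There are finitely many triangles, so the ultrafilter settles in one; its corners converge, so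
the positions stay bounded. -/
theorem exists_triangleConv (m : ∀ j, (R j).surface) : ∃ a, TriangleConv U R₀ R m a := by
  choose τ' p hp hpm using fun j => (R j).isTriangulation.cover (m j)
  obtain ⟨τ, hτ⟩ : ∃ τ, ∀ᶠ j in (U : Filter ι), τ' j = τ :=
    Ultrafilter.eventually_exists_iff.1 (Eventually.of_forall fun j => ⟨τ' j, rfl⟩)
  have hp' : ∀ᶠ j in (U : Filter ι), p j ∈ triangle (R j).hol τ ∧ (R j).map τ (p j) = m j := by
    filter_upwards [hτ] with j hj
    subst hj
    exact ⟨hp j, hpm j⟩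
  obtain ⟨C, hC⟩ : ∃ C : ℝ, ∀ i, ‖corner R₀.hol (τ, i)‖ < C :=
    ⟨∑ i, ‖corner R₀.hol (τ, i)‖ + 1, fun i => lt_of_le_of_lt
      (Finset.single_le_sum (f := fun i => ‖corner R₀.hol (τ, i)‖) (fun _ _ => norm_nonneg _)
        (Finset.mem_univ i)) (lt_add_one _)⟩
  have hbd : ∀ᶠ j in (U : Filter ι), p j ∈ Metric.closedBall (0 : ℂ) C := by
    have h1 : ∀ᶠ j in (U : Filter ι), ∀ i, ‖corner (R j).hol (τ, i)‖ < C :=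
      eventually_all.2 fun i => (tendsto_corner hU (τ, i)).norm.eventually (gt_mem_nhds (hC i))
    filter_upwards [h1, hp'] with j h1 h2
    refine convexHull_min ?_ (convex_closedBall (0 : ℂ) C) h2.1
    rintro _ ⟨i, rfl⟩
    exact mem_closedBall_zero_iff.2 (h1 i).le
  obtain ⟨p₀, -, hp₀⟩ := (isCompact_closedBall (0 : ℂ) C).ultrafilter_le_nhds (U.map p)
    (le_principal_iff.2 hbd)
  exact ⟨R₀.map τ p₀, τ, p, p₀, hp', hp₀,
    mem_triangle_of_tendsto hU hp₀ (hp'.mono fun j hj => hj.1), rfl⟩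

/-- For regular points two positions are equal or related by `shift` across one fixed side, and both
relations pass to the limit. For singular points `separate` gives nothing, but the positions are
then corners and their labels determine the limit. -/
theorem TriangleConv.unique {m : ∀ j, (R j).surface} {a b : R₀.surface}
    (ha : TriangleConv U R₀ R m a) (hb : TriangleConv U R₀ R m b) : a = b := by
  obtain ⟨τ, p, p₀, hp, hlim, hp₀, rfl⟩ := ha
  obtain ⟨τ', p', p₀', hp', hlim', hp₀', rfl⟩ := hb
  have hcorner : ∀ {τ : Fin T.num} {p : ι → ℂ} {p₀ : ℂ}, Tendsto p U (𝓝 p₀) →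
      (∀ᶠ j in (U : Filter ι), p j ∈ triangle (R j).hol τ ∧ (R j).map τ (p j) = m j) →
      (∀ᶠ j in (U : Filter ι), m j ∈ (R j).surface.singSet) →
      ∃ i, R₀.map τ p₀ = R₀.surface.sing (T.label (τ, i)) ∧
        ∀ᶠ j in (U : Filter ι), m j = (R j).surface.sing (T.label (τ, i)) := by
    intro τ p p₀ hlim hp hs
    obtain ⟨i, hi⟩ : ∃ i, ∀ᶠ j in (U : Filter ι), p j = corner (R j).hol (τ, i) := by
      refine Ultrafilter.eventually_exists_iff.1 ?_
      filter_upwards [hp, hs] with j h1 h2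
      exact (R j).isTriangulation.regular τ (p j) h1.1 (by rwa [h1.2])
    refine ⟨i, ?_, ?_⟩
    · have := tendsto_nhds_unique hlim
        ((tendsto_corner hU (τ, i)).congr' (hi.mono fun j hj => hj.symm))
      rw [this]
      exact R₀.isTriangulation.vertex (τ, i)
    · filter_upwards [hi, hp] with j h1 h2
      rw [← h2.2, h1]
      exact (R j).isTriangulation.vertex (τ, i)
  by_cases hs : ∀ᶠ j in (U : Filter ι), m j ∈ (R j).surface.singSet
  · obtain ⟨i, h1, h2⟩ := hcorner hlim hp hs
    obtain ⟨i', h1', h2'⟩ := hcorner hlim' hp' hs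
    obtain ⟨j, hj, hj'⟩ := (h2.and h2').exists
    rw [h1, h1', (R j).surface.sing_injective (hj.symm.trans hj')]
  · rw [← Ultrafilter.eventually_not] at hs
    have h1 : ∀ᶠ j in (U : Filter ι), (τ = τ' ∧ p j = p' j) ∨ ∃ e : Fin T.num × Fin 3, e.1 = τ ∧
        (T.opp e).1 = τ' ∧ height (R j).hol e (p j) = 0 ∧ p' j = p j - shift (R j).hol e := by
      filter_upwards [hs, hp, hp'] with j h1 h2 h3
      exact (R j).isTriangulation.eq_or_glued h2.1 h3.1 (h2.2.trans h3.2.symm) (by rwa [h2.2])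
    rcases Ultrafilter.eventually_or.1 h1 with h2 | h2
    · obtain ⟨j, hj⟩ := h2.exists
      obtain rfl := hj.1
      rw [tendsto_nhds_unique (hlim.congr' (h2.mono fun j hj => hj.2)) hlim']
    · obtain ⟨e, he⟩ := Ultrafilter.eventually_exists_iff.1 h2
      obtain ⟨j, hj⟩ := he.exists
      obtain rfl := hj.1
      obtain rfl := hj.2.1
      have h0 : height R₀.hol e p₀ = 0 := tendsto_nhds_unique (tendsto_height hU e hlim)
        (tendsto_const_nhds.congr' (he.mono fun j hj => hj.2.2.1.symm))
      have hsub : p₀' = p₀ - shift R₀.hol e := tendsto_nhds_unique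
        (hlim'.congr' (he.mono fun j hj => hj.2.2.2)) (hlim.sub (tendsto_shift hU e))
      rw [hsub]
      exact (R₀.isTriangulation.glue_of_height_eq_zero hp₀ h0).2

theorem triangleConv_kiteMap {e : Fin T.num × Fin 3} {p : ι → ℂ} {p₀ : ℂ}
    (hp : Tendsto p U (𝓝 p₀)) (h : p₀ ∈ kite R₀.hol e) :
    TriangleConv U R₀ R (fun j => kiteMap (R j).hol (R j).map e (p j))
      (kiteMap R₀.hol R₀.map e p₀) := by
  have hk := eventually_mem_kite hU hp h
  have hl := tendsto_height hU e hp
  by_cases h0 : ∀ᶠ j in (U : Filter ι), 0 ≤ height (R j).hol e (p j)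
  · have h0' : 0 ≤ height R₀.hol e p₀ := ge_of_tendsto hl h0
    refine ⟨e.1, p, p₀, ?_, hp, R₀.isPositive.mem_triangle_of_mem_kite h h0',
      (kiteMap_of_nonneg h0').symm⟩
    filter_upwards [hk, h0] with j h1 h2
    exact ⟨(R j).isPositive.mem_triangle_of_mem_kite h1 h2, (kiteMap_of_nonneg h2).symm⟩
  · rw [← Ultrafilter.eventually_not] at h0
    have h0' : height R₀.hol e p₀ ≤ 0 := le_of_tendsto hl (h0.mono fun j hj => (not_le.1 hj).le)
    have hmem : ∀ {v : T.Holonomy} (_ : IsPositive v) {z : ℂ}, z ∈ kite v e → height v e z ≤ 0 →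
        z - shift v e ∈ triangle v (T.opp e).1 := fun {v} hv {z} hz hz0 =>
      hv.mem_triangle_of_mem_kite (hv.mem_kite_opp hz) (by rw [hv.height_opp]; linarith)
    refine ⟨(T.opp e).1, fun j => p j - shift (R j).hol e, p₀ - shift R₀.hol e, ?_,
      hp.sub (tendsto_shift hU e), hmem R₀.isPositive h h0',
      (R₀.isTriangulation.kiteMap_of_nonpos h h0').symm⟩
    filter_upwards [hk, h0] with j h1 h2
    exact ⟨hmem (R j).isPositive h1 (not_le.1 h2).le, (kiteMap_of_neg (not_le.1 h2)).symm⟩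

/-- The triangle witnessing the convergence is not prescribed. As the limit lies in the kite, it can
only be one of the two triangles at `e`, and `shift` translates the positions into kite coordinates.
-/
theorem TriangleConv.exists_kiteMap {e : Fin T.num × Fin 3} {z : ℂ} (hz : z ∈ kite R₀.hol e)
    {m : ∀ j, (R j).surface} (hm : TriangleConv U R₀ R m (kiteMap R₀.hol R₀.map e z)) :
    ∃ q : ι → ℂ, Tendsto q U (𝓝 z) ∧
      ∀ᶠ j in (U : Filter ι), m j = kiteMap (R j).hol (R j).map e (q j) := by
  have key : ∀ {e : Fin T.num × Fin 3} {z : ℂ}, z ∈ kite R₀.hol e → 0 ≤ height R₀.hol e z →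
      TriangleConv U R₀ R m (kiteMap R₀.hol R₀.map e z) → ∃ q : ι → ℂ, Tendsto q U (𝓝 z) ∧
      ∀ᶠ j in (U : Filter ι), m j = kiteMap (R j).hol (R j).map e (q j) := by
    rintro e z hz h0 ⟨τ, p, p₀, hp, hlim, hp₀, he⟩
    have hr := R₀.isTriangulation.kiteMap_regular hz
    rw [kiteMap_of_nonneg h0] at he hr
    rcases R₀.isTriangulation.eq_or_glued (R₀.isPositive.mem_triangle_of_mem_kite hz h0) hp₀
      he.symm hr with ⟨rfl, rfl⟩ | ⟨e', h1, rfl, h3, rfl⟩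
    · refine ⟨p, hlim, ?_⟩
      filter_upwards [hp] with j h1
      rw [kiteMap_of_nonneg ((R j).isPositive.mem_triangle_iff.1 h1.1).1, h1.2]
    · have hpos := IsPositive.pos_of_mem_kite hz h0
      obtain rfl : e' = e := by
        rcases eq_or_eq_nxt_or_eq_prv h1 with h | rfl | rfl
        exacts [h, absurd h3 hpos.1.ne', absurd h3 hpos.2.ne']
      have hq : Tendsto (fun j => p j + shift (R j).hol e') U (𝓝 z) := by
        simpa using hlim.add (tendsto_shift hU e')
      refine ⟨_, hq, ?_⟩
      filter_upwards [hp, eventually_mem_kite hU hq hz] with j h1 h2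
      have h4 := ((R j).isPositive.mem_triangle_iff.1 h1.1).1
      have h5 := (R j).isPositive.height_opp e' (p j + shift (R j).hol e')
      rw [add_sub_cancel_right] at h5
      rw [(R j).isTriangulation.kiteMap_of_nonpos h2 (by linarith), add_sub_cancel_right, h1.2]
  rcases le_total 0 (height R₀.hol e z) with h0 | h0
  · exact key hz h0 hm
  · have hk := R₀.isPositive.mem_kite_opp hz
    obtain ⟨q, hq, hmq⟩ := key hk (by rw [R₀.isPositive.height_opp]; linarith)
      (by rwa [R₀.isTriangulation.kiteMap_opp hz])
    have hq' : Tendsto (fun j => q j + shift (R j).hol e) U (𝓝 z) := by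
      simpa using hq.add (tendsto_shift hU e)
    refine ⟨_, hq', ?_⟩
    filter_upwards [hmq, eventually_mem_kite hU hq' hz] with j h1 h2
    rw [h1, ← (R j).isTriangulation.kiteMap_opp h2, add_sub_cancel_right]

/-- Surfaces triangulated with the same pattern approximate each other when their edge holonomies
do. -/
def approx : TranslationSurface.Approx U R₀.surface (fun j => (R j).surface) where
  Conv := TriangleConv U R₀ R
  exists_conv := exists_triangleConv hU
  unique := TriangleConv.unique hU
  congr := by
    rintro m m' a h ⟨τ, p, p₀, hp, hr⟩
    refine ⟨τ, p, p₀, ?_, hr⟩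
    filter_upwards [h, hp] with j h1 h2
    rw [h1]
    exact h2
  disc a ha := by
    obtain ⟨τ, p, hp, rfl⟩ := R₀.isTriangulation.cover a
    obtain ⟨e, rfl, hpe, h0⟩ := R₀.isPositive.exists_mem_kite hp fun i hi => ha
      ⟨T.label (τ, i), by rw [hi]; exact (R₀.isTriangulation.vertex (τ, i)).symm⟩
    -- The kite is open jointly in the holonomy and the point, so one radius `r` serves `R₀` and all
    -- `R j` near it.
    obtain ⟨V, hV, W, hW, hVW⟩ := mem_nhds_prod_iff.1
      ((isOpen_kite e).mem_nhds (x := (R₀.hol, p)) hpe)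
    obtain ⟨r, hr, hrW⟩ := Metric.mem_nhds_iff.1 hW
    have hball : ∀ v ∈ V, ∀ z ∈ Metric.ball (0 : ℂ) r, p + z ∈ kite v e := fun v hv z hz =>
      hVW (⟨hv, hrW (by simpa [mem_ball_iff_norm] using hz)⟩ : (v, p + z) ∈ V ×ˢ W)
    have hball₀ := hball R₀.hol (mem_of_mem_nhds hV)
    refine ⟨r, hr, fun z => kiteMap R₀.hol R₀.map e (p + z),
      fun j z => kiteMap (R j).hol (R j).map e (p + z), ?_, ?_, ?_, ?_, ?_⟩
    · simp only [add_zero]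
      exact kiteMap_of_nonneg h0
    · exact fun z hz => (R₀.isTriangulation.flatAt_kiteMap (hball₀ z hz)).comp_const_add
    · filter_upwards [hU hV] with j hj
      refine ⟨fun z hz => ((R j).isTriangulation.flatAt_kiteMap (hball _ hj z hz)).comp_const_add,
        fun z hz z' hz' h => ?_⟩
      exact add_left_cancel
        ((R j).isTriangulation.injOn_kiteMap e (hball _ hj z hz) (hball _ hj z' hz') h)
    · exact fun z hz q hq => triangleConv_kiteMap hU (hq.const_add p) (hball₀ z hz)
    · intro z hz m hm
      obtain ⟨q, hq, hmq⟩ := hm.exists_kiteMap hU (hball₀ z hz)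
      refine ⟨fun j => q j - p, by simpa using hq.sub_const p, ?_⟩
      filter_upwards [hmq] with j hj
      rw [hj, add_sub_cancel]

end

end Pattern

/-! ### Trajectories leaving a vertex of a triangulation. -/

theorem Filter.Frequently.exists_ultrafilter {X : Type*} {l : Filter X} {p : X → Prop}
    (h : ∃ᶠ x in l, p x) : ∃ U : Ultrafilter X, (U : Filter X) ≤ l ∧ ∀ᶠ x in (U : Filter X), p x := by
  have : (l ⊓ 𝓟 {x | p x}).NeBot := frequently_mem_iff_neBot.1 h
  obtain ⟨U, hU⟩ := Ultrafilter.exists_le (l ⊓ 𝓟 {x | p x})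
  exact ⟨U, hU.trans inf_le_left, le_principal_iff.1 (hU.trans inf_le_right)⟩

namespace Pattern

variable {k : ℕ} {α : Fin k → ℕ} {T : Pattern k} {v : T.Holonomy}

theorem cross_ofReal_mul (a z : ℂ) (c : ℝ) : cross a (c * z) = c * cross a z := by
  simp only [cross, Complex.re_ofReal_mul, Complex.im_ofReal_mul]
  ring

theorem cross_neg_left (a z : ℂ) : cross (-a) z = -cross a z := by
  simp only [cross, Complex.neg_re, Complex.neg_im]
  ring

theorem eq_zero_of_cross_eq_zero {a b z : ℂ} (hab : cross a b ≠ 0) (ha : cross a z = 0)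
    (hb : cross b z = 0) : z = 0 := by
  simp only [cross] at *
  apply Complex.ext
  · refine (mul_eq_zero.1 (?_ : (a.re * b.im - a.im * b.re) * z.re = 0)).resolve_left hab
    linear_combination b.re * ha - a.re * hb
  · refine (mul_eq_zero.1 (?_ : (a.re * b.im - a.im * b.re) * z.im = 0)).resolve_left hab
    linear_combination b.im * ha - a.im * hb

/-- The corners at the starting points of the sides `c` and `c'` are identified by the gluing
along the side `e`. -/
def Adj (e c c' : Fin T.num × Fin 3) : Prop :=
  c = e ∧ c' = nxt (T.opp e) ∨ c = nxt e ∧ c' = T.opp e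

theorem Adj.fst_eq {e c c' : Fin T.num × Fin 3} (h : Adj e c c') :
    c.1 = e.1 ∧ c'.1 = (T.opp e).1 := by
  rcases h with ⟨rfl, rfl⟩ | ⟨rfl, rfl⟩ <;> exact ⟨rfl, rfl⟩

theorem Adj.corner_eq (hv : IsPositive v) {e c c' : Fin T.num × Fin 3} (h : Adj e c c') :
    corner v c' = corner v c - shift v e := by
  rcases h with ⟨rfl, rfl⟩ | ⟨rfl, rfl⟩
  · rw [shift]
    ring
  · rw [hv.shift_eq, hv.corner_nxt]
    ring

theorem Adj.height_eq (hv : IsPositive v) {e c c' : Fin T.num × Fin 3} (h : Adj e c c') (z : ℂ) :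
    height v e (corner v c + z) = cross (v e) z := by
  rcases h with ⟨rfl, rfl⟩ | ⟨rfl, rfl⟩
  · exact height_add_corner v _ z
  · have := hv.height_prv_add_corner (nxt e) z
    rwa [prv_nxt] at this

/-- The open discs of radius `ρ` around the corners of each triangle are disjoint and do not meet
the opposite sides. -/
def IsSeparated (v : T.Holonomy) (ρ : ℝ) : Prop :=
  ∀ z z' : ℂ, ‖z‖ < ρ → ‖z'‖ < ρ →
    (∀ c c' : Fin T.num × Fin 3, c.1 = c'.1 → corner v c + z = corner v c' + z' → c = c') ∧
    ∀ c : Fin T.num × Fin 3, 0 < height v (nxt c) (corner v c + z)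

theorem IsPositive.corner_injective (hv : IsPositive v) {c c' : Fin T.num × Fin 3}
    (h : c.1 = c'.1) (he : corner v c = corner v c') : c = c' := by
  rcases eq_or_eq_nxt_or_eq_prv h with h | rfl | rfl
  · exact h
  · rw [hv.corner_nxt, add_eq_left] at he
    exact absurd he (hv.ne_zero _)
  · rw [hv.corner_eq_prv c', left_eq_add] at he
    exact absurd he (hv.ne_zero _)

/-- The conditions are open jointly in the holonomy and the displacements, and they hold at
displacement zero. So one `ρ` serves all nearby holonomies, as a converging family of surfaces
requires. -/
theorem IsPositive.exists_isSeparated (hv : IsPositive v) :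
    ∃ ρ > 0, ∀ᶠ v' in 𝓝 v, IsSeparated v' ρ := by
  have hc1 : ∀ c : Fin T.num × Fin 3,
      Continuous fun q : T.Holonomy × (ℂ × ℂ) => corner q.1 c + q.2.1 := fun c =>
    ((continuous_corner c).comp continuous_fst).add (continuous_fst.comp continuous_snd)
  have hc2 : ∀ c : Fin T.num × Fin 3,
      Continuous fun q : T.Holonomy × (ℂ × ℂ) => corner q.1 c + q.2.2 := fun c =>
    ((continuous_corner c).comp continuous_fst).add (continuous_snd.comp continuous_snd)
  have h1 : ∀ᶠ q : T.Holonomy × (ℂ × ℂ) in 𝓝 (v, (0, 0)), ∀ c c' : Fin T.num × Fin 3,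
      c.1 = c'.1 → corner q.1 c + q.2.1 = corner q.1 c' + q.2.2 → c = c' := by
    refine eventually_all.2 fun c => eventually_all.2 fun c' => ?_
    by_cases hcc : c.1 = c'.1 ∧ c ≠ c'
    · have hne : corner v c + 0 ≠ corner v c' + 0 := by
        rw [add_zero, add_zero]
        exact fun h => hcc.2 (hv.corner_injective hcc.1 h)
      filter_upwards [(isOpen_ne_fun (hc1 c) (hc2 c')).mem_nhds hne] with q hq _ h
      exact absurd h hq
    · exact Eventually.of_forall fun q h _ => not_not.1 fun h' => hcc ⟨h, h'⟩
  have h2 : ∀ᶠ q : T.Holonomy × (ℂ × ℂ) in 𝓝 (v, (0, 0)), ∀ c : Fin T.num × Fin 3,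
      0 < height q.1 (nxt c) (corner q.1 c + q.2.1) := by
    refine eventually_all.2 fun c => ?_
    have hcont : Continuous fun q : T.Holonomy × (ℂ × ℂ) =>
        height q.1 (nxt c) (corner q.1 c + q.2.1) :=
      (continuous_height (nxt c)).comp (continuous_fst.prodMk (hc1 c))
    refine (isOpen_lt continuous_const hcont).mem_nhds ?_
    change 0 < height v (nxt c) (corner v c + 0)
    rw [hv.height_nxt_add_corner]
    simpa [cross] using hv.area_pos c
  obtain ⟨V, hV, W, hW, hVW⟩ := mem_nhds_prod_iff.1 (h1.and h2)
  obtain ⟨ρ, hρ, hρW⟩ := Metric.mem_nhds_iff.1 hW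
  refine ⟨ρ, hρ, ?_⟩
  filter_upwards [hV] with v' hv' z z' hz hz'
  have hm : (z, z') ∈ W := hρW (by
    rw [← ball_prod_same]
    exact ⟨mem_ball_zero_iff.2 hz, mem_ball_zero_iff.2 hz'⟩)
  exact hVW (⟨hv', hm⟩ : (v', (z, z')) ∈ V ×ˢ W)

/-- A kite is star-shaped seen from the starting point of `e`, which is not in it. A ray from there
that is in the kite at one time was in it at all earlier positive times. -/
theorem mem_kite_of_smul (hv : IsPositive v) {e : Fin T.num × Fin 3} {z : ℂ} {c : ℝ}
    (hz : corner v e + z ∈ kite v e) (hc : 0 < c) (hc1 : c ≤ 1) :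
    corner v e + c * z ∈ kite v e := by
  have hA : ∀ e : Fin T.num × Fin 3, 0 < height v (nxt e) (corner v e + z) →
      0 < height v (nxt e) (corner v e + c * z) := by
    intro e h
    rw [hv.height_nxt_add_corner] at h ⊢
    rw [cross_ofReal_mul]
    have := hv.area_pos e
    nlinarith
  have hB : ∀ e : Fin T.num × Fin 3, height v e (corner v e + c * z) =
      c * height v e (corner v e + z) := fun e => by
    rw [height_add_corner, height_add_corner, cross_ofReal_mul]
  have hC : height v (prv e) (corner v e + c * z) = c * height v (prv e) (corner v e + z) := by
    rw [hv.height_prv_add_corner, hv.height_prv_add_corner, cross_ofReal_mul]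
  have hs : ∀ z, corner v e + z - shift v e = corner v (nxt (T.opp e)) + z := fun z => by
    rw [shift]
    ring
  refine ⟨?_, ?_⟩
  · rw [hB, hC]
    exact hz.1.imp (fun h => mul_neg_of_pos_of_neg hc h) fun h => ⟨hA e h.1, mul_pos hc h.2⟩
  · have h2 := hz.2
    rw [hs] at h2 ⊢
    rw [hB, hB]
    refine h2.imp (fun h => mul_pos hc h) fun h => ⟨mul_pos hc h.1, ?_⟩
    have := hA (nxt (T.opp e))
    rw [nxt_nxt] at this
    exact this h.2

namespace IsTriangulation

variable {M : TranslationSurface α} {f : Fin T.num → ℂ → M}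

/-- The position of a regular point near a singularity relative to the singularity does not depend
on the triangle in which it is measured. -/
theorem eq_of_separated (h : IsTriangulation M v f) {ρ : ℝ} (hs : IsSeparated v ρ)
    {c c' : Fin T.num × Fin 3} {z z' : ℂ} (hz : ‖z‖ < ρ) (hz' : ‖z'‖ < ρ)
    (hm : corner v c + z ∈ triangle v c.1) (hm' : corner v c' + z' ∈ triangle v c'.1)
    (he : f c.1 (corner v c + z) = f c'.1 (corner v c' + z'))
    (hr : f c.1 (corner v c + z) ∉ M.singSet) :
    z = z' ∧ (c = c' ∨ ∃ e, Adj e c c' ∧ cross (v e) z = 0) := by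
  have hv := h.isPositive
  rcases h.eq_or_glued hm hm' he hr with ⟨h1, h2⟩ | ⟨e, h1, h2, h3, h4⟩
  · obtain rfl := (hs z z' hz hz').1 c c' h1 h2
    exact ⟨add_left_cancel h2, Or.inl rfl⟩
  · have hadj : ∀ c'', Adj e c c'' → z = z' ∧ (c = c' ∨ ∃ e, Adj e c c' ∧ cross (v e) z = 0) := by
      intro c'' ha
      have h5 : corner v c'' + z = corner v c' + z' := by
        rw [ha.corner_eq hv, h4]
        ring
      obtain rfl := (hs z z' hz hz').1 c'' c' (ha.fst_eq.2.trans h2) h5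
      rw [ha.height_eq hv] at h3
      exact ⟨add_left_cancel h5, Or.inr ⟨e, ha, h3⟩⟩
    rcases eq_or_eq_nxt_or_eq_prv h1.symm with rfl | rfl | rfl
    · exact hadj _ (Or.inl ⟨rfl, rfl⟩)
    · exact hadj _ (Or.inr ⟨rfl, rfl⟩)
    · have := (hs z z' hz hz').2 (prv e)
      rw [nxt_prv] at this
      exact absurd h3 this.ne'

/-- Otherwise points tending to the singularity would have positions in one compact triangle, away
from its corners; but the limit position is mapped to the singularity, so it is a corner. -/
theorem eventually_near_corner (h : IsTriangulation M v f) (i : Fin k) {ε : ℝ} (hε : 0 < ε) :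
    ∀ᶠ m in 𝓝 (M.sing i), ∃ z : ℂ, ‖z‖ < ε ∧ ∃ c : Fin T.num × Fin 3,
      corner v c + z ∈ triangle v c.1 ∧ f c.1 (corner v c + z) = m := by
  by_contra hcon
  obtain ⟨U, hU, hU'⟩ := (not_eventually.1 hcon).exists_ultrafilter
  choose τ' p hp hpm using fun m => h.cover m
  obtain ⟨τ, hτ⟩ : ∃ τ, ∀ᶠ m in (U : Filter M), τ' m = τ :=
    Ultrafilter.eventually_exists_iff.1 (Eventually.of_forall fun m => ⟨τ' m, rfl⟩)
  have hp' : ∀ᶠ m in (U : Filter M), p m ∈ triangle v τ ∧ f τ (p m) = m := by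
    filter_upwards [hτ] with m hm
    subst hm
    exact ⟨hp m, hpm m⟩
  have hcomp : IsCompact (triangle v τ) := (Set.finite_range _).isCompact_convexHull ℝ
  obtain ⟨p₀, hp₀, hlim⟩ := hcomp.ultrafilter_le_nhds (U.map p)
    (le_principal_iff.2 (hp'.mono fun m hm => hm.1))
  have hlim' : Tendsto p U (𝓝 p₀) := hlim
  have hf : Tendsto (fun m => f τ (p m)) U (𝓝 (f τ p₀)) :=
    (h.continuousOn τ p₀ hp₀).tendsto.comp
      (tendsto_nhdsWithin_iff.2 ⟨hlim', hp'.mono fun m hm => hm.1⟩)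
  have hfp : f τ p₀ = M.sing i :=
    tendsto_nhds_unique (hf.congr' (hp'.mono fun m hm => hm.2)) (tendsto_id'.2 hU)
  obtain ⟨j, hj⟩ := h.regular τ p₀ hp₀ ⟨i, hfp.symm⟩
  have hz : Tendsto (fun m => ‖p m - corner v (τ, j)‖) U (𝓝 0) := by
    have := (hlim'.sub_const (corner v (τ, j))).norm
    rwa [hj, sub_self, norm_zero] at this
  obtain ⟨m, hm, hm1, hm2⟩ := ((hU'.and (hz.eventually (gt_mem_nhds hε))).and hp').exists
  exact hm.1 ⟨_, hm.2, (τ, j), by simpa using hm1, by simpa using hm2⟩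

/-- A trajectory leaving a singularity does so straight from a corner of a triangle. -/
theorem exists_corner (h : IsTriangulation M v f) {i : Fin k} {y : M} {σ : ℝ → M} {w : ℂ}
    (hσ : M.IsSegment (M.sing i) y σ w) :
    ∃ t₁ > (0 : ℝ), t₁ ≤ 1 ∧ ∃ ρ > 0, IsSeparated v ρ ∧ ∀ t : ℝ, t ∈ Ioo 0 t₁ → ‖(t : ℂ) * w‖ < ρ ∧
      ∃ c : Fin T.num × Fin 3, corner v c + t * w ∈ triangle v c.1 ∧
        f c.1 (corner v c + t * w) = σ t := by
  obtain ⟨ρ, hρ, hsep⟩ := h.isPositive.exists_isSeparated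
  have hs : IsSeparated v ρ := hsep.self_of_nhds
  have hev := fun ε hε => hσ.tendsto_start.eventually (h.eventually_near_corner i (ε := ε) hε)
  obtain ⟨t₂, ht₂, hsub⟩ := mem_nhdsGT_iff_exists_Ioo_subset.1 (hev (ρ / 2) (by positivity))
  have ht₂0 : 0 < t₂ := ht₂
  set t₁ := min t₂ 1 with ht₁
  have ht₁0 : 0 < t₁ := lt_min ht₂0 one_pos
  have hF : ∀ t : ℝ, ∃ z : ℂ, t ∈ Ioo 0 t₁ → ‖z‖ < ρ / 2 ∧ ∃ c : Fin T.num × Fin 3,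
      corner v c + z ∈ triangle v c.1 ∧ f c.1 (corner v c + z) = σ t := by
    intro t
    by_cases ht : t ∈ Ioo 0 t₁
    · obtain ⟨z, hz⟩ := hsub ⟨ht.1, ht.2.trans_le (min_le_left _ _)⟩
      exact ⟨z, fun _ => hz⟩
    · exact ⟨0, fun h => absurd h ht⟩
  choose F hF using hF
  have hreg : ∀ t : ℝ, t ∈ Ioo 0 t₁ → M.PathFlatAt σ w t := fun t ht =>
    hσ.flat t ⟨ht.1, ht.2.trans_le (min_le_right _ _)⟩
  -- The triangle containing `σ t` need not be unique, but the displacement from the vertex is.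
  have huniq : ∀ t : ℝ, t ∈ Ioo 0 t₁ → ∀ z : ℂ, ‖z‖ < ρ → (∃ c : Fin T.num × Fin 3,
      corner v c + z ∈ triangle v c.1 ∧ f c.1 (corner v c + z) = σ t) → z = F t := by
    rintro t ht z hz ⟨c, hc, hcσ⟩
    obtain ⟨hFt, c', hc', hcσ'⟩ := hF t ht
    refine (h.eq_of_separated hs hz (by linarith) hc hc' (hcσ.trans hcσ'.symm) ?_).1
    rw [hcσ]
    exact (hreg t ht).regular
  have hlin : ∀ t : ℝ, t ∈ Ioo 0 t₁ → F t = t * w := by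
    -- If `F` failed to move with velocity `w` near `t`, an ultrafilter of failing times would stay
    -- in one triangle, where a chart at `σ t` compares `F` with `σ` directly.
    refine TranslationSurface.eq_mul_of_locally ht₁0 (fun t ht => ?_) ?_
    · by_contra hcon
      obtain ⟨U, hU, hU'⟩ := (not_eventually.1 hcon).exists_ultrafilter
      have hI : ∀ᶠ s in (U : Filter ℝ), s ∈ Ioo 0 t₁ := hU (Ioo_mem_nhds ht.1 ht.2)
      obtain ⟨c, hc⟩ : ∃ c : Fin T.num × Fin 3, ∀ᶠ s in (U : Filter ℝ),
          corner v c + F s ∈ triangle v c.1 ∧ f c.1 (corner v c + F s) = σ s :=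
        Ultrafilter.eventually_exists_iff.1 (hI.mono fun s hs => (hF s hs).2)
      obtain ⟨z₀, hz₀, hlim⟩ := (isCompact_closedBall (0 : ℂ) (ρ / 2)).ultrafilter_le_nhds
        (U.map F) (le_principal_iff.2
          (hI.mono fun s hs => mem_closedBall_zero_iff.2 (hF s hs).1.le))
      have hlim' : Tendsto (fun s => corner v c + F s) U (𝓝 (corner v c + z₀)) :=
        (show Tendsto F U (𝓝 z₀) from hlim).const_add _
      have hcomp : IsCompact (triangle v c.1) := (Set.finite_range _).isCompact_convexHull ℝ
      have hmem : corner v c + z₀ ∈ triangle v c.1 :=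
        hcomp.isClosed.mem_of_tendsto hlim' (hc.mono fun s hs => hs.1)
      have hwithin : Tendsto (fun s => corner v c + F s) U
          (𝓝[triangle v c.1] (corner v c + z₀)) :=
        tendsto_nhdsWithin_iff.2 ⟨hlim', hc.mono fun s hs => hs.1⟩
      have hσt : f c.1 (corner v c + z₀) = σ t := by
        refine tendsto_nhds_unique (((h.continuousOn c.1 _ hmem).tendsto.comp hwithin).congr'
          (hc.mono fun s hs => hs.2)) ?_
        exact (hreg t ht).continuousAt.tendsto.mono_left hU
      have hz₀F : z₀ = F t := huniq t ht z₀
        (lt_of_le_of_lt (mem_closedBall_zero_iff.1 hz₀) (by linarith)) ⟨c, hmem, hσt⟩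
      obtain ⟨φ, hφ, hφt⟩ := M.exists_chart (hreg t ht).regular
      have htr := hwithin.eventually (h.translation c.1 _ hmem φ hφ (hσt ▸ hφt))
      obtain ⟨s, h1, h2, h3, h4⟩ :=
        (hU'.and (htr.and (hc.and (hU ((hreg t ht).straight φ hφ hφt))))).exists
      refine h1 ?_
      rw [h3.2, hσt, hz₀F] at h2
      have h5 : φ (σ s) = φ (σ t) + ((s - t : ℝ) : ℂ) * w := h4
      push_cast at h5
      linear_combination h5 - h2
    · rw [tendsto_zero_iff_norm_tendsto_zero, Metric.tendsto_nhds]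
      intro ε hε
      filter_upwards [hev (min ε ρ) (lt_min hε hρ), Ioo_mem_nhdsGT ht₁0] with t ⟨z, hz, hc⟩ ht
      rw [← huniq t ht z (hz.trans_le (min_le_right _ _)) hc]
      simpa using hz.trans_le (min_le_left _ _)
  refine ⟨t₁, ht₁0, min_le_right _ _, ρ, hρ, hs, fun t ht => ?_⟩
  rw [← hlin t ht]
  obtain ⟨h1, h2⟩ := hF t ht
  exact ⟨by linarith, h2⟩

/-- A trajectory leaving a singularity begins inside a kite. -/
theorem exists_kite_of_segment (h : IsTriangulation M v f) {i : Fin k} {y : M} {σ : ℝ → M} {w : ℂ}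
    (hσ : M.IsSegment (M.sing i) y σ w) : ∃ e : Fin T.num × Fin 3, ∃ t₁ > (0 : ℝ), ∀ t : ℝ, t ∈ Ioo 0 t₁ →
      corner v e + t * w ∈ kite v e ∧ σ t = kiteMap v f e (corner v e + t * w) := by
  have hv := h.isPositive
  obtain ⟨t₁, ht₁, ht₁1, ρ, hρ, hs, hc⟩ := h.exists_corner hσ
  have hmid : t₁ / 2 ∈ Ioo 0 t₁ := ⟨by linarith, by linarith⟩
  set s := t₁ / 2 with hsdef
  obtain ⟨-, c, hcm, hcσ⟩ := hc s hmid
  -- It is enough that `w` points into the half-open angle at the start of `e` that includes the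
  -- side `e` and excludes the previous side.
  have key : ∀ e : Fin T.num × Fin 3, 0 ≤ cross (v e) w → 0 < cross (v (prv e)) w →
      f e.1 (corner v e + s * w) = σ s → ∃ e : Fin T.num × Fin 3, ∃ t₁ > (0 : ℝ), ∀ t : ℝ, t ∈ Ioo 0 t₁ →
      corner v e + t * w ∈ kite v e ∧ σ t = kiteMap v f e (corner v e + t * w) := by
    intro e h1 h2 h3
    have hh : ∀ t : ℝ, t ∈ Ioo 0 t₁ → 0 ≤ height v e (corner v e + t * w) := fun t ht => by
      rw [height_add_corner, cross_ofReal_mul]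
      exact mul_nonneg ht.1.le h1
    have hk : ∀ t : ℝ, t ∈ Ioo 0 t₁ → corner v e + t * w ∈ kite v e := fun t ht => by
      refine hv.mem_kite (hh t ht) ((hs _ _ (hc t ht).1 (hc t ht).1).2 e) ?_
      rw [hv.height_prv_add_corner, cross_ofReal_mul]
      exact mul_pos ht.1 h2
    have heq : EqOn σ (fun t : ℝ => kiteMap v f e (t * w + corner v e)) (Ioo 0 t₁) := by
      refine TranslationSurface.eqOn_of_pathFlatAt (w := w) isPreconnected_Ioo
        (fun t ht => hσ.flat t ⟨ht.1, ht.2.trans_le ht₁1⟩)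
        (fun t ht => TranslationSurface.FlatAt.pathFlatAt (h.flatAt_kiteMap ?_)) hmid ?_
      · rw [add_comm]
        exact hk t ht
      · rw [add_comm, kiteMap_of_nonneg (hh s hmid), h3]
    exact ⟨e, t₁, ht₁, fun t ht => ⟨hk t ht, by rw [add_comm (corner v e)]; exact heq ht⟩⟩
  obtain ⟨h1, h2, h3⟩ := hv.mem_triangle_iff.1 hcm
  rw [height_add_corner, cross_ofReal_mul] at h1
  rw [hv.height_prv_add_corner, cross_ofReal_mul] at h3
  have h1' := nonneg_of_mul_nonneg_right h1 hmid.1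
  have h3' := nonneg_of_mul_nonneg_right h3 hmid.1
  -- If `w` points along the previous side, the segment is viewed from the neighbouring triangle,
  -- where that side is the included side of the angle.
  rcases eq_or_lt_of_le h3' with h0 | h0
  · have hadj : Adj (prv c) c (T.opp (prv c)) := Or.inr ⟨(nxt_prv c).symm, rfl⟩
    have h4 : height v (prv c) (corner v c + s * w) = 0 := by
      rw [hv.height_prv_add_corner, cross_ofReal_mul, ← h0, mul_zero]
    obtain ⟨h5, h6⟩ := h.glue_of_height_eq_zero (e := prv c) hcm h4
    have h7 : corner v c + s * w - shift v (prv c) = corner v (T.opp (prv c)) + s * w := by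
      rw [hadj.corner_eq hv]
      ring
    rw [h7] at h5 h6
    obtain ⟨g1, g2, g3⟩ := hv.mem_triangle_iff.1 h5
    rw [hv.height_prv_add_corner, cross_ofReal_mul] at g3
    have g3' := nonneg_of_mul_nonneg_right g3 hmid.1
    have g4 : cross (v (T.opp (prv c))) w = 0 := by rw [hv.opposite, cross_neg_left, ← h0, neg_zero]
    refine key (T.opp (prv c)) g4.ge (lt_of_le_of_ne g3' fun g0 => ?_) (h6.symm.trans hcσ)
    refine hσ.ne_zero (eq_zero_of_cross_eq_zero (hv.area_pos (prv (T.opp (prv c)))).ne' g0.symm ?_)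
    rw [nxt_prv]
    exact g4
  · exact key c h1' h0 hcσ

/-- The corner is not in the kite and flatness says nothing there. It lies on the common side, so
the two triangles give the same limit. -/
theorem tendsto_kiteMap_corner (h : IsTriangulation M v f) {e : Fin T.num × Fin 3} {ι : Type*}
    {l : Filter ι} {p : ι → ℂ} (hp : Tendsto p l (𝓝 (corner v e)))
    (hk : ∀ᶠ j in l, p j ∈ kite v e) :
    Tendsto (fun j => kiteMap v f e (p j)) l (𝓝 (M.sing (T.label e))) := by
  have hv := h.isPositive
  have hce : corner v e ∈ triangle v e.1 := subset_convexHull ℝ _ ⟨e.2, rfl⟩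
  have h0 : height v e (corner v e) = 0 := by
    have := height_add_corner v e 0
    simpa [cross] using this
  obtain ⟨h1, h2⟩ := h.glue_of_height_eq_zero hce h0
  have h3 : f e.1 (corner v e) = M.sing (T.label e) := h.vertex e
  intro W hW
  have hA : ∀ᶠ q in 𝓝 (corner v e), q ∈ triangle v e.1 → f e.1 q ∈ W := by
    rw [← h3] at hW
    exact eventually_nhdsWithin_iff.1 (h.continuousOn e.1 _ hce hW)
  have hB : ∀ᶠ q in 𝓝 (corner v e - shift v e), q ∈ triangle v (T.opp e).1 →
      f (T.opp e).1 q ∈ W := by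
    rw [← h3, h2] at hW
    exact eventually_nhdsWithin_iff.1 (h.continuousOn _ _ h1 hW)
  have hs : Tendsto (fun q : ℂ => q - shift v e) (𝓝 (corner v e)) (𝓝 (corner v e - shift v e)) :=
    (continuous_id.sub continuous_const).tendsto _
  change ∀ᶠ j in l, kiteMap v f e (p j) ∈ W
  filter_upwards [hk, hp.eventually hA, hp.eventually (hs.eventually hB)] with j g1 g2 g3
  rcases lt_or_ge (height v e (p j)) 0 with g0 | g0
  · rw [kiteMap_of_neg g0]
    exact g3 (hv.mem_triangle_of_mem_kite (hv.mem_kite_opp g1) (by rw [hv.height_opp]; linarith))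
  · rw [kiteMap_of_nonneg g0]
    exact g2 (hv.mem_triangle_of_mem_kite g1 g0)

/-- A point of the kite of `e` near the starting point of `e` lies in one of the two triangles. -/
theorem kiteMap_corner (h : IsTriangulation M v f) {e : Fin T.num × Fin 3} {z : ℂ}
    (hz : corner v e + z ∈ kite v e) : ∃ c : Fin T.num × Fin 3, (c = e ∨ c = nxt (T.opp e)) ∧
      corner v c + z ∈ triangle v c.1 ∧
      kiteMap v f e (corner v e + z) = f c.1 (corner v c + z) := by
  have hv := h.isPositive
  have hs : corner v e + z - shift v e = corner v (nxt (T.opp e)) + z := by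
    rw [shift]
    ring
  rcases lt_or_ge (height v e (corner v e + z)) 0 with h0 | h0
  · refine ⟨_, Or.inr rfl, ?_, ?_⟩
    · rw [← hs]
      exact hv.mem_triangle_of_mem_kite (e := T.opp e) (hv.mem_kite_opp hz)
        (by rw [hv.height_opp]; linarith)
    · rw [kiteMap_of_neg h0, hs]
      rfl
  · exact ⟨e, Or.inl rfl, hv.mem_triangle_of_mem_kite hz h0, kiteMap_of_nonneg h0⟩

theorem kiteMap_of_mem_triangle (h : IsTriangulation M v f) {e c : Fin T.num × Fin 3} {z : ℂ}
    (hz : corner v e + z ∈ kite v e) (hc : c = e ∨ c = nxt (T.opp e))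
    (hm : corner v c + z ∈ triangle v c.1) :
    kiteMap v f e (corner v e + z) = f c.1 (corner v c + z) := by
  have hv := h.isPositive
  rcases hc with rfl | rfl
  · exact kiteMap_of_nonneg (hv.mem_triangle_iff.1 hm).1
  · have hs : corner v e + z - shift v e = corner v (nxt (T.opp e)) + z := by
      rw [shift]
      ring
    have h1 := (hv.mem_triangle_iff (e := T.opp e)).1 hm
    rw [← hs, hv.height_opp] at h1
    rw [h.kiteMap_of_nonpos hz (by linarith [h1.1]), hs]
    rfl

end IsTriangulation

end Pattern

/-! ### Launches at labelled points and limits in a stratum. -/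

namespace Pattern

open TranslationSurface

variable {k : ℕ} {α : Fin k → ℕ} {T : Pattern k} {ι : Type*}
variable {U : Ultrafilter ι} {R₀ : T.Realization α} {R : ι → T.Realization α}

theorem triangleConv_corner (hU : Tendsto (fun j => (R j).hol) U (𝓝 R₀.hol))
    {e : Fin T.num × Fin 3} {p : ι → ℂ} (hp : Tendsto p U (𝓝 (corner R₀.hol e)))
    (hk : ∀ᶠ j in (U : Filter ι), p j ∈ kite (R j).hol e) :
    TriangleConv U R₀ R (fun j => kiteMap (R j).hol (R j).map e (p j))
      (R₀.surface.sing (T.label e)) := by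
  have hce : corner R₀.hol e ∈ triangle R₀.hol e.1 := subset_convexHull ℝ _ ⟨e.2, rfl⟩
  have h0 : height R₀.hol e (corner R₀.hol e) = 0 := by
    have := height_add_corner R₀.hol e 0
    simpa [cross] using this
  obtain ⟨h1, h2⟩ := R₀.isTriangulation.glue_of_height_eq_zero hce h0
  have h3 : R₀.map e.1 (corner R₀.hol e) = R₀.surface.sing (T.label e) :=
    R₀.isTriangulation.vertex e
  by_cases hA : ∀ᶠ j in (U : Filter ι), 0 ≤ height (R j).hol e (p j)
  · refine ⟨e.1, p, corner R₀.hol e, ?_, hp, hce, h3⟩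
    filter_upwards [hA, hk] with j g1 g2
    exact ⟨(R j).isPositive.mem_triangle_of_mem_kite g2 g1, (kiteMap_of_nonneg g1).symm⟩
  · rw [← Ultrafilter.eventually_not] at hA
    refine ⟨(T.opp e).1, fun j => p j - shift (R j).hol e, corner R₀.hol e - shift R₀.hol e, ?_,
      hp.sub (tendsto_shift hU e), h1, by rw [← h2, h3]⟩
    filter_upwards [hA, hk] with j g1 g2
    have g0 := not_le.1 g1
    exact ⟨(R j).isPositive.mem_triangle_of_mem_kite ((R j).isPositive.mem_kite_opp g2)
      (by rw [(R j).isPositive.height_opp]; linarith), (kiteMap_of_neg g0).symm⟩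

/-- At the single time `t₀` membership in the kite is open in holonomy and velocity;
`mem_kite_of_smul` extends it to all of `(0, t₀]`, uniformly down to the singularity. -/
theorem launchOn_kite (hU : Tendsto (fun j => (R j).hol) U (𝓝 R₀.hol)) {e : Fin T.num × Fin 3}
    {y : R₀.surface} {σ : ℝ → R₀.surface} {w : ℂ} {t₁ : ℝ} (ht₁ : 0 < t₁)
    (hσ : R₀.surface.IsSegment (R₀.surface.sing (T.label e)) y σ w)
    (hk : ∀ t : ℝ, t ∈ Ioo 0 t₁ → corner R₀.hol e + t * w ∈ kite R₀.hol e ∧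
      σ t = kiteMap R₀.hol R₀.map e (corner R₀.hol e + t * w)) :
    ∃ t₀ r, LaunchOn (approx hU) (fun j => (R j).surface.sing (T.label e)) σ w
      (fun j z => kiteMap (R j).hol (R j).map e (corner (R j).hol e + z)) t₀ r := by
  set t₀ := t₁ / 2 with ht₀
  have ht₀0 : 0 < t₀ := by positivity
  have ht₀1 : t₀ < t₁ := by linarith
  have hcont : Continuous fun q : T.Holonomy × ℂ => (q.1, corner q.1 e + (t₀ : ℂ) * q.2) :=
    continuous_fst.prodMk (((continuous_corner e).comp continuous_fst).add
      (continuous_const.mul continuous_snd))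
  obtain ⟨V, hV, W, hW, hVW⟩ := mem_nhds_prod_iff.1
    (((isOpen_kite e).preimage hcont).mem_nhds (x := (R₀.hol, w)) (hk t₀ ⟨ht₀0, ht₀1⟩).1)
  obtain ⟨r, hr, hrW⟩ := Metric.mem_nhds_iff.1 hW
  have hmem : ∀ᶠ j in (U : Filter ι), ∀ z ∈ Metric.ball w r, ∀ s ∈ Ioc 0 t₀,
      corner (R j).hol e + s * z ∈ kite (R j).hol e := by
    filter_upwards [hU hV] with j hj z hz s hs
    have h1 : corner (R j).hol e + t₀ * z ∈ kite (R j).hol e :=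
      hVW (⟨hj, hrW hz⟩ : ((R j).hol, z) ∈ V ×ˢ W)
    have h2 := mem_kite_of_smul (R j).isPositive (c := s / t₀) h1 (div_pos hs.1 ht₀0)
      ((div_le_one ht₀0).2 hs.2)
    have h3 : ((s / t₀ : ℝ) : ℂ) * (t₀ * z) = s * z := by
      have : (t₀ : ℂ) ≠ 0 := by exact_mod_cast ht₀0.ne'
      push_cast
      field_simp
    rwa [h3] at h2
  have hlin : ∀ (c z : ℂ), Tendsto (fun s : ℝ => c + (s : ℂ) * z) (𝓝[>] 0) (𝓝 c) := fun c z => by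
    have : Continuous fun s : ℝ => c + (s : ℂ) * z := by fun_prop
    simpa using (this.tendsto 0).mono_left nhdsWithin_le_nhds
  refine ⟨t₀, r, ht₀0, hr, ?_, ?_, ?_⟩
  · filter_upwards [hmem] with j hj z hz s hs
    exact ((R j).isTriangulation.flatAt_kiteMap (hj z hz s hs)).comp_const_add
  · filter_upwards [hmem] with j hj z hz
    refine (R j).isTriangulation.tendsto_kiteMap_corner (hlin _ z) ?_
    filter_upwards [Ioc_mem_nhdsGT ht₀0] with s hs using hj z hz s hs
  · intro z hz s hs s₀ hs₀
    have hs₀m : s₀ ∈ Icc 0 t₀ :=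
      isClosed_Icc.mem_of_tendsto hs₀ (hs.mono fun j hj => ⟨hj.1.le, hj.2⟩)
    have hlim : Tendsto (fun j => corner (R j).hol e + (s j : ℂ) * z j) U
        (𝓝 (corner R₀.hol e + s₀ * w)) :=
      (tendsto_corner hU e).add (((Complex.continuous_ofReal.tendsto s₀).comp hs₀).mul hz)
    rcases eq_or_lt_of_le hs₀m.1 with rfl | hpos
    · rw [hσ.start]
      refine triangleConv_corner hU (by simpa using hlim) ?_
      filter_upwards [hmem, hs, hz.eventually (Metric.ball_mem_nhds w hr)] with j g1 g2 g3
      exact g1 _ g3 _ g2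
    · obtain ⟨h1, h2⟩ := hk s₀ ⟨hpos, hs₀m.2.trans_lt ht₀1⟩
      rw [h2]
      exact triangleConv_kiteMap hU hlim h1

/-- Points of the triangulated surfaces tending to a corner of a triangle determine the direction
in which they lie. -/
theorem HitAtStart.exists_corner (hU : Tendsto (fun j => (R j).hol) U (𝓝 R₀.hol))
    {e : Fin T.num × Fin 3} {σ : ℝ → R₀.surface} {w : ℂ} {t₁ : ℝ} (ht₁ : 0 < t₁)
    (hk : ∀ t : ℝ, t ∈ Ioo 0 t₁ → corner R₀.hol e + t * w ∈ kite R₀.hol e ∧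
      σ t = kiteMap R₀.hol R₀.map e (corner R₀.hol e + t * w)) {b : ∀ j, (R j).surface}
    (hb : HitAtStart U w
      (fun j z => kiteMap (R j).hol (R j).map e (corner (R j).hol e + z)) b) :
    ∃ (c : Fin T.num × Fin 3) (z : ι → ℂ) (s : ι → ℝ), Tendsto z U (𝓝 w) ∧ Tendsto s U (𝓝 0) ∧
      (∀ᶠ j in (U : Filter ι), 0 < s j) ∧
      (∀ᶠ j in (U : Filter ι), corner (R j).hol c + s j * z j ∈ triangle (R j).hol c.1 ∧
        b j = (R j).map c.1 (corner (R j).hol c + s j * z j) ∧ b j ∉ (R j).surface.singSet) ∧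
      ∀ᶠ t : ℝ in 𝓝[>] 0, corner R₀.hol c + t * w ∈ triangle R₀.hol c.1 ∧
        σ t = R₀.map c.1 (corner R₀.hol c + t * w) := by
  obtain ⟨z, s, hz, hs, hs0, hbz⟩ := hb
  have hv := R₀.isPositive
  have hmid : t₁ / 2 ∈ Ioo 0 t₁ := ⟨by linarith, by linarith⟩
  have hkite : ∀ᶠ j in (U : Filter ι), corner (R j).hol e + s j * z j ∈ kite (R j).hol e := by
    have hlim : Tendsto (fun j => corner (R j).hol e + ((t₁ / 2 : ℝ) : ℂ) * z j) U
        (𝓝 (corner R₀.hol e + ((t₁ / 2 : ℝ) : ℂ) * w)) :=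
      (tendsto_corner hU e).add (hz.const_mul _)
    filter_upwards [eventually_mem_kite hU hlim (hk _ hmid).1, hs0,
      hs.eventually (gt_mem_nhds hmid.1)] with j h1 h2 h3
    have h4 := mem_kite_of_smul (R j).isPositive (c := s j / (t₁ / 2)) h1 (div_pos h2 hmid.1)
      ((div_le_one hmid.1).2 h3.le)
    have h5 : ((s j / (t₁ / 2) : ℝ) : ℂ) * (((t₁ / 2 : ℝ) : ℂ) * z j) = s j * z j := by
      have : (t₁ : ℂ) ≠ 0 := by exact_mod_cast ht₁.ne'
      push_cast
      field_simp
    rwa [h5] at h4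
  obtain ⟨c, hc⟩ : ∃ c : Fin T.num × Fin 3, ∀ᶠ j in (U : Filter ι),
      (c = e ∨ c = nxt (T.opp e)) ∧ corner (R j).hol c + s j * z j ∈ triangle (R j).hol c.1 ∧
      kiteMap (R j).hol (R j).map e (corner (R j).hol e + s j * z j) =
        (R j).map c.1 (corner (R j).hol c + s j * z j) :=
    Ultrafilter.eventually_exists_iff.1
      (hkite.mono fun j hj => (R j).isTriangulation.kiteMap_corner hj)
  obtain ⟨-, hce, -⟩ := hc.exists
  refine ⟨c, z, s, hz, hs, hs0, ?_, ?_⟩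
  · filter_upwards [hc, hbz, hkite] with j h1 h2 h3
    refine ⟨h1.2.1, h2.trans h1.2.2, ?_⟩
    rw [h2]
    exact (R j).isTriangulation.kiteMap_regular h3
  -- The directions of the hit points lie in the angle at `c`. This is a closed condition, so the
  -- limit `w` lies in the angle at `c` for `R₀`, and `σ` starts in that triangle.
  · have hlimc : ∀ e : Fin T.num × Fin 3, Tendsto (fun j => cross ((R j).hol e) (z j)) U
        (𝓝 (cross (R₀.hol e) w)) := fun e =>
      (continuous_cross.tendsto (R₀.hol e, w)).comp
        ((((continuous_apply e).tendsto R₀.hol).comp hU).prodMk_nhds hz)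
    have h1 : 0 ≤ cross (R₀.hol c) w := by
      refine ge_of_tendsto (hlimc c) ?_
      filter_upwards [hc, hs0] with j g1 g2
      have g3 := ((R j).isPositive.mem_triangle_iff.1 g1.2.1).1
      rw [height_add_corner, cross_ofReal_mul] at g3
      exact nonneg_of_mul_nonneg_right g3 g2
    have h2 : 0 ≤ cross (R₀.hol (prv c)) w := by
      refine ge_of_tendsto (hlimc (prv c)) ?_
      filter_upwards [hc, hs0] with j g1 g2
      have g3 := ((R j).isPositive.mem_triangle_iff.1 g1.2.1).2.2
      rw [(R j).isPositive.height_prv_add_corner, cross_ofReal_mul] at g3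
      exact nonneg_of_mul_nonneg_right g3 g2
    obtain ⟨ρ, hρ, hsep⟩ := hv.exists_isSeparated
    have hlin : Tendsto (fun t : ℝ => ‖(t : ℂ) * w‖) (𝓝[>] 0) (𝓝 0) := by
      have : Continuous fun t : ℝ => ‖(t : ℂ) * w‖ := by fun_prop
      simpa using (this.tendsto 0).mono_left nhdsWithin_le_nhds
    filter_upwards [Ioo_mem_nhdsGT ht₁, hlin.eventually (gt_mem_nhds hρ)] with t ht htρ
    have hm : corner R₀.hol c + t * w ∈ triangle R₀.hol c.1 := by
      refine hv.mem_triangle_iff.2 ⟨?_, ?_, ?_⟩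
      · rw [height_add_corner, cross_ofReal_mul]
        exact mul_nonneg ht.1.le h1
      · exact ((hsep.self_of_nhds _ _ htρ htρ).2 c).le
      · rw [hv.height_prv_add_corner, cross_ofReal_mul]
        exact mul_nonneg ht.1.le h2
    obtain ⟨g1, g2⟩ := hk t ht
    exact ⟨hm, g2.trans (R₀.isTriangulation.kiteMap_of_mem_triangle g1 hce hm)⟩

/-- Segments leaving one singularity may start in different kites, so injectivity of a single map
cannot give the germ condition. Hits are compared through triangles instead: equal points have equal
displacements from the vertex, and their triangles either agree or share a side along which the
displacement runs. -/
theorem exists_launchFamily_corner (hU : Tendsto (fun j => (R j).hol) U (𝓝 R₀.hol)) {i : Fin k}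
    {κ : Type*} {σ : κ → ℝ → R₀.surface} {w : κ → ℂ}
    (hσ : ∀ p, ∃ y, R₀.surface.IsSegment (R₀.surface.sing i) y (σ p) (w p)) :
    ∃ S, LaunchFamily (approx hU) (fun j => (R j).surface.sing i) σ w S := by
  choose y hy using hσ
  choose e t₁ ht₁ hk using fun p => R₀.isTriangulation.exists_kite_of_segment (hy p)
  have hlabel : ∀ p, T.label (e p) = i := by
    intro p
    refine R₀.surface.sing_injective (tendsto_nhds_unique ?_ (hy p).tendsto_start)
    have hlin : Tendsto (fun t : ℝ => corner R₀.hol (e p) + (t : ℂ) * w p) (𝓝[>] 0)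
        (𝓝 (corner R₀.hol (e p))) := by
      have : Continuous fun s : ℝ => corner R₀.hol (e p) + (s : ℂ) * w p := by fun_prop
      simpa using (this.tendsto 0).mono_left nhdsWithin_le_nhds
    have hI := Ioo_mem_nhdsGT (ht₁ p)
    refine (R₀.isTriangulation.tendsto_kiteMap_corner hlin ?_).congr' ?_
    · filter_upwards [hI] with t ht using (hk p t ht).1
    · filter_upwards [hI] with t ht using (hk p t ht).2.symm
  refine ⟨fun p j z => kiteMap (R j).hol (R j).map (e p) (corner (R j).hol (e p) + z),
    fun p => ?_, fun p q b hp hq => ?_⟩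
  · have hyp := hy p
    rw [← hlabel p] at hyp ⊢
    exact launchOn_kite hU (ht₁ p) hyp (hk p)
  · obtain ⟨c, z, s, hz, hs, hs0, hb, hev⟩ := HitAtStart.exists_corner hU (ht₁ p) (hk p) hp
    obtain ⟨c', z', s', hz', hs', hs0', hb', hev'⟩ := HitAtStart.exists_corner hU (ht₁ q) (hk q) hq
    obtain ⟨ρ, hρ, hsep⟩ := R₀.isPositive.exists_isSeparated
    have hsmall : ∀ {z : ι → ℂ} {s : ι → ℝ} {w : ℂ}, Tendsto z U (𝓝 w) → Tendsto s U (𝓝 0) →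
        ∀ᶠ j in (U : Filter ι), ‖(s j : ℂ) * z j‖ < ρ := by
      intro z s w hz hs
      have := (((Complex.continuous_ofReal.tendsto 0).comp hs).mul hz).norm
      simp only [Complex.ofReal_zero, zero_mul, norm_zero] at this
      exact this.eventually (gt_mem_nhds hρ)
    have hmain : ∀ᶠ j in (U : Filter ι), (s j : ℂ) * z j = s' j * z' j ∧
        (c = c' ∨ ∃ d, Adj d c c' ∧ cross ((R j).hol d) (s j * z j) = 0) := by
      filter_upwards [hU.eventually hsep, hsmall hz hs, hsmall hz' hs', hb, hb']
        with j g1 g2 g3 g4 g5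
      exact (R j).isTriangulation.eq_of_separated g1 g2 g3 g4.1 g5.1 (g4.2.1.symm.trans g5.2.1)
        (g4.2.1 ▸ g4.2.2)
    obtain ⟨r, hr, hw⟩ := exists_pos_smul_of_rays (hy p).ne_zero (hy q).ne_zero hz hz' hs0 hs0'
      (hmain.mono fun j hj => hj.1)
    refine ⟨r, hr, hw, ?_⟩
    have hrt : Tendsto (fun t : ℝ => r * t) (𝓝[>] 0) (𝓝[>] 0) := by
      refine tendsto_nhdsWithin_iff.2 ⟨?_, ?_⟩
      · have : Continuous fun t : ℝ => r * t := by fun_prop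
        simpa using (this.tendsto 0).mono_left nhdsWithin_le_nhds
      · filter_upwards [self_mem_nhdsWithin] with t ht
        exact mul_pos hr ht
    have htw : ∀ t : ℝ, ((r * t : ℝ) : ℂ) * w q = t * w p := fun t => by
      rw [hw]
      push_cast
      ring
    rcases Ultrafilter.eventually_or.1 (hmain.mono fun j hj => hj.2) with h | h
    · obtain ⟨-, rfl⟩ := h.exists
      filter_upwards [hev, hrt.eventually hev'] with t g1 g2
      rw [g1.2, g2.2, htw]
    -- The limit direction runs along the side `d` shared by the two triangles, so the gluing along
    -- `d` identifies the two germs.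
    · obtain ⟨d, hd⟩ := Ultrafilter.eventually_exists_iff.1 h
      obtain ⟨-, hadj, -⟩ := hd.exists
      have h0 : cross (R₀.hol d) (w p) = 0 := by
        have hl : Tendsto (fun j => cross ((R j).hol d) (z j)) U (𝓝 (cross (R₀.hol d) (w p))) :=
          (continuous_cross.tendsto (R₀.hol d, w p)).comp
            ((((continuous_apply d).tendsto R₀.hol).comp hU).prodMk_nhds hz)
        refine tendsto_nhds_unique hl (tendsto_const_nhds.congr' ?_)
        filter_upwards [hd, hs0] with j g1 g2
        have g3 := g1.2
        rw [cross_ofReal_mul] at g3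
        exact ((mul_eq_zero.1 g3).resolve_left g2.ne').symm
      filter_upwards [hev, hrt.eventually hev'] with t g1 g2
      rw [g1.2, g2.2, htw]
      have hg := (R₀.isTriangulation.glue_of_height_eq_zero (e := d)
        (z := corner R₀.hol c + t * w p) (hadj.fst_eq.1 ▸ g1.1)
        (by rw [hadj.height_eq R₀.isPositive, cross_ofReal_mul, h0, mul_zero])).2
      rw [hadj.fst_eq.1, hadj.fst_eq.2, hg, hadj.corner_eq R₀.isPositive]
      congr 1
      ring

/-- Blocking cardinalities of pairs of labelled points are lower semicontinuous. -/
theorem bc_sing_le (hU : Tendsto (fun j => (R j).hol) U (𝓝 R₀.hol)) {i i' : Fin k} (hi : i ≠ i')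
    {n : ℕ} (hn : ∀ᶠ j in (U : Filter ι),
      (R j).surface.bc ((R j).surface.sing i) ((R j).surface.sing i') ≤ n) :
    R₀.surface.bc (R₀.surface.sing i) (R₀.surface.sing i') ≤ n := by
  let κ := {p : (ℝ → R₀.surface) × ℂ //
    R₀.surface.IsPrimitive (R₀.surface.sing i) (R₀.surface.sing i') p.1 p.2}
  obtain ⟨S, hS⟩ := exists_launchFamily_corner hU (κ := κ) (σ := fun p => p.1.1)
    (w := fun p => p.1.2) fun p => ⟨_, p.2.toIsSegment⟩
  obtain ⟨S', hS'⟩ := exists_launchFamily_corner hU (κ := κ) (σ := fun p t => p.1.1 (1 - t))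
    (w := fun p => -p.1.2) fun p => ⟨_, p.2.reverse.toIsSegment⟩
  obtain ⟨B, hxB, hyB, hB, -, hc⟩ := (approx hU).exists_blocking hn (fun p : κ => p.2) hS hS'
  exact bc_le_iff.2 ⟨B, isBlockingSet_of_isPrimitive hxB hyB fun σ w h => hB ⟨(σ, w), h⟩,
    hc fun h => hi (R₀.surface.sing_injective h)⟩

/-- A bound for the blocking cardinalities of all pairs of distinct regular points is inherited by
limits. -/
theorem bc_regularPairs_le (hU : Tendsto (fun j => (R j).hol) U (𝓝 R₀.hol)) {n : ℕ}
    (hn : ∀ᶠ j in (U : Filter ι),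
      ∀ p ∈ (R j).surface.regularPairs, (R j).surface.bc p.1 p.2 ≤ n) :
    ∀ p ∈ R₀.surface.regularPairs, R₀.surface.bc p.1 p.2 ≤ n := by
  rintro ⟨x, y⟩ ⟨hx, hy, hxy⟩
  have key : ∀ x : R₀.surface, x ∉ R₀.surface.singSet → ∃ xs : ∀ j, (R j).surface,
      (approx hU).Conv xs x ∧ ∀ᶠ j in (U : Filter ι), xs j ∉ (R j).surface.singSet := by
    intro x hx
    obtain ⟨r, hr, D, E, hD0, -, hE, hconv, -⟩ := (approx hU).disc x hx
    have h0 := Metric.mem_ball_self (x := (0 : ℂ)) hr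
    refine ⟨fun j => E j 0, ?_, hE.mono fun j hj => (hj.1 0 h0).regular⟩
    have := hconv 0 h0 (fun _ => 0) tendsto_const_nhds
    rwa [hD0] at this
  obtain ⟨xs, hxs, hxr⟩ := key x hx
  obtain ⟨ys, hys, hyr⟩ := key y hy
  have hne : ∀ᶠ j in (U : Filter ι), xs j ≠ ys j := by
    by_contra h
    rw [← Ultrafilter.eventually_not] at h
    exact hxy ((approx hU).unique hxs ((approx hU).congr (h.mono fun j hj => not_not.1 hj) hys))
  refine (approx hU).bc_le (xs := xs) (ys := ys) ?_ hx hy hxy hxs hys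
  filter_upwards [hn, hxr, hyr, hne] with j h1 h2 h3 h4
  exact h1 (xs j, ys j) ⟨h2, h3, h4⟩

end Pattern

/-! ### Invariance under translation equivalence and closed sets in strata. -/

namespace TranslationSurface

variable {k : ℕ} {α : Fin k → ℕ}

theorem IsTranslationEquiv.symm {M N : TranslationSurface α} {f : M ≃ₜ N}
    (hf : IsTranslationEquiv M N f) : IsTranslationEquiv N M f.symm := by
  refine ⟨fun i => by rw [← hf.map_sing i, f.symm_apply_apply], ?_⟩
  intro φ hφ ψ hψ p hp hp'
  have h := hf.translation ψ hψ φ hφ (f.symm p) hp' (by simpa using hp)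
  have h2 := f.symm.continuous.continuousAt.eventually h
  filter_upwards [h2] with q hq
  simp only [f.apply_symm_apply] at hq
  linear_combination -hq

theorem IsTranslationEquiv.mem_singSet {M N : TranslationSurface α} {f : M ≃ₜ N}
    (hf : IsTranslationEquiv M N f) {p : M} : f p ∈ N.singSet ↔ p ∈ M.singSet := by
  constructor
  · rintro ⟨i, hi⟩
    rw [← hf.map_sing i] at hi
    exact ⟨i, f.injective hi⟩
  · rintro ⟨i, rfl⟩
    exact ⟨i, (hf.map_sing i).symm⟩

theorem IsTranslationEquiv.isSegment {M N : TranslationSurface α} {f : M ≃ₜ N}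
    (hf : IsTranslationEquiv M N f) {x y : M} {γ : ℝ → M} {w : ℂ} (hγ : M.IsSegment x y γ w) :
    N.IsSegment (f x) (f y) (f ∘ γ) w where
  continuousOn := f.continuous.comp_continuousOn hγ.continuousOn
  start := congrArg f hγ.start
  finish := congrArg f hγ.finish
  flat t ht := by
    have h := hγ.flat t ht
    refine ⟨f.continuous.continuousAt.comp h.continuousAt, fun hs => h.regular (hf.mem_singSet.1 hs),
      fun ψ hψ hz => ?_⟩
    obtain ⟨φ, hφ, hzφ⟩ := M.exists_chart h.regular
    filter_upwards [h.straight φ hφ hzφ,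
      h.continuousAt.eventually (hf.translation φ hφ ψ hψ _ hzφ hz)] with s h1 h2
    simp only [Function.comp_apply]
    linear_combination h1 + h2
  ne_zero := hγ.ne_zero

/-- Trajectories of `N` pull back along `f.symm`, so the image of a blocking set blocks. Conditions
on blocking cardinalities thus descend to the stratum. -/
theorem IsTranslationEquiv.bc_le {M N : TranslationSurface α} {f : M ≃ₜ N}
    (hf : IsTranslationEquiv M N f) {x y : M} {n : ℕ} (h : M.bc x y ≤ n) :
    N.bc (f x) (f y) ≤ n := by
  classical
  obtain ⟨B, ⟨hx, hy, hB⟩, hc⟩ := bc_le_iff.1 h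
  refine bc_le_iff.2 ⟨B.map f.toEquiv.toEmbedding, ⟨?_, ?_, fun γ hγ => ?_⟩, ?_⟩
  · simpa using hx
  · simpa using hy
  · obtain ⟨w, hw⟩ := hγ.exists_isSegment
    have hw' := hf.symm.isSegment hw
    rw [f.symm_apply_apply, f.symm_apply_apply] at hw'
    obtain ⟨t, ht, htB⟩ := hB _ hw'.isTrajectory
    exact ⟨t, ht, Finset.mem_map.2 ⟨_, htB, by simp⟩⟩
  · rwa [Finset.card_map]

end TranslationSurface

/-- A set of translation surfaces closed under limits of edge holonomies is closed in the
stratum. -/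
theorem Stratum.isClosed_of_tendsto {k : ℕ} {α : Fin k → ℕ} {P : TranslationSurface α → Prop}
    (hP : ∀ {M N : TranslationSurface α}, M ≈ N → P M → P N)
    (hlim : ∀ (T : Pattern k) (R₀ : T.Realization α) (U : Ultrafilter (T.Realization α)),
      Tendsto (fun R : T.Realization α => R.hol) U (𝓝 R₀.hol) →
      (∀ᶠ R in (U : Filter (T.Realization α)), P R.surface) → P R₀.surface) :
    IsClosed {X : Stratum α | ∃ M, M.toStratum = X ∧ P M} := by
  have hmem : ∀ M : TranslationSurface α,
      M.toStratum ∈ {X : Stratum α | ∃ M, M.toStratum = X ∧ P M} ↔ P M := by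
    intro M
    constructor
    · rintro ⟨N, hN, hPN⟩
      exact hP (Quotient.exact hN) hPN
    · exact fun h => ⟨M, rfl, h⟩
  -- In the final topology a set is closed when its preimage under every pattern is. Realizations
  -- carry the topology induced by `hol`, so only convergence of holonomies matters.
  rw [isClosed_iSup_iff]
  intro T
  rw [isClosed_coinduced]
  let _ : TopologicalSpace (T.Realization α) :=
    TopologicalSpace.induced (fun R : T.Realization α => R.hol) inferInstance
  refine isClosed_iff_ultrafilter.2 fun R₀ U hU hUS => ?_
  have h1 : Tendsto (fun R : T.Realization α => R.hol) U (𝓝 R₀.hol) :=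
    (continuous_induced_dom.tendsto R₀).mono_left hU
  exact (hmem _).2 (hlim T R₀ U h1 (by filter_upwards [hUS] with R hR using (hmem _).1 hR))

/-- Marked points are labelled points, hence vertices of every triangulation; their launches
therefore come from corners and not from flat discs. -/
theorem isClosed_markedBlocked {k : ℕ} (α : Fin k → ℕ) (n : ℕ) :
    IsClosed (markedBlocked α n) := by
  refine Stratum.isClosed_of_tendsto (P := fun M : TranslationSurface (addTwoMarked α) =>
    M.bc (M.sing (Fin.natAdd k 0)) (M.sing (Fin.natAdd k 1)) ≤ n) ?_ ?_
  · rintro M N ⟨f, hf⟩ h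
    have := hf.bc_le h
    rwa [hf.map_sing, hf.map_sing] at this
  · intro T R₀ U hU hn
    refine Pattern.bc_sing_le hU ?_ hn
    simp [Fin.ext_iff]

theorem isClosed_regularBlocking {k : ℕ} (α : Fin k → ℕ) (n : ℕ) :
    IsClosed (regularBlocking α n) := by
  refine Stratum.isClosed_of_tendsto (P := fun M : TranslationSurface α =>
    ∀ p ∈ M.regularPairs, M.bc p.1 p.2 ≤ n) ?_ ?_
  · rintro M N ⟨f, hf⟩ h ⟨x, y⟩ ⟨hx, hy, hxy⟩
    have hs := hf.symm
    have := hf.bc_le (h (f.symm x, f.symm y) ⟨fun h' => hx (hs.mem_singSet.1 h'),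
      fun h' => hy (hs.mem_singSet.1 h'), fun h' => hxy (f.symm.injective h')⟩)
    simpa using this
  · intro T R₀ U hU hn
    exact Pattern.bc_regularPairs_le hU hn

/-- A subset `A` of `S` is closed relative to `S` exactly when `A = S ∩ closure A`; the first two
clauses express relative closedness in this form. -/
theorem lemma3p1 {k : ℕ} (hk : k ≠ 0) (α : Fin k → ℕ) (n : ℕ) :
    (∀ M : TranslationSurface α,
      M.blockedPairs n = M.regularPairs ∩ closure (M.blockedPairs n)) ∧
    (∀ M : TranslationSurface α, ∀ x : M, x ∉ M.singSet →
      M.blockedFrom x n = M.regularPointsNe x ∩ closure (M.blockedFrom x n)) ∧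
    IsClosed (markedBlocked α n) ∧
    IsClosed (regularBlocking α n) ∧
    ∃ ℓ : ℕ, ∀ M : TranslationSurface α,
      Dense {p : M × M | M.bc p.1 p.2 ≤ n} → M.BoundedBlocking ℓ :=
  ⟨fun M => M.blockedPairs_eq n, fun M _ hx => M.blockedFrom_eq hx n, isClosed_markedBlocked α n,
    isClosed_regularBlocking α n, _, fun _ hd => TranslationSurface.boundedBlocking_of_dense hd⟩
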